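/- **Setting.** Let $d\ge 1$, $m\ge 2$ be integers, $\langle x\rangle=(1+|x|^2)^{1/2}$, $z^+=z$, $z^-=\overline z$. Distributions on $\mathbb T^d$ are identified with their Fourier coefficients $(\widehat u_k)_{k\in\mathbb Z^d}$, and $\|u\|_{H^s}^2=\sum_k\langle k\rangle^{2s}|\widehat u_k|^2$. *Path.* $W:\mathbb R\to\mathbb R$ is continuous and $(\rho,\gamma)$-irregular with $\rho>0$, $\gamma\in(\tfrac12,1)$: with the occupation measures $\mu_{[a,b]}(A)=\mathrm{Leb}\{t\in[a,b]:W_t\in A\}$, for every $R>0$ there is $C$ with $\langle\xi\rangle^\rho|\widehat{\mu_{[a,b]}}(\xi)|\le C|b-a|^\gamma$ for all $-R\le a\le b\le R$, $\xi\in\mathbb R$. *Equation.* $L$ has symbol $i\varphi(k)$ with $\varphi\in C(\mathbb R^d;\mathbb R)$. Let $\pm_0=-$, let $\pm_1,\dots,\pm_m$ be signs, $\Gamma=\{(k_0,\dots,k_m)\in(\mathbb Z^d)^{m+1}:\sum_{j=0}^m\pm_jk_j=0\}$, and $\widehat{\mathcal N}:\Gamma\to\mathbb C$. Put $$\widehat{\mathcal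 N(u_1,\dots,u_m)}(k_0)=\sum_{k_1,\dots,k_m:\,(k_0,\dots,k_m)\in\Gamma}\widehat{\mathcal N}(k_0,\dots,k_m)\prod_{j=1}^m\big(\widehat{(u_j)}_{k_j}\big)^{\pm_j},\qquad \mathcal N(u)=\mathcal N(u,\dots,u).$$ Assume that for some $\beta_0,\dots,\beta_m\ge0$, $C>0$: $|\widehat{\mathcal N}(k_0,\dots,k_m)|\le C\prod_{j=0}^m\langle k_j\rangle^{\beta_j}$ on $\Gamma$; and that for some $\alpha_1>0$, $\alpha_2\ge0$, $c>0$, for all $(k_0,\dots,k_m)\in\Gamma$ with $\widehat{\mathcal N}(k_0,\dots,k_m)\ne0$, $$\Big|\sum_{j=0}^m\pm_j\varphi(k_j)\Big|\ge c\,\langle k_0^*\rangle^{\alpha_1}\langle k_2^*\rangle^{\alpha_2},$$ where $|k_0^*|\ge|k_1^*|\ge\dots\ge|k_m^*|$ is the decreasing rearrangement. *Condition on $\rho$.* Let $s\in\mathbb R$, and let $\beta_1^*\ge\dots\ge\beta_m^*$ be the decreasing rearrangement of $(\beta_1,\dots,\beta_m)$. Assume $$\begin{cases}\rho\ge\alpha_1^{-1}(\beta_0+\beta_1^*),\qquad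 \rho\ge\alpha_1^{-1}(\beta_1^*+\beta_2^*-2s),\\ \rho>(\alpha_1+\alpha_2)^{-1}\big(\beta_1^*+\beta_2^*-2s+\sum_{\ell=2}^{L}(\beta_{\ell+1}^*+\frac d2-s)\big)\ \text{ for } 2\le L\le m-1,\\ \rho>(\alpha_1+\alpha_2)^{-1}\big(\beta_1^*+\beta_2^*+\beta_0+\frac d2-s+\sum_{\ell=2}^{L-1}(\beta_{\ell+1}^*+\frac d2-s)\big)\ \text{ for } 2\le L\le m.\end{cases}$$ *Spaces.* A $U^2([0,T))L^2$-atom is $A=\sum_{k=1}^K\mathbf 1_{[t_{k-1},t_k)}\psi_k$ with $0=t_0\le\dots\le t_K=T$, $\psi_k\in L^2(\mathbb T^d)$, $\sum_k\|\psi_k\|_{L^2}^2\le1$, and $\|f\|_{U^2}=\inf\{\sum_j|\lambda_j|: f=\sum_j\lambda_jA_j,\ A_j \text{ atoms}\}$. For dyadic $N=2^n$, $n\ge0$, $P_N$ is the projection onto the frequencies $N/2<|k|\le N$ ($|k|\le1$ if $N=1$). Then $\|u\|_{X^s_T}^2=\sum_NN^{2s}\|e^{W_tL}P_Nu\|_{U^2([0,T))L^2}^2$.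 *Mild solutions.* $u$ is a mild solution on $[0,T)$ of $$\partial_tu+\frac{dW}{dt}Lu+\mathcal N(u)=0,\qquad u|_{t=0}=u_0,$$ if for $t\in[0,T)$, $u(t)=e^{-(W_t-W_0)L}u_0-\int_0^te^{-(W_t-W_\tau)L}\mathcal N(u(\tau))\,d\tau$, where the integral stands for the sum over dyadic $N_1,\dots,N_m$ of $\int_0^te^{-(W_t-W_\tau)L}\mathcal N(P_{N_1}u(\tau),\dots,P_{N_m}u(\tau))\,d\tau$, each Fourier coefficient of which is required to converge unconditionally. **Theorem.** The equation is locally well-posed in $H^s(\mathbb T^d)$. Precisely, there are $T:[0,\infty)\to(0,\infty)$ and $K\ge 0$ such that for every $R\ge0$, with $T=T(R)$: (i) for every $u_0$ with $\|u_0\|_{H^s}\le R$ there is a unique mild solution $u\in C([0,T);H^s(\mathbb T^d))\cap X^s_T$ with $u|_{t=0}=u_0$ (in particular one may take $T=T(\|u_0\|_{H^s})$); (ii) if moreover $u_0\in H^\sigma(\mathbb T^d)$ with $\sigma\ge s$, then $u\in C([0,T);H^\sigma(\mathbb T^d))\cap X^\sigma_T$, with the same $T$; (iii) if $u,v$ are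 the solutions with data $u_0,v_0$ of $H^s$-norm at most $R$, then $$\sup_{0\le t<T}\|u(t)-v(t)\|_{H^s}+\|u-v\|_{X^s_T}\le K\|u_0-v_0\|_{H^s}.$$ Solutions here are complex-valued; if $L$ and $\mathcal N$ map real-valued functions to real-valued functions and $u_0$ is real-valued, then so is $u$. -/

import Mathlib

open Set Filter Topology MeasureTheory
open scoped ENNReal NNReal

noncomputable section

namespace ModDisp

/-! ### Elementary notation -/

/-- The bracket `⟨r⟩ = (1 + r²)^{1/2}`. -/
def bracket (r : ℝ) : ℝ := Real.sqrt (1 + r ^ 2)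

/-- The Euclidean length `|k|` of a frequency `k ∈ ℤ^d`. -/
def freqNorm {d : ℕ} (k : Fin d → ℤ) : ℝ := Real.sqrt (∑ i, (k i : ℝ) ^ 2)

/-- The decreasing rearrangement: `nthLargest x i` is the entry of index `i` (starting from `0`)
of the tuple `x` once it is sorted in decreasing order (and `0` if there is no such entry). -/
def nthLargest {n : ℕ} (x : Fin n → ℝ) (i : ℕ) : ℝ :=
  if h : i < n then x (Tuple.sort x (Fin.rev ⟨i, h⟩)) else 0

/-! ### Irregularity of the path -/

/-- The occupation measure of `W` on the time set `J`: `μ_J(A) = Leb {t ∈ J : W t ∈ A}`. -/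
def occupationMeasure (W : ℝ → ℝ) (J : Set ℝ) : Measure ℝ := (volume.restrict J).map W

/-- `(ρ, γ)`-irregularity of a continuous path: `t ↦ μ_{[0,t]}` is (locally in time) `γ`-Hölder
with values in the Fourier-Lebesgue space `𝓕L^{ρ,∞}(ℝ)`, whose norm is the supremum over `ξ` of
`⟨ξ⟩^ρ` times the modulus of the Fourier transform. The increment of `μ_{[0,·]}` between
`a` and `b` is `μ_{[a,b]}`. If the occupation measure has a density (the local time), then its
Fourier transform is the one of that density. -/
structure IsIrregular (ρ γ : ℝ) (W : ℝ → ℝ) : Prop where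
  continuous : Continuous W
  holder : ∀ R : ℝ, 0 < R → ∃ C : ℝ, ∀ a b : ℝ, -R ≤ a → a ≤ b → b ≤ R → ∀ ξ : ℝ,
    bracket ξ ^ ρ * ‖charFun (occupationMeasure W (Icc a b)) ξ‖ ≤ C * (b - a) ^ γ

/-! ### Distributions on the torus, Sobolev spaces, linear propagator

A distribution on `𝕋^d` is represented by the family of its Fourier coefficients. -/

/-- Families of Fourier coefficients indexed by `ℤ^d`. -/
abbrev Coeffs (d : ℕ) : Type := (Fin d → ℤ) → ℂ

/-- The norm of `H^s(𝕋^d)`, with values in `[0, ∞]`; `a ∈ H^s` means that it is finite. -/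
def sobolevNorm {d : ℕ} (s : ℝ) (a : Coeffs d) : ℝ≥0∞ :=
  (∑' k, ENNReal.ofReal (bracket (freqNorm k) ^ (2 * s)) * ‖a k‖ₑ ^ 2) ^ (1 / 2 : ℝ)

/-- The value at `k ∈ ℤ^d` of a multiplier given on `ℝ^d`. -/
def atFreq {d : ℕ} (φ : (Fin d → ℝ) → ℝ) (k : Fin d → ℤ) : ℝ := φ (fun i => (k i : ℝ))

/-- The unitary group `e^{cL}` of the skew-adjoint operator `L` with symbol `i φ(k)`. -/
def propagator {d : ℕ} (φ : (Fin d → ℝ) → ℝ) (c : ℝ) (a : Coeffs d) : Coeffs d :=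
  fun k => Complex.exp (Complex.I * ((c * atFreq φ k : ℝ) : ℂ)) * a k

/-- The projection `P_{≤ r}` onto the frequencies `|k| ≤ r`. -/
def lowProj {d : ℕ} (r : ℝ) (a : Coeffs d) : Coeffs d :=
  fun k => if freqNorm k ≤ r then a k else 0

/-- The dyadic projection `P_N`, `N = 2^n`: `P_1 = P_{≤ 1}` and `P_N = P_{≤ N} - P_{≤ N/2}` for
`N ≥ 2`, so that the `P_N` sum up to the identity. -/
def dyadicProj {d : ℕ} (n : ℕ) (a : Coeffs d) : Coeffs d :=
  lowProj (2 ^ n) a - if n = 0 then 0 else lowProj (2 ^ n / 2) a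

/-- `L²(𝕋^d)`, through Plancherel. -/
abbrev L2 (d : ℕ) : Type := lp (fun _ : Fin d → ℤ => ℂ) 2

theorem finite_freqNorm_le (d : ℕ) (r : ℝ) : {k : Fin d → ℤ | freqNorm k ≤ r}.Finite := by
  refine (Set.finite_Icc (fun _ : Fin d => -⌈r⌉) (fun _ => ⌈r⌉)).subset ?_
  intro k hk
  have key : ∀ i, |(k i : ℝ)| ≤ r := fun i => by
    refine le_trans ?_ (show freqNorm k ≤ r from hk)
    unfold freqNorm
    refine Real.abs_le_sqrt ?_
    exact Finset.single_le_sum (f := fun i => (k i : ℝ) ^ 2) (fun j _ => sq_nonneg _)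
      (Finset.mem_univ i)
  constructor
  · intro i
    have h1 := neg_le_of_abs_le (key i)
    have h2 := Int.le_ceil r
    have : ((-⌈r⌉ : ℤ) : ℝ) ≤ (k i : ℝ) := by push_cast; linarith
    exact_mod_cast this
  · intro i
    have h1 := le_of_abs_le (key i)
    have h2 := Int.le_ceil r
    have : (k i : ℝ) ≤ ((⌈r⌉ : ℤ) : ℝ) := by linarith
    exact_mod_cast this

theorem memlp_dyadicProj {d : ℕ} (n : ℕ) (a : Coeffs d) : Memℓp (dyadicProj n a) 2 := by
  have hlow : ∀ r : ℝ, Memℓp (lowProj r a) 2 := fun r => by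
    have h0 : Memℓp (lowProj r a) 0 := by
      refine memℓp_zero ((finite_freqNorm_le d r).subset ?_)
      intro k hk
      by_contra h
      exact hk (by simp only [lowProj]; exact if_neg h)
    exact h0.of_exponent_ge (by simp)
  unfold dyadicProj
  refine (hlow _).sub ?_
  split_ifs
  · exact zero_memℓp
  · exact hlow _

/-- `P_N a`, `N = 2^n`, as an element of `L²(𝕋^d)`. -/
def block {d : ℕ} (n : ℕ) (a : Coeffs d) : L2 d := ⟨dyadicProj n a, memlp_dyadicProj n a⟩

/-! ### The function spaces -/

/-- `U^p([a, b)) H`-atoms: step functions `∑_{k=1}^K 1_{[t_{k-1}, t_k)} ψ_k` with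
`a = t_0 ≤ ... ≤ t_K = b` and `∑ ‖ψ_k‖^p ≤ 1`. -/
def IsUAtom {H : Type*} [NormedAddCommGroup H] (p a b : ℝ) (A : ℝ → H) : Prop :=
  ∃ (K : ℕ) (t : Fin (K + 1) → ℝ) (ψ : Fin K → H),
    Monotone t ∧ t 0 = a ∧ t (Fin.last K) = b ∧ ∑ k, ‖ψ k‖ ^ p ≤ 1 ∧
    ∀ τ ∈ Ico a b, A τ = ∑ k, (Ico (t k.castSucc) (t k.succ)).indicator (fun _ => ψ k) τ

/-- The norm of `U^p([a, b)) H`: the infimum of `∑ |c_j|` over the atomic decompositions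
`f = ∑ c_j A_j` on `[a, b)`. It is `∞` exactly if `f` is not in `U^p([a, b)) H`. -/
def uNorm {H : Type*} [NormedAddCommGroup H] [NormedSpace ℂ H] (p a b : ℝ) (f : ℝ → H) : ℝ≥0∞ :=
  ⨅ (c : ℕ → ℂ) (A : ℕ → ℝ → H) (_ : ∀ j, IsUAtom p a b (A j))
    (_ : ∀ t ∈ Ico a b, HasSum (fun j => c j • A j t) (f t)), ∑' j, ‖c j‖ₑ

/-- The norm of `X^s_T`: the square root of `∑_N N^{2s} ‖e^{W_t L} P_N u‖²_{U²([0,T)) L²}`. -/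
def xNorm {d : ℕ} (φ : (Fin d → ℝ) → ℝ) (W : ℝ → ℝ) (s T : ℝ) (u : ℝ → Coeffs d) : ℝ≥0∞ :=
  (∑' n : ℕ, ENNReal.ofReal (((2 : ℝ) ^ n) ^ (2 * s)) *
    uNorm 2 0 T (fun t => block n (propagator φ (W t) (u t))) ^ 2) ^ (1 / 2 : ℝ)

/-- The norm of `C([0,T); H^s)`. -/
def supNorm {d : ℕ} (s T : ℝ) (u : ℝ → Coeffs d) : ℝ≥0∞ :=
  ⨆ t ∈ Ico 0 T, sobolevNorm s (u t)

/-- `u ∈ C([0,T); H^s(𝕋^d)) ∩ X^s_T`. -/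
structure InSolutionSpace {d : ℕ} (φ : (Fin d → ℝ) → ℝ) (W : ℝ → ℝ) (s T : ℝ)
    (u : ℝ → Coeffs d) : Prop where
  mem_sobolev : ∀ t ∈ Ico 0 T, sobolevNorm s (u t) < ∞
  continuous : ∀ t ∈ Ico 0 T,
    Tendsto (fun τ => sobolevNorm s (u τ - u t)) (𝓝[Ico 0 T] t) (𝓝 0)
  mem_x : xNorm φ W s T u < ∞

/-! ### The nonlinearity -/

/-- The convolution set `Γ^{m+1}`: the `(k_0, ..., k_m)` with `∑ ±_j k_j = 0`. -/
def Gam (d : ℕ) {m : ℕ} (ε : Fin (m + 1) → ℤˣ) : Set (Fin (m + 1) → Fin d → ℤ) :=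
  {k | ∑ j, (ε j : ℤ) • k j = 0}

/-- `z^+ = z` and `z^-` is the complex conjugate of `z`. -/
def signConj (e : ℤˣ) (z : ℂ) : ℂ := if e = 1 then z else starRingEnd ℂ z

/-- The Fourier coefficient at `k₀` of the `m`-linear form of the nonlinearity with signs `ε` and
multiplier `Nhat`, evaluated at `v 0, ..., v (m-1)`. The nonlinearity itself is its value on the
diagonal. -/
def nonlin {d m : ℕ} (ε : Fin (m + 1) → ℤˣ) (Nhat : (Fin (m + 1) → Fin d → ℤ) → ℂ)
    (v : Fin m → Coeffs d) : Coeffs d := fun k₀ =>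
  ∑' k : Fin m → Fin d → ℤ, (Gam d ε).indicator
    (fun κ => Nhat κ * ∏ j : Fin m, signConj (ε j.succ) (v j (κ j.succ)))
    (Fin.cons k₀ k : Fin (m + 1) → Fin d → ℤ)

/-- Symbol bound of the nonlinearity: `|Nhat(k_0, ..., k_m)| ≤ C ∏ ⟨k_j⟩^{β_j}` on `Γ^{m+1}`,
with `β_j ≥ 0`. -/
def SymbolBound {d m : ℕ} (ε : Fin (m + 1) → ℤˣ) (Nhat : (Fin (m + 1) → Fin d → ℤ) → ℂ)
    (β : Fin (m + 1) → ℝ) : Prop :=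
  (∀ j, 0 ≤ β j) ∧ ∃ C : ℝ, 0 < C ∧ ∀ k ∈ Gam d ε,
    ‖Nhat k‖ ≤ C * ∏ j, bracket (freqNorm (k j)) ^ β j

/-- The resonance function `∑ ±_j φ(k_j)`. -/
def resonance {d m : ℕ} (φ : (Fin d → ℝ) → ℝ) (ε : Fin (m + 1) → ℤˣ)
    (k : Fin (m + 1) → Fin d → ℤ) : ℝ := ∑ j, ((ε j : ℤ) : ℝ) * atFreq φ (k j)

/-- Strong non-resonance: on the part of `Γ^{m+1}` where `Nhat ≠ 0`, the resonance function is at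
least `c ⟨k_0^*⟩^{α₁} ⟨k_2^*⟩^{α₂}` in modulus, where `|k_0^*| ≥ |k_1^*| ≥ |k_2^*| ≥ ...` is the
decreasing rearrangement. -/
def StronglyNonResonant {d m : ℕ} (φ : (Fin d → ℝ) → ℝ) (ε : Fin (m + 1) → ℤˣ)
    (Nhat : (Fin (m + 1) → Fin d → ℤ) → ℂ) (α₁ α₂ : ℝ) : Prop :=
  0 < α₁ ∧ 0 ≤ α₂ ∧ ∃ c : ℝ, 0 < c ∧ ∀ k ∈ Gam d ε, Nhat k ≠ 0 →
    c * bracket (nthLargest (fun j => freqNorm (k j)) 0) ^ α₁ *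
      bracket (nthLargest (fun j => freqNorm (k j)) 2) ^ α₂ ≤ |resonance φ ε k|

/-- `β_j^*` for `1 ≤ j ≤ m`: the `j`-th entry of the decreasing rearrangement of
`(β_1, ..., β_m)` (without `β_0`). -/
def betaStar {m : ℕ} (β : Fin (m + 1) → ℝ) (j : ℕ) : ℝ :=
  nthLargest (fun i : Fin m => β i.succ) (j - 1)

/-- `ρ` is large enough with respect to `α`, `β` and `s`. -/
structure EnoughIrregularity (d : ℕ) {m : ℕ} (α₁ α₂ : ℝ) (β : Fin (m + 1) → ℝ) (s ρ : ℝ) :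
    Prop where
  high_low : (β 0 + betaStar β 1) / α₁ ≤ ρ
  high_high : (betaStar β 1 + betaStar β 2 - 2 * s) / α₁ ≤ ρ
  sum_before : ∀ L : ℕ, 2 ≤ L → L ≤ m - 1 →
    (betaStar β 1 + betaStar β 2 - 2 * s +
      ∑ l ∈ Finset.Icc 2 L, (betaStar β (l + 1) + (d : ℝ) / 2 - s)) / (α₁ + α₂) < ρ
  sum_after : ∀ L : ℕ, 2 ≤ L → L ≤ m →
    (betaStar β 1 + betaStar β 2 + β 0 + (d : ℝ) / 2 - s +
      ∑ l ∈ Finset.Icc 2 (L - 1), (betaStar β (l + 1) + (d : ℝ) / 2 - s)) / (α₁ + α₂) < ρ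

/-! ### Mild solutions -/

/-- The Duhamel formula
`u(t) = e^{-(W_t - W_0)L} u₀ - ∫_0^t e^{-(W_t - W_τ)L} N(u(τ)) dτ` on `[0, T)`, in the sense of
distributions on the torus (Fourier coefficient by Fourier coefficient). Since `N(u(τ))` need not
make sense at a fixed time for `u(τ)` of low regularity, the time integral of the nonlinearity is
the unconditional sum over the dyadic numbers `N_1, ..., N_m` of the time integrals of
`N(P_{N_1} u(τ), ..., P_{N_m} u(τ))`, and the convergence of this sum is part of the definition. -/
def IsMildSolution {d m : ℕ} (φ : (Fin d → ℝ) → ℝ) (W : ℝ → ℝ) (ε : Fin (m + 1) → ℤˣ)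
    (Nhat : (Fin (m + 1) → Fin d → ℤ) → ℂ) (u₀ : Coeffs d) (T : ℝ) (u : ℝ → Coeffs d) : Prop :=
  ∀ t ∈ Ico 0 T, ∀ k₀ : Fin d → ℤ,
    HasSum
      (fun n : Fin m → ℕ => ∫ τ in (0 : ℝ)..t,
        propagator φ (-(W t - W τ)) (nonlin ε Nhat (fun j => dyadicProj (n j) (u τ))) k₀)
      (propagator φ (-(W t - W 0)) u₀ k₀ - u t k₀)

/-- `u` is a mild solution with data `u₀` in the class `C([0,T); H^s) ∩ X^s_T`. -/
def IsSolution {d m : ℕ} (φ : (Fin d → ℝ) → ℝ) (W : ℝ → ℝ) (ε : Fin (m + 1) → ℤˣ)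
    (Nhat : (Fin (m + 1) → Fin d → ℤ) → ℂ) (s : ℝ) (u₀ : Coeffs d) (T : ℝ)
    (u : ℝ → Coeffs d) : Prop :=
  InSolutionSpace φ W s T u ∧ IsMildSolution φ W ε Nhat u₀ T u

/-! ### Real-valued equations -/

/-- Fourier coefficients of a real-valued distribution. -/
def IsRealValued {d : ℕ} (a : Coeffs d) : Prop := ∀ k, a (-k) = starRingEnd ℂ (a k)

/-- The operator `L` and the nonlinearity map real-valued functions (it is enough to consider
trigonometric polynomials) to real-valued functions. -/
def IsRealEquation {d m : ℕ} (φ : (Fin d → ℝ) → ℝ) (ε : Fin (m + 1) → ℤˣ)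
    (Nhat : (Fin (m + 1) → Fin d → ℤ) → ℂ) : Prop :=
  (∀ k : Fin d → ℤ, atFreq φ (-k) = -atFreq φ k) ∧
  ∀ a : Coeffs d, a.support.Finite → IsRealValued a → IsRealValued (nonlin ε Nhat (fun _ => a))

end ModDisp

end

/-!
# Local well-posedness of modulated dispersive equations

In the interaction picture `v(t) = e^{W_t L} u(t)` the equation becomes
`v(t) = v(0) - ∫_0^t N_τ(v(τ)) dτ`, where the multiplier of `N_τ` is that of the nonlinearity times
`e^{-i W_τ Ω}` with the resonance function `Ω` (`isMildSolution_iff`). For inputs which do not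
depend on time, irregularity of `W` bounds the integral of the phase over `[σ, τ)` by
`⟨Ω⟩^{-ρ} (τ - σ)^γ`, so that the time integral regains `ρ` powers of the resonance function.

*From constant inputs to `U²`.* Let the inputs be step functions whose values are square-summable.
On each cell of the common refinement of their partitions the inputs are constant. A nonempty cell
is determined by the interval, of one of the partitions, together with which it ends; therefore the
products of the values are square-summable over the cells (`sum_cell_prod_le`), and so are the
`γ`-th powers of the lengths of the cells, because `γ > 1/2`. By Cauchy-Schwarz the bound for
constant inputs survives, with the factor `(b - a)^γ` (`enorm_block_integral_le`). Consequently the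
Duhamel integral is `γ`-Hölder in time, and Hölder functions of exponent above `1/2` lie in `U²`,
as one sees from their interpolations on dyadic meshes (`uNorm_le_of_holder`). This makes duality
for `U²` unnecessary.

*Frequencies.* On the convolution set the two largest frequencies are comparable. These two are
estimated in `ℓ²`, the others in `ℓ¹` by Bernstein's inequality. The conditions on `ρ` make up for
all powers of the frequencies that occur, with some `η > 0` to spare at the smaller ones
(`exists_gap`, `exponent_le`). The outcome is the bound `exists_duhBound` for each dyadic piece, with a kernel in
the dyadic levels that sums as a convolution would (`l2_ker_tame_le`). Since the output level
cannot exceed all input levels by much, a slowly varying weight on the output can be moved to one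
of the inputs, which gives the tame estimate `xw_duhamel_le`.

*Conclusion.* The Duhamel operator starting at time `a` is Lipschitz on bounded sets of the `U²`
based space on `[a, b)`, with constant `O((b - a)^γ)` (`xw_duhamel_sub_le`). Existence follows by
iteration (`exists_isIntSol`), and uniqueness without a smallness assumption by restarting the
equation on short intervals (`IsIntSol.unique`). In the tame estimate the higher norm enters
linearly and the length of the admissible step depends on the lower norm only, so higher
regularity persists on the whole interval (`IsIntSol.xw_higher_ne_top`). Continuity in time comes
from the factor `(b - a)^γ` and from strong continuity of the unitary group, and real-valuedness
passes from the data to the iterates and to their limit.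
-/

noncomputable section

namespace ModDisp

/-! ### Square-summable sequences with values in `[0, ∞]` -/

/-- The `ℓ²` norm of a family with values in `[0, ∞]`. -/
def l2 {α : Type*} (a : α → ℝ≥0∞) : ℝ≥0∞ := (∑' i, a i ^ 2) ^ (1 / 2 : ℝ)

section l2
variable {α : Type*}

theorem sqrt_sq_ennreal (x : ℝ≥0∞) : (x ^ 2) ^ (1 / 2 : ℝ) = x := by
  rw [← ENNReal.rpow_natCast, ← ENNReal.rpow_mul]; norm_num

theorem sq_sqrt_ennreal (x : ℝ≥0∞) : (x ^ (1 / 2 : ℝ)) ^ 2 = x := by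
  rw [← ENNReal.rpow_natCast, ← ENNReal.rpow_mul]; norm_num

theorem l2_sq (a : α → ℝ≥0∞) : l2 a ^ 2 = ∑' i, a i ^ 2 := sq_sqrt_ennreal _

theorem l2_mono {a b : α → ℝ≥0∞} (h : ∀ i, a i ≤ b i) : l2 a ≤ l2 b := by
  unfold l2
  gcongr with i
  exact h i

theorem le_l2 (a : α → ℝ≥0∞) (i : α) : a i ≤ l2 a := by
  rw [← sqrt_sq_ennreal (a i)]
  unfold l2
  gcongr
  exact ENNReal.le_tsum (f := fun i => a i ^ 2) i

theorem l2_const_mul (c : ℝ≥0∞) (a : α → ℝ≥0∞) : l2 (fun i => c * a i) = c * l2 a := by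
  unfold l2
  simp_rw [mul_pow]
  rw [ENNReal.tsum_mul_left, ENNReal.mul_rpow_of_nonneg _ _ (by norm_num), sqrt_sq_ennreal]

theorem tsum_mul_le_l2 (a b : α → ℝ≥0∞) : ∑' i, a i * b i ≤ l2 a * l2 b := by
  refine ENNReal.summable.tsum_le_of_sum_le fun s => ?_
  refine (ENNReal.inner_le_Lp_mul_Lq s a b Real.HolderConjugate.two_two).trans ?_
  unfold l2
  gcongr
  · simpa using ENNReal.sum_le_tsum (f := fun i => a i ^ 2) s
  · simpa using ENNReal.sum_le_tsum (f := fun i => b i ^ 2) s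

/-- `ℓ²` duality. -/
theorem l2_le_of_dual (b : α → ℝ≥0∞) (C : ℝ≥0∞)
    (h : ∀ a : α → ℝ≥0∞, ∑' i, a i * b i ≤ C * l2 a) : l2 b ≤ C := by
  classical
  rcases eq_or_ne C ⊤ with rfl | hC
  · exact le_top
  have hb : ∀ i, b i ≤ C := fun i => by
    have h1 := h (Pi.single i 1)
    have e1 : l2 (Pi.single i 1 : α → ℝ≥0∞) = 1 := by
      unfold l2
      rw [tsum_eq_single i (fun j hj => by simp [Pi.single_eq_of_ne hj])]
      simp
    rw [e1, tsum_eq_single i (fun j hj => by simp [Pi.single_eq_of_ne hj])] at h1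
    simpa using h1
  rw [← sqrt_sq_ennreal C]
  unfold l2
  gcongr
  refine ENNReal.summable.tsum_le_of_sum_le fun s => ?_
  set x := ∑ i ∈ s, b i ^ 2 with hx
  have hxt : x ≠ ⊤ := by
    refine (ENNReal.sum_lt_top.2 fun i _ => ?_).ne
    exact ENNReal.pow_lt_top ((hb i).trans_lt hC.lt_top)
  have h1 := h (fun i => if i ∈ s then b i else 0)
  have e1 : l2 (fun i => if i ∈ s then b i else 0) = x ^ (1 / 2 : ℝ) := by
    unfold l2
    rw [tsum_eq_sum (s := s) (fun j hj => by simp [hj])]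
    congr 1
    exact Finset.sum_congr rfl fun i hi => by simp [hi]
  rw [e1, tsum_eq_sum (s := s) (fun j hj => by simp [hj])] at h1
  have e2 : ∑ i ∈ s, (if i ∈ s then b i else 0) * b i = x :=
    Finset.sum_congr rfl fun i hi => by simp [hi, sq]
  rw [e2] at h1
  rcases eq_or_ne x 0 with h0 | h0
  · rw [h0]; exact zero_le
  have hy0 : x ^ (1 / 2 : ℝ) ≠ 0 := by simp [h0]
  have hyt : x ^ (1 / 2 : ℝ) ≠ ⊤ := ENNReal.rpow_ne_top_of_nonneg (by norm_num) hxt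
  have h2 : x ^ (1 / 2 : ℝ) * x ^ (1 / 2 : ℝ) ≤ C * x ^ (1 / 2 : ℝ) := by
    rw [← sq, sq_sqrt_ennreal]; exact h1
  have h3 := (ENNReal.mul_le_mul_iff_left hy0 hyt).1 h2
  calc x = (x ^ (1 / 2 : ℝ)) ^ 2 := (sq_sqrt_ennreal x).symm
    _ ≤ C ^ 2 := by gcongr

theorem l2_tsum_le {ι : Type*} (f : ι → α → ℝ≥0∞) :
    l2 (fun k => ∑' i, f i k) ≤ ∑' i, l2 (f i) := by
  refine l2_le_of_dual _ _ fun a => ?_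
  simp_rw [← ENNReal.tsum_mul_left]
  rw [ENNReal.tsum_comm, ← ENNReal.tsum_mul_right]
  refine ENNReal.tsum_le_tsum fun i => ?_
  rw [mul_comm]
  exact tsum_mul_le_l2 _ _

theorem l2_sum_le {ι : Type*} [Fintype ι] (f : ι → α → ℝ≥0∞) :
    l2 (fun k => ∑ i, f i k) ≤ ∑ i, l2 (f i) := by
  simpa only [tsum_fintype] using l2_tsum_le f

theorem l2_add_le (a b : α → ℝ≥0∞) : l2 (fun k => a k + b k) ≤ l2 a + l2 b := by
  have := l2_sum_le (fun i : Fin 2 => if i = 0 then a else b)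
  simpa [Fin.sum_univ_two] using this

theorem l2_iSup_le {f : ℕ → α → ℝ≥0∞} {g : α → ℝ≥0∞} {B : ℝ≥0∞}
    (hg : ∀ k, ∃ M, g k ≤ f M k) (hf : ∀ k, Monotone fun M => f M k)
    (hB : ∀ M, l2 (f M) ≤ B) : l2 g ≤ B := by
  rw [← sqrt_sq_ennreal B]
  unfold l2
  gcongr
  refine ENNReal.summable.tsum_le_of_sum_le fun s => ?_
  choose M hM using hg
  calc ∑ i ∈ s, g i ^ 2 ≤ ∑ i ∈ s, f (s.sup M) i ^ 2 := by
        gcongr with i hi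
        exact (hM i).trans (hf i (Finset.le_sup hi))
    _ ≤ ∑' i, f (s.sup M) i ^ 2 := ENNReal.sum_le_tsum _
    _ = l2 (f (s.sup M)) ^ 2 := (l2_sq _).symm
    _ ≤ B ^ 2 := by gcongr; exact hB _

end l2

/-! ### Sums over tuples -/

section tuples
variable {ι α : Type*} [Fintype ι]

theorem tsum_pi_prod_le (z : ι → α → ℝ≥0∞) :
    ∑' k : ι → α, ∏ j, z j (k j) ≤ ∏ j, ∑' x, z j x := by
  classical
  refine ENNReal.summable.tsum_le_of_sum_le fun s => ?_
  calc ∑ k ∈ s, ∏ j, z j (k j)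
      ≤ ∑ k ∈ Fintype.piFinset (fun j => s.image fun k => k j), ∏ j, z j (k j) := by
        refine Finset.sum_le_sum_of_subset fun k hk => ?_
        rw [Fintype.mem_piFinset]
        exact fun j => Finset.mem_image_of_mem _ hk
    _ = ∏ j, ∑ x ∈ s.image fun k => k j, z j x := (Finset.prod_univ_sum _ _).symm
    _ ≤ ∏ j, ∑' x, z j x := by
        gcongr with j
        exact ENNReal.sum_le_tsum _

theorem tsum_determined_le [DecidableEq ι] (G : Set (ι → α)) (p : ι)
    (hp : ∀ k ∈ G, ∀ k' ∈ G, (∀ j, j ≠ p → k j = k' j) → k = k')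
    (z : ι → α → ℝ≥0∞) :
    ∑' k : ι → α, G.indicator (fun k => ∏ j ∈ Finset.univ.erase p, z j (k j)) k ≤
      ∏ j ∈ Finset.univ.erase p, ∑' x, z j x := by
  rw [← tsum_subtype G (fun k => ∏ j ∈ Finset.univ.erase p, z j (k j))]
  have hs : ∀ f : ι → ℝ≥0∞,
      ∏ j ∈ Finset.univ.erase p, f j = ∏ j : {j // j ≠ p}, f j := fun f => by
    rw [← Finset.prod_subtype (p := fun j => j ≠ p) (Finset.univ.erase p) (by simp)]
  simp_rw [hs]
  refine le_trans ?_ (tsum_pi_prod_le fun j : {j // j ≠ p} => z j)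
  refine ENNReal.tsum_comp_le_tsum_of_injective
    (f := fun (k : G) (j : {j // j ≠ p}) => (k : ι → α) j) ?_
    (fun k : {j // j ≠ p} → α => ∏ j : {j // j ≠ p}, z j (k j))
  intro k k' h
  exact Subtype.ext (hp k k.2 k' k'.2 fun j hj => congrFun h ⟨j, hj⟩)

/-- A sum over tuples on which each of the entries of index `p` and `q` is a function of the
other entries is bounded by the `ℓ²` norms of the factors `p` and `q` and the `ℓ¹` norms of
the others. -/
theorem tsum_indicator_prod_le [DecidableEq ι] (G : Set (ι → α)) (p q : ι) (hpq : p ≠ q)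
    (hp : ∀ k ∈ G, ∀ k' ∈ G, (∀ j, j ≠ p → k j = k' j) → k = k')
    (hq : ∀ k ∈ G, ∀ k' ∈ G, (∀ j, j ≠ q → k j = k' j) → k = k')
    (y : ι → α → ℝ≥0∞) :
    ∑' k : ι → α, G.indicator (fun k => ∏ j, y j (k j)) k ≤
      l2 (y p) * l2 (y q) * ∏ j ∈ (Finset.univ.erase p).erase q, ∑' x, y j x := by
  set R := (Finset.univ.erase p).erase q with hR
  set P : ℝ≥0∞ := ∏ j ∈ R, ∑' x, y j x with hP
  have hqp : q ∈ Finset.univ.erase p := by simp [hpq.symm]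
  have hpq' : p ∈ Finset.univ.erase q := by simp [hpq]
  have hR' : R = (Finset.univ.erase q).erase p := Finset.erase_right_comm
  have key : ∀ (p q : ι), R = (Finset.univ.erase p).erase q → p ≠ q →
      (∀ k ∈ G, ∀ k' ∈ G, (∀ j, j ≠ p → k j = k' j) → k = k') →
      ∑' k : ι → α, G.indicator (fun k => (∏ j ∈ R, y j (k j)) * y q (k q) ^ 2) k ≤
        P * l2 (y q) ^ 2 := by
    intro p q hR hpq hp
    have hqp : q ∈ Finset.univ.erase p := by simp [hpq.symm]
    have h := tsum_determined_le G p hp (fun j x => if j = q then y q x ^ 2 else y j x)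
    have e1 : ∀ k : ι → α, (∏ j ∈ Finset.univ.erase p,
        (fun j x => if j = q then y q x ^ 2 else y j x) j (k j)) =
        (∏ j ∈ R, y j (k j)) * y q (k q) ^ 2 := fun k => by
      rw [← Finset.prod_erase_mul _ _ hqp, ← hR]
      simp only [if_true]
      congr 1
      refine Finset.prod_congr rfl fun j hj => ?_
      have : j ≠ q := by rw [hR] at hj; exact Finset.ne_of_mem_erase hj
      simp [this]
    have e2 : (∏ j ∈ Finset.univ.erase p, ∑' x,
        (fun j x => if j = q then y q x ^ 2 else y j x) j x) = P * l2 (y q) ^ 2 := by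
      rw [← Finset.prod_erase_mul _ _ hqp, ← hR, l2_sq]
      simp only [if_true]
      congr 1
      refine Finset.prod_congr rfl fun j hj => ?_
      have : j ≠ q := by rw [hR] at hj; exact Finset.ne_of_mem_erase hj
      simp [this]
    rw [e2] at h
    simpa only [e1] using h
  have hsq : ∀ x : ℝ≥0∞, x ^ (1 / 2 : ℝ) * x ^ (1 / 2 : ℝ) = x := fun x => by
    rw [← sq, sq_sqrt_ennreal]
  -- Cauchy-Schwarz: in each factor the constraint determines the entry on which nothing depends
  have e3 : ∀ k : ι → α, G.indicator (fun k => ∏ j, y j (k j)) k =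
      G.indicator (fun k => (∏ j ∈ R, y j (k j)) ^ (1 / 2 : ℝ) * y p (k p)) k *
      G.indicator (fun k => (∏ j ∈ R, y j (k j)) ^ (1 / 2 : ℝ) * y q (k q)) k := fun k => by
    by_cases hk : k ∈ G
    · simp only [Set.indicator_of_mem hk]
      rw [← Finset.prod_erase_mul _ _ (Finset.mem_univ p), ← Finset.prod_erase_mul _ _ hqp,
        ← hR, mul_mul_mul_comm, hsq]
      ring
    · simp [Set.indicator_of_notMem hk]
  simp_rw [e3]
  refine (tsum_mul_le_l2 _ _).trans ?_
  have key2 : ∀ (p q : ι), R = (Finset.univ.erase p).erase q → p ≠ q →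
      (∀ k ∈ G, ∀ k' ∈ G, (∀ j, j ≠ p → k j = k' j) → k = k') →
      l2 (fun k => G.indicator (fun k => (∏ j ∈ R, y j (k j)) ^ (1 / 2 : ℝ) * y q (k q)) k) ≤
        P ^ (1 / 2 : ℝ) * l2 (y q) := by
    intro p q hR hpq hp
    have h := key p q hR hpq hp
    rw [← sqrt_sq_ennreal (P ^ (1 / 2 : ℝ) * l2 (y q)), mul_pow, sq_sqrt_ennreal]
    unfold l2 at h ⊢
    refine ENNReal.rpow_le_rpow (le_trans (le_of_eq ?_) h) (by norm_num)
    refine tsum_congr fun k => ?_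
    by_cases hk : k ∈ G
    · simp only [Set.indicator_of_mem hk]
      rw [mul_pow, sq_sqrt_ennreal]
    · simp [Set.indicator_of_notMem hk]
  calc _ ≤ (P ^ (1 / 2 : ℝ) * l2 (y p)) * (P ^ (1 / 2 : ℝ) * l2 (y q)) :=
        mul_le_mul' (key2 q p hR' hpq.symm hq) (key2 p q rfl hpq hp)
    _ = l2 (y p) * l2 (y q) * (P ^ (1 / 2 : ℝ) * P ^ (1 / 2 : ℝ)) := by ring
    _ = _ := by rw [hsq]

end tuples


/-! ### Dyadic levels of frequencies -/

section levels
variable {d : ℕ}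

theorem freqNorm_nonneg (k : Fin d → ℤ) : 0 ≤ freqNorm k := Real.sqrt_nonneg _

theorem exists_freqNorm_le (k : Fin d → ℤ) : ∃ n : ℕ, freqNorm k ≤ 2 ^ n := by
  obtain ⟨n, hn⟩ := pow_unbounded_of_one_lt (freqNorm k) (one_lt_two)
  exact ⟨n, hn.le⟩

open Classical in
/-- The dyadic level of a frequency: the `n` such that `k` is in the range of `P_N`, `N = 2^n`. -/
def lvl (k : Fin d → ℤ) : ℕ := Nat.find (exists_freqNorm_le k)

theorem freqNorm_le_lvl (k : Fin d → ℤ) : freqNorm k ≤ 2 ^ lvl k := by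
  classical
  exact Nat.find_spec (exists_freqNorm_le k)

theorem lvl_le_iff (k : Fin d → ℤ) (n : ℕ) : lvl k ≤ n ↔ freqNorm k ≤ 2 ^ n := by
  refine ⟨fun h => (freqNorm_le_lvl k).trans (pow_le_pow_right₀ one_le_two h), fun h => ?_⟩
  classical
  exact Nat.find_min' _ h

theorem dyadicProj_apply (n : ℕ) (a : Coeffs d) (k : Fin d → ℤ) :
    dyadicProj n a k = if lvl k = n then a k else 0 := by
  unfold dyadicProj lowProj
  rcases n with _ | n
  · have : lvl k = 0 ↔ freqNorm k ≤ 1 := by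
      rw [← Nat.le_zero, lvl_le_iff]; simp
    simp [this]
  · have h1 : (2 : ℝ) ^ (n + 1) / 2 = 2 ^ n := by rw [pow_succ]; ring
    simp only [Nat.add_eq_zero_iff, one_ne_zero, and_false, if_false, Pi.sub_apply, h1,
      ← lvl_le_iff]
    split_ifs with h2 h3 h4 h5 h6 h7
    · omega
    · simp
    · simp
    · omega
    · omega
    · omega
    · omega
    · simp

theorem block_apply (n : ℕ) (a : Coeffs d) (k : Fin d → ℤ) :
    (block n a : Coeffs d) k = if lvl k = n then a k else 0 := dyadicProj_apply n a k

theorem bracket_pos (r : ℝ) : 0 < bracket r := Real.sqrt_pos.2 (by positivity)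

theorem one_le_bracket (r : ℝ) : 1 ≤ bracket r :=
  Real.one_le_sqrt.2 (by nlinarith [sq_nonneg r])

theorem abs_le_bracket (r : ℝ) : |r| ≤ bracket r :=
  Real.abs_le_sqrt (by linarith)

theorem bracket_mono {r t : ℝ} (hr : 0 ≤ r) (h : r ≤ t) : bracket r ≤ bracket t :=
  Real.sqrt_le_sqrt (by nlinarith)

theorem bracket_freqNorm_le (k : Fin d → ℤ) : bracket (freqNorm k) ≤ 2 * 2 ^ lvl k := by
  have h := freqNorm_le_lvl k
  have h1 : (1 : ℝ) ≤ 2 ^ lvl k := one_le_pow₀ one_le_two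
  refine Real.sqrt_le_iff.2 ⟨by positivity, ?_⟩
  nlinarith [freqNorm_nonneg k]

theorem two_pow_lvl_le (k : Fin d → ℤ) : (2 : ℝ) ^ lvl k ≤ 2 * bracket (freqNorm k) := by
  rcases Nat.eq_zero_or_pos (lvl k) with h | h
  · rw [h]; have := one_le_bracket (freqNorm k); simp; linarith
  · obtain ⟨n, hn⟩ := Nat.exists_eq_succ_of_ne_zero h.ne'
    have h1 : ¬ lvl k ≤ n := by omega
    rw [lvl_le_iff, not_le] at h1
    have h2 := abs_le_bracket (freqNorm k)
    rw [abs_of_nonneg (freqNorm_nonneg k)] at h2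
    rw [hn, pow_succ]; linarith

theorem finite_lvl (d n : ℕ) : {k : Fin d → ℤ | lvl k = n}.Finite := by
  refine (finite_freqNorm_le d (2 ^ n)).subset fun k hk => ?_
  exact (lvl_le_iff k n).1 (le_of_eq hk)

/-- The frequencies of level `n`. -/
def shell (d n : ℕ) : Finset (Fin d → ℤ) := (finite_lvl d n).toFinset

@[simp] theorem mem_shell {n : ℕ} {k : Fin d → ℤ} : k ∈ shell d n ↔ lvl k = n := by
  simp [shell]

theorem card_shell_le (d n : ℕ) : ((shell d n).card : ℝ) ≤ 3 ^ d * (2 ^ n) ^ d := by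
  have h : shell d n ⊆ Fintype.piFinset fun _ : Fin d => Finset.Icc (-(2 ^ n : ℤ)) (2 ^ n) := by
    intro k hk
    rw [mem_shell] at hk
    have hk := (lvl_le_iff k n).1 hk.le
    rw [Fintype.mem_piFinset]
    intro i
    have h1 : |(k i : ℝ)| ≤ 2 ^ n := by
      refine le_trans (Real.abs_le_sqrt ?_) hk
      exact Finset.single_le_sum (f := fun i => (k i : ℝ) ^ 2) (fun j _ => sq_nonneg _)
        (Finset.mem_univ i)
    rw [Finset.mem_Icc]
    exact ⟨by exact_mod_cast (abs_le.1 h1).1, by exact_mod_cast (abs_le.1 h1).2⟩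
  have h2 := Finset.card_le_card h
  rw [Fintype.card_piFinset] at h2
  simp only [Int.card_Icc, Finset.prod_const, Finset.card_univ, Fintype.card_fin] at h2
  have h3 : ((2 : ℤ) ^ n + 1 - -2 ^ n).toNat ≤ 3 * 2 ^ n := by
    have h5 : (1 : ℤ) ≤ 2 ^ n := one_le_pow₀ (by norm_num)
    have : ((2 : ℤ) ^ n + 1 - -2 ^ n) ≤ ((3 * 2 ^ n : ℕ) : ℤ) := by push_cast; linarith
    omega
  have h4 : (shell d n).card ≤ (3 * 2 ^ n) ^ d := h2.trans (Nat.pow_le_pow_left h3 d)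
  rw [← mul_pow]
  exact_mod_cast h4

theorem enorm_L2_eq (x : L2 d) : ‖x‖ₑ = l2 fun k => ‖x k‖ₑ := by
  have h := lp.norm_rpow_eq_tsum (p := 2) (by norm_num) x
  have hs : Summable fun k => ‖x k‖ ^ (2 : ℝ) := by
    simpa using (lp.memℓp x).summable (by norm_num)
  rw [← sqrt_sq_ennreal ‖x‖ₑ]
  unfold l2
  congr 1
  have h' : ‖x‖ ^ 2 = ∑' k, ‖x k‖ ^ 2 := by simpa using h
  have hs' : Summable fun k => ‖x k‖ ^ 2 := by simpa using hs
  rw [← ofReal_norm, ← ENNReal.ofReal_pow (norm_nonneg _), h',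
    ENNReal.ofReal_tsum_of_nonneg (fun k => by positivity) hs']
  refine tsum_congr fun k => ?_
  rw [ENNReal.ofReal_pow (norm_nonneg _), ofReal_norm]

theorem enorm_block_eq (n : ℕ) (a : Coeffs d) :
    ‖block n a‖ₑ = l2 fun k => if lvl k = n then ‖a k‖ₑ else 0 := by
  rw [enorm_L2_eq]
  congr 1
  funext k
  rw [block_apply]
  split_ifs <;> simp

theorem enorm_block_le (n : ℕ) (x : L2 d) : ‖block n x‖ₑ ≤ ‖x‖ₑ := by
  rw [enorm_block_eq, enorm_L2_eq]
  refine l2_mono fun k => ?_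
  split_ifs
  · exact le_rfl
  · exact zero_le

theorem enorm_apply_le_block (a : Coeffs d) (k : Fin d → ℤ) : ‖a k‖ₑ ≤ ‖block (lvl k) a‖ₑ := by
  rw [enorm_block_eq]
  refine le_trans ?_ (le_l2 _ k)
  simp

theorem enorm_apply_le (x : L2 d) (k : Fin d → ℤ) : ‖x k‖ₑ ≤ ‖x‖ₑ := by
  rw [enorm_L2_eq]
  exact le_l2 (fun k => ‖x k‖ₑ) k

theorem block_add (n : ℕ) (a b : Coeffs d) : block n (a + b) = block n a + block n b := by
  refine lp.ext (funext fun k => ?_)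
  rw [lp.coeFn_add, Pi.add_apply, block_apply, block_apply, block_apply]
  split_ifs <;> simp

theorem block_sub (n : ℕ) (a b : Coeffs d) : block n (a - b) = block n a - block n b := by
  refine lp.ext (funext fun k => ?_)
  rw [lp.coeFn_sub, Pi.sub_apply, block_apply, block_apply, block_apply]
  split_ifs <;> simp

theorem block_sum {ι : Type*} (s : Finset ι) (n : ℕ) (a : ι → Coeffs d) :
    block n (∑ i ∈ s, a i) = ∑ i ∈ s, block n (a i) := by
  classical
  induction s using Finset.induction_on with
  | empty =>
    refine lp.ext (funext fun k => ?_)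
    simp [block_apply]
  | insert i s hi ih => rw [Finset.sum_insert hi, block_add, ih, Finset.sum_insert hi]

theorem enorm_block_sq (n : ℕ) (a : Coeffs d) :
    ‖block n a‖ₑ ^ 2 = ∑ k ∈ shell d n, ‖a k‖ₑ ^ 2 := by
  rw [enorm_block_eq, l2_sq, tsum_eq_sum (s := shell d n)]
  · refine Finset.sum_congr rfl fun k hk => ?_
    rw [mem_shell] at hk
    simp [hk]
  · intro k hk
    rw [mem_shell] at hk
    simp [hk]

/-- Lower semicontinuity of the norm of a block under convergence of the coefficients. -/
theorem enorm_block_le_of_tendsto {n : ℕ} {A : ℕ → Coeffs d} {a : Coeffs d} {B : ℝ≥0∞}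
    (h : ∀ k, Tendsto (fun M => A M k) atTop (𝓝 (a k))) (hB : ∀ M, ‖block n (A M)‖ₑ ≤ B) :
    ‖block n a‖ₑ ≤ B := by
  have h1 : ‖block n a‖ₑ ^ 2 ≤ B ^ 2 := by
    rw [enorm_block_sq]
    refine le_of_tendsto' (f := fun M => ∑ k ∈ shell d n, ‖A M k‖ₑ ^ 2) (x := atTop) ?_ ?_
    · refine tendsto_finsetSum _ fun k _ => ?_
      exact ((ENNReal.continuous_pow 2).tendsto _).comp ((continuous_enorm.tendsto _).comp (h k))
    · intro M
      rw [← enorm_block_sq]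
      gcongr
      exact hB M
  exact (ENNReal.pow_le_pow_left_iff (two_ne_zero)).1 h1

/-! ### The Sobolev norm in terms of the dyadic blocks -/

/-- The dyadic weight `N^s`, `N = 2^n`. -/
def dyW (s : ℝ) (n : ℕ) : ℝ≥0∞ := ENNReal.ofReal ((2 : ℝ) ^ (s * n))

theorem dyW_ne_zero (s : ℝ) (n : ℕ) : dyW s n ≠ 0 := by
  have : (0 : ℝ) < (2 : ℝ) ^ (s * n) := by positivity
  simpa [dyW] using this

theorem dyW_ne_top (s : ℝ) (n : ℕ) : dyW s n ≠ ⊤ := ENNReal.ofReal_ne_top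

theorem dyW_sq (s : ℝ) (n : ℕ) : dyW s n ^ 2 = ENNReal.ofReal (((2 : ℝ) ^ n) ^ (2 * s)) := by
  unfold dyW
  rw [← ENNReal.ofReal_pow (by positivity)]
  congr 1
  rw [← Real.rpow_natCast, ← Real.rpow_mul (by norm_num), ← Real.rpow_natCast,
    ← Real.rpow_mul (by norm_num)]
  congr 1
  push_cast
  ring

/-- The Sobolev norm with the bracket replaced by the dyadic weight. -/
def hw (w : ℕ → ℝ≥0∞) (a : Coeffs d) : ℝ≥0∞ := l2 fun n => w n * ‖block n a‖ₑ

theorem hw_eq (w : ℕ → ℝ≥0∞) (a : Coeffs d) : hw w a = l2 fun k => w (lvl k) * ‖a k‖ₑ := by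
  unfold hw l2
  congr 1
  simp_rw [mul_pow, enorm_block_eq, l2_sq, ← ENNReal.tsum_mul_left]
  rw [ENNReal.tsum_comm]
  refine tsum_congr fun k => ?_
  rw [tsum_eq_single (lvl k)]
  · simp
  · intro n hn
    simp [hn.symm]

theorem bracket_rpow_le (s : ℝ) (k : Fin d → ℤ) :
    bracket (freqNorm k) ^ s ≤ 2 ^ |s| * 2 ^ (s * lvl k) := by
  have hb := bracket_pos (freqNorm k)
  have h1 := bracket_freqNorm_le k
  have h2 := two_pow_lvl_le k
  have e : ((2 : ℝ) ^ lvl k) ^ s = 2 ^ (s * lvl k) := by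
    rw [← Real.rpow_natCast, ← Real.rpow_mul (by norm_num), mul_comm]
  rcases le_total 0 s with hs | hs
  · rw [abs_of_nonneg hs, ← e, ← Real.mul_rpow (by norm_num) (by positivity)]
    exact Real.rpow_le_rpow hb.le h1 hs
  · rw [abs_of_nonpos hs]
    have h3 : (2 : ℝ) ^ lvl k / 2 ≤ bracket (freqNorm k) := by linarith
    have h4 := Real.rpow_le_rpow_of_nonpos (by positivity) h3 hs
    refine h4.trans (le_of_eq ?_)
    rw [Real.div_rpow (by positivity) (by norm_num), e, Real.rpow_neg (by norm_num)]
    field_simp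

theorem le_bracket_rpow (s : ℝ) (k : Fin d → ℤ) :
    2 ^ (s * lvl k) ≤ 2 ^ |s| * bracket (freqNorm k) ^ s := by
  have h := bracket_rpow_le (-s) k
  have hb := bracket_pos (freqNorm k)
  rw [abs_neg, neg_mul, Real.rpow_neg hb.le, Real.rpow_neg (by norm_num)] at h
  have h1 : (0 : ℝ) < 2 ^ (s * lvl k) := by positivity
  have h2 : (0 : ℝ) < bracket (freqNorm k) ^ s := Real.rpow_pos_of_pos hb _
  rw [inv_le_iff_one_le_mul₀ h2] at h
  have h3 := mul_le_mul_of_nonneg_left h h1.le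
  rw [mul_one] at h3
  refine h3.trans (le_of_eq ?_)
  field_simp

theorem sobolevNorm_eq (s : ℝ) (a : Coeffs d) :
    sobolevNorm s a = l2 fun k => ENNReal.ofReal (bracket (freqNorm k) ^ s) * ‖a k‖ₑ := by
  unfold sobolevNorm l2
  congr 1
  refine tsum_congr fun k => ?_
  rw [mul_pow, ← ENNReal.ofReal_pow (Real.rpow_nonneg (bracket_pos _).le _)]
  congr 2
  rw [← Real.rpow_natCast, ← Real.rpow_mul (bracket_pos _).le]
  congr 1
  push_cast
  ring

theorem sobolevNorm_le_hw (s : ℝ) (a : Coeffs d) :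
    sobolevNorm s a ≤ ENNReal.ofReal (2 ^ |s|) * hw (dyW s) a := by
  rw [sobolevNorm_eq, hw_eq, ← l2_const_mul]
  refine l2_mono fun k => ?_
  rw [← mul_assoc]
  gcongr
  unfold dyW
  rw [← ENNReal.ofReal_mul (by positivity)]
  exact ENNReal.ofReal_le_ofReal (bracket_rpow_le s k)

theorem hw_le_sobolevNorm (s : ℝ) (a : Coeffs d) :
    hw (dyW s) a ≤ ENNReal.ofReal (2 ^ |s|) * sobolevNorm s a := by
  rw [sobolevNorm_eq, hw_eq, ← l2_const_mul]
  refine l2_mono fun k => ?_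
  rw [← mul_assoc]
  gcongr
  unfold dyW
  rw [← ENNReal.ofReal_mul (by positivity)]
  exact ENNReal.ofReal_le_ofReal (le_bracket_rpow s k)

theorem hw_mono {w w' : ℕ → ℝ≥0∞} (h : ∀ n, w n ≤ w' n) (a : Coeffs d) : hw w a ≤ hw w' a :=
  l2_mono fun n => by gcongr; exact h n

theorem hw_congr {w : ℕ → ℝ≥0∞} {a b : Coeffs d} (h : ∀ k, ‖a k‖ₑ = ‖b k‖ₑ) :
    hw w a = hw w b := by
  simp_rw [hw_eq, h]

theorem hw_ne_top_iff (s : ℝ) (a : Coeffs d) : hw (dyW s) a ≠ ⊤ ↔ sobolevNorm s a < ⊤ := by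
  constructor
  · intro h
    exact (sobolevNorm_le_hw s a).trans_lt (ENNReal.mul_lt_top ENNReal.ofReal_lt_top h.lt_top)
  · intro h
    exact ((hw_le_sobolevNorm s a).trans_lt (ENNReal.mul_lt_top ENNReal.ofReal_lt_top h)).ne

end levels


/-! ### The space `U²` -/

section U
variable {H : Type*} [NormedAddCommGroup H]

/-- The step function `∑ 1_{[t_k, t_{k+1})} ψ_k`. -/
def stepFun {K : ℕ} (t : Fin (K + 1) → ℝ) (ψ : Fin K → H) (τ : ℝ) : H :=
  ∑ k, (Ico (t k.castSucc) (t k.succ)).indicator (fun _ => ψ k) τ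

theorem step_unique {K : ℕ} {t : Fin (K + 1) → ℝ} (ht : Monotone t) {k l : Fin K} {τ : ℝ}
    (hk : τ ∈ Ico (t k.castSucc) (t k.succ)) (hl : τ ∈ Ico (t l.castSucc) (t l.succ)) : k = l := by
  rcases lt_trichotomy k l with h | h | h
  · exfalso
    have : t k.succ ≤ t l.castSucc := ht (by
      rw [Fin.le_def]; simp; exact h)
    linarith [hk.2, hl.1]
  · exact h
  · exfalso
    have : t l.succ ≤ t k.castSucc := ht (by
      rw [Fin.le_def]; simp; exact h)
    linarith [hl.2, hk.1]

theorem stepFun_eq {K : ℕ} {t : Fin (K + 1) → ℝ} (ht : Monotone t) (ψ : Fin K → H) {k : Fin K}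
    {τ : ℝ} (hk : τ ∈ Ico (t k.castSucc) (t k.succ)) : stepFun t ψ τ = ψ k := by
  unfold stepFun
  rw [Finset.sum_eq_single k]
  · rw [Set.indicator_of_mem hk]
  · intro l _ hl
    exact Set.indicator_of_notMem (fun h => hl (step_unique ht h hk)) _
  · simp

theorem norm_le_one_of_sum_sq {K : ℕ} {ψ : Fin K → H} (h : ∑ k, ‖ψ k‖ ^ (2 : ℝ) ≤ 1) (k : Fin K) :
    ‖ψ k‖ ≤ 1 := by
  have h1 : ‖ψ k‖ ^ (2 : ℝ) ≤ 1 :=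
    (Finset.single_le_sum (f := fun k => ‖ψ k‖ ^ (2 : ℝ)) (fun _ _ => by positivity)
      (Finset.mem_univ k)).trans h
  rw [Real.rpow_two] at h1
  exact (sq_le_one_iff₀ (norm_nonneg _)).1 h1

theorem norm_stepFun_le_one {K : ℕ} {t : Fin (K + 1) → ℝ} (ht : Monotone t) {ψ : Fin K → H}
    (h : ∑ k, ‖ψ k‖ ^ (2 : ℝ) ≤ 1) (τ : ℝ) : ‖stepFun t ψ τ‖ ≤ 1 := by
  by_cases hk : ∃ k : Fin K, τ ∈ Ico (t k.castSucc) (t k.succ)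
  · obtain ⟨k, hk⟩ := hk
    rw [stepFun_eq ht ψ hk]
    exact norm_le_one_of_sum_sq h k
  · have : stepFun t ψ τ = 0 := by
      unfold stepFun
      refine Finset.sum_eq_zero fun k _ => Set.indicator_of_notMem (fun h => hk ⟨k, h⟩) _
    simp [this]

theorem IsUAtom.norm_le_one {a b : ℝ} {A : ℝ → H} (hA : IsUAtom 2 a b A) {τ : ℝ}
    (hτ : τ ∈ Ico a b) : ‖A τ‖ ≤ 1 := by
  obtain ⟨K, t, ψ, ht, h0, h1, hψ, h⟩ := hA
  rw [h τ hτ]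
  exact norm_stepFun_le_one ht hψ τ

theorem isUAtom_const {a b : ℝ} (hab : a ≤ b) {x : H} (hx : ‖x‖ ≤ 1) :
    IsUAtom 2 a b fun _ => x := by
  refine ⟨1, ![a, b], fun _ => x, ?_, by simp, by simp [Fin.last], ?_, ?_⟩
  · refine Fin.monotone_iff_le_succ.2 fun i => ?_
    fin_cases i
    simpa using hab
  · simpa using hx
  · intro τ hτ
    simp only [Finset.univ_unique, Fin.default_eq_zero, Finset.sum_singleton]
    rw [Set.indicator_of_mem]
    simpa using hτ

/-- Restriction of an atom to a smaller interval: the partition points are moved to the nearest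
point of the smaller interval. -/
theorem IsUAtom.restrict {a b a' b' : ℝ} {A : ℝ → H} (hA : IsUAtom 2 a b A) (ha : a ≤ a')
    (hab : a' ≤ b') (hb : b' ≤ b) : IsUAtom 2 a' b' A := by
  obtain ⟨K, t, ψ, ht, h0, h1, hψ, h⟩ := hA
  refine ⟨K, fun k => max a' (min (t k) b'), ψ, ?_, ?_, ?_, hψ, ?_⟩
  · intro i j hij
    exact max_le_max le_rfl (min_le_min (ht hij) le_rfl)
  · simp only [h0]
    rw [min_eq_left (by linarith), max_eq_left ha]
  · simp only [h1]
    rw [min_eq_right hb, max_eq_right hab]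
  · intro τ hτ
    rw [h τ ⟨ha.trans hτ.1, hτ.2.trans_le hb⟩]
    refine Finset.sum_congr rfl fun k _ => ?_
    have e : τ ∈ Ico (t k.castSucc) (t k.succ) ↔
        τ ∈ Ico (max a' (min (t k.castSucc) b')) (max a' (min (t k.succ) b')) := by
      simp only [mem_Ico, max_le_iff, min_le_iff, lt_max_iff, lt_min_iff]
      constructor
      · rintro ⟨h2, h3⟩
        exact ⟨⟨hτ.1, Or.inl h2⟩, Or.inr ⟨h3, hτ.2⟩⟩
      · rintro ⟨⟨_, h2⟩, h3⟩
        refine ⟨h2.resolve_right (not_le.2 hτ.2), ?_⟩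
        rcases h3 with h3 | h3
        · exact absurd hτ.1 (not_le.2 h3)
        · exact h3.1
    by_cases hk : τ ∈ Ico (t k.castSucc) (t k.succ)
    · rw [Set.indicator_of_mem hk, Set.indicator_of_mem (e.1 hk)]
    · rw [Set.indicator_of_notMem hk, Set.indicator_of_notMem (fun h => hk (e.2 h))]

/-- Extension of an atom by zero to the right. -/
theorem IsUAtom.extend_right {a b c : ℝ} {A : ℝ → H} (hA : IsUAtom 2 a b A) (hbc : b ≤ c) :
    IsUAtom 2 a c ((Iio b).indicator A) := by
  obtain ⟨K, t, ψ, ht, h0, h1, hψ, h⟩ := hA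
  refine ⟨K + 1, Fin.snoc t c, Fin.snoc ψ 0, ?_, ?_, by simp, ?_, ?_⟩
  · refine Fin.monotone_iff_le_succ.2 fun i => ?_
    induction i using Fin.lastCases with
    | last => rw [Fin.succ_last, Fin.snoc_last, Fin.snoc_castSucc, h1]; exact hbc
    | cast i =>
      rw [Fin.snoc_castSucc, Fin.succ_castSucc, Fin.snoc_castSucc]
      exact ht (Fin.castSucc_lt_succ).le
  · rw [← h0]
    exact Fin.snoc_castSucc (α := fun _ => ℝ) c t 0
  · rw [Fin.sum_univ_castSucc]
    simpa using hψ
  · intro τ hτ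
    rw [Fin.sum_univ_castSucc]
    simp only [Fin.snoc_last, Fin.snoc_castSucc, Fin.succ_castSucc, Set.indicator_zero, add_zero]
    by_cases hb : τ < b
    · rw [Set.indicator_of_mem (by exact hb), h τ ⟨hτ.1, hb⟩]
    · rw [Set.indicator_of_notMem (by exact hb)]
      symm
      refine Finset.sum_eq_zero fun k _ => Set.indicator_of_notMem (fun h => hb ?_) _
      exact h.2.trans_le (h1 ▸ ht (Fin.le_last _))

/-- Extension of an atom by zero to the left. -/
theorem IsUAtom.extend_left {a b c : ℝ} {A : ℝ → H} (hA : IsUAtom 2 b c A) (hab : a ≤ b) :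
    IsUAtom 2 a c ((Ici b).indicator A) := by
  obtain ⟨K, t, ψ, ht, h0, h1, hψ, h⟩ := hA
  refine ⟨K + 1, Fin.cons a t, Fin.cons 0 ψ, ?_, by simp, ?_, ?_, ?_⟩
  · refine Fin.monotone_iff_le_succ.2 fun i => ?_
    induction i using Fin.cases with
    | zero => simpa [h0] using hab
    | succ i =>
      rw [Fin.cons_succ, Fin.castSucc_succ, Fin.cons_succ]
      exact ht (Fin.castSucc_lt_succ).le
  · rw [← h1, ← Fin.succ_last]
    simp
  · rw [Fin.sum_univ_succ]
    simpa using hψ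
  · intro τ hτ
    rw [Fin.sum_univ_succ]
    simp only [Fin.cons_zero, Fin.cons_succ, Fin.castSucc_succ, Set.indicator_zero, zero_add]
    by_cases hb : b ≤ τ
    · rw [Set.indicator_of_mem (by exact hb), h τ ⟨hb, hτ.2⟩]
    · rw [Set.indicator_of_notMem (by exact hb)]
      symm
      refine Finset.sum_eq_zero fun k _ => Set.indicator_of_notMem (fun h => hb ?_) _
      exact (h0.symm.le.trans (ht (Fin.zero_le k.castSucc))).trans h.1

variable [NormedSpace ℂ H]

theorem exists_decomp {a b : ℝ} {f : ℝ → H} {B : ℝ≥0∞} (h : uNorm 2 a b f < B) :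
    ∃ (c : ℕ → ℂ) (A : ℕ → ℝ → H), (∀ j, IsUAtom 2 a b (A j)) ∧
      (∀ t ∈ Ico a b, HasSum (fun j => c j • A j t) (f t)) ∧ ∑' j, ‖c j‖ₑ < B := by
  unfold uNorm at h
  simp only [iInf_lt_iff] at h
  obtain ⟨c, A, h1, h2, h3⟩ := h
  exact ⟨c, A, h1, h2, h3⟩

/-- A decomposition into atoms over any countable index set bounds the `U²` norm. -/
theorem uNorm_le_of_decomp {κ : Type*} [Countable κ] {a b : ℝ} (hab : a ≤ b) {f : ℝ → H}
    (c : κ → ℂ) (A : κ → ℝ → H) (hA : ∀ j, IsUAtom 2 a b (A j))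
    (hf : ∀ t ∈ Ico a b, HasSum (fun j => c j • A j t) (f t)) :
    uNorm 2 a b f ≤ ∑' j, ‖c j‖ₑ := by
  obtain ⟨e, he⟩ := exists_injective_nat κ
  have h1 : ∑' j, ‖c j‖ₑ = ∑' n, ‖Function.extend e c 0 n‖ₑ := by
    rw [← tsum_extend_zero he]
    refine tsum_congr fun n => ?_
    by_cases hn : ∃ j, e j = n
    · obtain ⟨j, rfl⟩ := hn
      simp only [he.extend_apply]
    · rw [Function.extend_apply' _ _ _ hn, Function.extend_apply' _ _ _ hn]
      simp
  rw [h1]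
  refine iInf_le_of_le (Function.extend e c 0) (iInf_le_of_le
    (Function.extend e A (fun _ _ => 0)) (iInf_le_of_le ?_ (iInf_le_of_le ?_ le_rfl)))
  · intro n
    by_cases hn : ∃ j, e j = n
    · obtain ⟨j, rfl⟩ := hn
      rw [he.extend_apply]
      exact hA j
    · rw [Function.extend_apply' _ _ _ hn]
      exact isUAtom_const hab (by simp)
  · intro t ht
    have h2 := (hasSum_extend_zero he).2 (hf t ht)
    convert h2 using 2 with n
    by_cases hn : ∃ j, e j = n
    · obtain ⟨j, rfl⟩ := hn
      simp only [he.extend_apply]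
    · simp [Function.extend_apply' _ _ _ hn]

theorem enorm_le_uNorm {a b : ℝ} (f : ℝ → H) {t : ℝ} (ht : t ∈ Ico a b) :
    ‖f t‖ₑ ≤ uNorm 2 a b f := by
  refine le_of_forall_gt fun B hB => ?_
  obtain ⟨c, A, hA, hf, hc⟩ := exists_decomp hB
  refine lt_of_le_of_lt ?_ hc
  have h1 : Summable fun j => ‖c j‖ := by
    have := ENNReal.summable_toReal (hc.trans_le le_top).ne
    simpa using this
  have h2 : ‖f t‖ ≤ ∑' j, ‖c j‖ := by
    rw [← (hf t ht).tsum_eq]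
    refine tsum_of_norm_bounded h1.hasSum fun j => ?_
    rw [norm_smul]
    exact mul_le_of_le_one_right (norm_nonneg _) ((hA j).norm_le_one ht)
  rw [← ofReal_norm]
  refine (ENNReal.ofReal_le_ofReal h2).trans (le_of_eq ?_)
  rw [ENNReal.ofReal_tsum_of_nonneg (fun _ => norm_nonneg _) h1]
  simp

theorem uNorm_congr {a b : ℝ} {f g : ℝ → H} (h : ∀ t ∈ Ico a b, f t = g t) :
    uNorm 2 a b f = uNorm 2 a b g := by
  have key : ∀ (c : ℕ → ℂ) (A : ℕ → ℝ → H),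
      (∀ t ∈ Ico a b, HasSum (fun j => c j • A j t) (f t)) ↔
      (∀ t ∈ Ico a b, HasSum (fun j => c j • A j t) (g t)) := fun c A =>
    forall₂_congr fun t ht => by rw [h t ht]
  unfold uNorm
  simp_rw [key]

/-- Countable subadditivity of the `U²` norm. -/
theorem uNorm_tsum_le [CompleteSpace H] {ι : Type*} [Countable ι] {a b : ℝ} (hab : a ≤ b)
    {F : ι → ℝ → H} {f : ℝ → H}
    (hf : ∀ t ∈ Ico a b, HasSum (fun i => F i t) (f t)) :
    uNorm 2 a b f ≤ ∑' i, uNorm 2 a b (F i) := by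
  by_cases hfin : ∑' i, uNorm 2 a b (F i) = ⊤
  · rw [hfin]; exact le_top
  refine ENNReal.le_of_forall_pos_le_add fun δ hδ _ => ?_
  obtain ⟨δ', hδ', hsum⟩ := ENNReal.exists_pos_sum_of_countable (ENNReal.coe_pos.2 hδ).ne' ι
  have hlt : ∀ i, uNorm 2 a b (F i) < uNorm 2 a b (F i) + δ' i := fun i =>
    ENNReal.lt_add_right (ENNReal.ne_top_of_tsum_ne_top hfin i) (ENNReal.coe_pos.2 (hδ' i)).ne'
  choose c A hA hF hc using fun i => exists_decomp (hlt i)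
  have htot : ∑' p : ι × ℕ, ‖c p.1 p.2‖ₑ ≤ ∑' i, uNorm 2 a b (F i) + δ := by
    rw [ENNReal.tsum_prod (f := fun i j => ‖c i j‖ₑ)]
    calc ∑' i, ∑' j, ‖c i j‖ₑ ≤ ∑' i, (uNorm 2 a b (F i) + δ' i) :=
          ENNReal.tsum_le_tsum fun i => (hc i).le
      _ = ∑' i, uNorm 2 a b (F i) + ∑' i, (δ' i : ℝ≥0∞) := ENNReal.tsum_add
      _ ≤ _ := by gcongr
  refine le_trans (uNorm_le_of_decomp hab (fun p : ι × ℕ => c p.1 p.2) (fun p => A p.1 p.2)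
    (fun p => hA _ _) ?_) htot
  intro t ht
  have hs : Summable fun p : ι × ℕ => c p.1 p.2 • A p.1 p.2 t := by
    have h1 : Summable fun p : ι × ℕ => ‖c p.1 p.2‖ := by
      have h2 : ∑' p : ι × ℕ, ‖c p.1 p.2‖ₑ ≠ ⊤ :=
        (htot.trans_lt (ENNReal.add_lt_top.2 ⟨lt_top_iff_ne_top.2 hfin, ENNReal.coe_lt_top⟩)).ne
      have := ENNReal.summable_toReal h2
      simpa using this
    refine Summable.of_norm_bounded h1 fun p => ?_
    rw [norm_smul]
    exact mul_le_of_le_one_right (norm_nonneg _) ((hA _ _).norm_le_one ht)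
  have h3 := hs.hasSum.prod_fiberwise fun i => hF i t ht
  rw [← h3.unique (hf t ht)]
  exact hs.hasSum

theorem uNorm_zero {a b : ℝ} (hab : a ≤ b) : uNorm 2 a b (fun _ => (0 : H)) = 0 := by
  have := uNorm_le_of_decomp (κ := ℕ) hab (f := fun _ => (0 : H)) (fun _ => 0) (fun _ _ => 0)
    (fun _ => isUAtom_const hab (by simp)) (fun t _ => by simp)
  simpa using this

theorem uNorm_eq_of_zero {a b : ℝ} (hab : a ≤ b) {f : ℝ → H} (h : ∀ t ∈ Ico a b, f t = 0) :
    uNorm 2 a b f = 0 := (uNorm_congr h).trans (uNorm_zero hab)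

theorem uNorm_add_le [CompleteSpace H] {a b : ℝ} (hab : a ≤ b) (f g : ℝ → H) :
    uNorm 2 a b (fun t => f t + g t) ≤ uNorm 2 a b f + uNorm 2 a b g := by
  have := uNorm_tsum_le (ι := Fin 2) hab (F := fun i => if i = 0 then f else g)
    (f := fun t => f t + g t) (fun t _ => by
      have := hasSum_fintype fun i : Fin 2 => (if i = 0 then f else g) t
      simpa [Fin.sum_univ_two] using this)
  simpa [tsum_fintype, Fin.sum_univ_two] using this

theorem uNorm_neg {a b : ℝ} (f : ℝ → H) : uNorm 2 a b (fun t => -f t) = uNorm 2 a b f := by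
  have key : ∀ g : ℝ → H, uNorm 2 a b (fun t => -g t) ≤ uNorm 2 a b g := fun g => by
    refine le_of_forall_gt fun B hB => ?_
    obtain ⟨c, A, hA, hf, hc⟩ := exists_decomp hB
    refine lt_of_le_of_lt ?_ hc
    refine iInf_le_of_le (fun j => -c j) (iInf_le_of_le A (iInf_le_of_le hA
      (iInf_le_of_le (fun t ht => by simpa using (hf t ht).neg) (by simp))))
  refine le_antisymm (key f) ?_
  simpa using key fun t => -f t

theorem uNorm_const_le {a b : ℝ} (hab : a ≤ b) (x : H) : uNorm 2 a b (fun _ => x) ≤ ‖x‖ₑ := by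
  rcases eq_or_ne x 0 with rfl | hx
  · simp [uNorm_zero hab]
  have hx' : ‖x‖ ≠ 0 := norm_ne_zero_iff.2 hx
  have hxc : (‖x‖ : ℂ) ≠ 0 := by exact_mod_cast hx'
  refine (uNorm_le_of_decomp (κ := Unit) hab (fun _ => (‖x‖ : ℂ))
    (fun _ _ => (‖x‖ : ℂ)⁻¹ • x) (fun _ => isUAtom_const hab ?_) (fun t _ => ?_)).trans ?_
  · rw [norm_smul]; simp [hx']
  · simp [smul_smul, hxc]
  · rw [tsum_fintype, Finset.univ_unique, Finset.sum_singleton, ← ofReal_norm, ← ofReal_norm]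
    simp

theorem uNorm_restrict {a b a' b' : ℝ} (f : ℝ → H) (ha : a ≤ a') (hab : a' ≤ b') (hb : b' ≤ b) :
    uNorm 2 a' b' f ≤ uNorm 2 a b f := by
  refine le_of_forall_gt fun B hB => ?_
  obtain ⟨c, A, hA, hf, hc⟩ := exists_decomp hB
  refine lt_of_le_of_lt ?_ hc
  exact uNorm_le_of_decomp hab c A (fun j => (hA j).restrict ha hab hb)
    (fun t ht => hf t ⟨ha.trans ht.1, ht.2.trans_le hb⟩)

/-- The `U²` norm on an interval is at most the sum of the norms on two pieces. -/
theorem uNorm_glue [CompleteSpace H] {a b c : ℝ} (f : ℝ → H) (hab : a ≤ b) (hbc : b ≤ c) :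
    uNorm 2 a c f ≤ uNorm 2 a b f + uNorm 2 b c f := by
  have h1 : uNorm 2 a c ((Iio b).indicator f) ≤ uNorm 2 a b f := by
    refine le_of_forall_gt fun B hB => ?_
    obtain ⟨c', A, hA, hf, hc⟩ := exists_decomp hB
    refine lt_of_le_of_lt ?_ hc
    refine uNorm_le_of_decomp (hab.trans hbc) c' _ (fun j => (hA j).extend_right hbc) ?_
    intro t ht
    by_cases hb : t ∈ Iio b
    · simpa only [Set.indicator_of_mem hb] using hf t ⟨ht.1, hb⟩
    · simpa only [Set.indicator_of_notMem hb, smul_zero] using hasSum_zero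
  have h2 : uNorm 2 a c ((Ici b).indicator f) ≤ uNorm 2 b c f := by
    refine le_of_forall_gt fun B hB => ?_
    obtain ⟨c', A, hA, hf, hc⟩ := exists_decomp hB
    refine lt_of_le_of_lt ?_ hc
    refine uNorm_le_of_decomp (hab.trans hbc) c' _ (fun j => (hA j).extend_left hab) ?_
    intro t ht
    by_cases hb : t ∈ Ici b
    · simpa only [Set.indicator_of_mem hb] using hf t ⟨hb, ht.2⟩
    · simpa only [Set.indicator_of_notMem hb, smul_zero] using hasSum_zero
  refine le_trans (le_of_eq (uNorm_congr fun t _ => ?_))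
    ((uNorm_add_le (hab.trans hbc) _ _).trans (add_le_add h1 h2))
  by_cases hb : t < b
  · rw [Set.indicator_of_mem (by exact hb), Set.indicator_of_notMem (by simpa using hb), add_zero]
  · rw [Set.indicator_of_notMem (by exact hb), Set.indicator_of_mem (by simpa using hb), zero_add]

/-- The constant of the embedding of the `γ`-Hölder functions into `U²`. -/
def holderConst (γ : ℝ) : ℝ≥0∞ := ∑' n : ℕ, ENNReal.ofReal (2 ^ (1 / 2 - γ)) ^ (n + 1)

theorem holderConst_ne_top {γ : ℝ} (hγ : 1 / 2 < γ) : holderConst γ ≠ ⊤ := by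
  unfold holderConst
  rw [ENNReal.tsum_geometric_add_one]
  have h1 : ENNReal.ofReal (2 ^ (1 / 2 - γ)) < 1 := by
    rw [ENNReal.ofReal_lt_one]
    exact Real.rpow_lt_one_of_one_lt_of_neg one_lt_two (by linarith)
  refine ENNReal.mul_ne_top ENNReal.ofReal_ne_top (ENNReal.inv_ne_top.2 ?_)
  exact (tsub_pos_of_lt h1).ne'

/-- Step functions on the mesh of `2^(n+1)` equal intervals: each of the `2^(n+1)` values has
norm at most `C (h / 2^(n+1))^γ`, so the `ℓ²` sum of the values is `C h^γ 2^(-(γ-1/2)(n+1))`. -/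
theorem sum_sq_mesh_le {C h γ : ℝ} (hC : 0 < C) (hh : 0 < h) (n : ℕ)
    (ψ : Fin (2 ^ (n + 1)) → H) (hψ : ∀ j, ‖ψ j‖ ≤ C * (h / 2 ^ (n + 1)) ^ γ) :
    ∑ j, ‖((C * h ^ γ * (2 ^ (1 / 2 - γ)) ^ (n + 1) : ℝ) : ℂ)⁻¹ • ψ j‖ ^ (2 : ℝ) ≤ 1 := by
  set lam : ℝ := C * h ^ γ * (2 ^ (1 / 2 - γ)) ^ (n + 1) with hlam
  have hlam0 : 0 < lam := by positivity
  have e1 : (C * (h / 2 ^ (n + 1)) ^ γ) ^ 2 * 2 ^ (n + 1) = lam ^ 2 := by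
    rw [hlam, Real.div_rpow hh.le (by positivity), mul_pow, mul_pow, div_pow, mul_pow]
    have e2 : ((2 : ℝ) ^ (1 / 2 - γ)) ^ (n + 1) = (2 ^ (n + 1)) ^ (1 / 2 - γ) := by
      rw [← Real.rpow_natCast, ← Real.rpow_natCast, ← Real.rpow_mul (by norm_num),
        ← Real.rpow_mul (by norm_num), mul_comm]
    rw [e2, Real.rpow_sub (by positivity), div_pow, ← Real.sqrt_eq_rpow,
      Real.sq_sqrt (by positivity)]
    field_simp
  calc ∑ j, ‖(lam : ℂ)⁻¹ • ψ j‖ ^ (2 : ℝ)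
      ≤ ∑ j : Fin (2 ^ (n + 1)), (lam⁻¹ * (C * (h / 2 ^ (n + 1)) ^ γ)) ^ 2 := by
        gcongr with j
        rw [Real.rpow_two]
        have : ‖(lam : ℂ)⁻¹ • ψ j‖ = lam⁻¹ * ‖ψ j‖ := by
          rw [norm_smul, norm_inv, Complex.norm_real, Real.norm_of_nonneg hlam0.le]
        rw [this]
        gcongr
        exact hψ j
    _ = (lam⁻¹) ^ 2 * ((C * (h / 2 ^ (n + 1)) ^ γ) ^ 2 * 2 ^ (n + 1)) := by
        rw [Finset.sum_const, Finset.card_univ, Fintype.card_fin, nsmul_eq_mul]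
        push_cast
        ring
    _ = 1 := by rw [e1]; field_simp
    _ ≤ 1 := le_rfl

/-- A `γ`-Hölder function with `γ > 1/2` belongs to `U²`: it is the sum over `n` of the increments
between its piecewise constant interpolations on the meshes of size `2^(-n)` and `2^(-n-1)`. -/
theorem uNorm_le_of_holder [CompleteSpace H] {a b C γ : ℝ} {F : ℝ → H} (hγ : 1 / 2 < γ)
    (hab : a ≤ b) (hC : 0 ≤ C) (hF0 : F a = 0)
    (hF : ∀ s t, a ≤ s → s ≤ t → t < b → ‖F t - F s‖ ≤ C * (t - s) ^ γ) :
    uNorm 2 a b F ≤ ENNReal.ofReal (C * (b - a) ^ γ) * holderConst γ := by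
  rcases hC.eq_or_lt with rfl | hC
  · refine le_of_eq_of_le (uNorm_eq_of_zero hab fun t ht => ?_) zero_le
    have := hF a t le_rfl ht.1 ht.2
    rw [hF0] at this
    simpa using this
  rcases hab.eq_or_lt with rfl | hab'
  · refine le_of_eq_of_le (uNorm_eq_of_zero le_rfl fun t ht => ?_) zero_le
    simp at ht
  set h := b - a with hh
  have hh0 : 0 < h := by rw [hh]; linarith
  -- `pt n j` is the `j`-th point of the mesh of size `h / 2 ^ n`, `P n` the interpolation of `F` which
  -- is constant on the mesh intervals, `lam n` times the atom `A n` the difference `P (n + 1) - P n`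
  set lam : ℕ → ℝ := fun n => C * h ^ γ * (2 ^ (1 / 2 - γ)) ^ (n + 1) with hlam
  have hlam0 : ∀ n, 0 < lam n := fun n => by simp only [hlam]; positivity
  set pt : ℕ → ℕ → ℝ := fun n j => a + j * (h / 2 ^ n) with hpt
  set P : ℕ → ℝ → H := fun n τ => F (pt n ⌊2 ^ n * ((τ - a) / h)⌋₊) with hP
  set ψ : ∀ n, Fin (2 ^ (n + 1)) → H := fun n j =>
    F (pt (n + 1) j) - F (pt n ((j : ℕ) / 2)) with hψ
  set A : ℕ → ℝ → H := fun n => stepFun (fun j : Fin (2 ^ (n + 1) + 1) => pt (n + 1) j)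
    (fun j => (lam n : ℂ)⁻¹ • ψ n j) with hA
  have hptmono : ∀ n, Monotone (pt n) := fun n i j hij => by
    simp only [hpt]
    have : (i : ℝ) ≤ j := by exact_mod_cast hij
    gcongr
  have hptb : ∀ n j, j < 2 ^ n → pt n j < b := fun n j hj => by
    have h1 : (j : ℝ) < 2 ^ n := by exact_mod_cast hj
    have h2 : (j : ℝ) * (h / 2 ^ n) < 2 ^ n * (h / 2 ^ n) := by gcongr
    have h3 : (2 : ℝ) ^ n * (h / 2 ^ n) = h := by field_simp
    simp only [hpt]; linarith
  have hpta : ∀ n j, a ≤ pt n j := fun n j => by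
    simp only [hpt]
    have : 0 ≤ (j : ℝ) * (h / 2 ^ n) := by positivity
    linarith
  have hψn : ∀ n j, ‖ψ n j‖ ≤ C * (h / 2 ^ (n + 1)) ^ γ := by
    intro n j
    have h1 : 2 * (((j : ℕ) / 2 : ℕ) : ℝ) ≤ (j : ℕ) := by
      have : 2 * ((j : ℕ) / 2) ≤ j := by omega
      exact_mod_cast this
    have h2 : ((j : ℕ) : ℝ) ≤ 2 * (((j : ℕ) / 2 : ℕ) : ℝ) + 1 := by
      have : (j : ℕ) ≤ 2 * ((j : ℕ) / 2) + 1 := by omega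
      exact_mod_cast this
    have e : pt n ((j : ℕ) / 2) = a + 2 * (((j : ℕ) / 2 : ℕ) : ℝ) * (h / 2 ^ (n + 1)) := by
      have e' : h / 2 ^ n = 2 * (h / 2 ^ (n + 1)) := by rw [pow_succ (2 : ℝ) n]; field_simp
      simp only [hpt]; rw [e']; ring
    have hpos : 0 < h / 2 ^ (n + 1) := by positivity
    have h3 : pt n ((j : ℕ) / 2) ≤ pt (n + 1) j := by
      rw [e]; simp only [hpt]; gcongr
    have h4 : pt (n + 1) j - pt n ((j : ℕ) / 2) ≤ h / 2 ^ (n + 1) := by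
      rw [e]; simp only [hpt]; nlinarith
    refine (hF _ _ (hpta _ _) h3 (hptb _ _ j.2)).trans ?_
    exact mul_le_mul_of_nonneg_left
      (Real.rpow_le_rpow (by linarith) h4 (by linarith)) hC.le
  have hfloor : ∀ n, ∀ τ ∈ Ico a b, ⌊2 ^ n * ((τ - a) / h)⌋₊ < 2 ^ n ∧
      τ ∈ Ico (pt n ⌊2 ^ n * ((τ - a) / h)⌋₊) (pt n (⌊2 ^ n * ((τ - a) / h)⌋₊ + 1)) := by
    intro n τ hτ
    have hx0 : 0 ≤ (τ - a) / h := div_nonneg (by linarith [hτ.1]) hh0.le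
    have hx1 : (τ - a) / h < 1 := by rw [div_lt_one hh0]; linarith [hτ.2]
    have h0 : (0 : ℝ) ≤ 2 ^ n * ((τ - a) / h) := by positivity
    have h1 := Nat.floor_le h0
    have h2 := Nat.lt_floor_add_one (2 ^ n * ((τ - a) / h))
    have e : 2 ^ n * ((τ - a) / h) * (h / 2 ^ n) = τ - a := by field_simp
    have hpos : 0 < h / 2 ^ n := by positivity
    refine ⟨?_, ?_, ?_⟩
    · rw [Nat.floor_lt h0]
      push_cast
      have : (0 : ℝ) < 2 ^ n := by positivity
      nlinarith
    · simp only [hpt]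
      nlinarith
    · simp only [hpt]
      push_cast
      nlinarith
  have hAt : ∀ n, IsUAtom 2 a b (A n) := by
    intro n
    refine ⟨2 ^ (n + 1), fun j => pt (n + 1) j, fun j => (lam n : ℂ)⁻¹ • ψ n j, ?_, ?_, ?_, ?_,
      fun τ _ => rfl⟩
    · intro i j hij
      exact hptmono _ hij
    · simp [hpt]
    · simp only [hpt, Fin.val_last]
      push_cast
      rw [hh]; field_simp; ring
    · exact sum_sq_mesh_le hC hh0 n (ψ n) (hψn n)
  have hdiff : ∀ n, ∀ τ ∈ Ico a b, (lam n : ℂ) • A n τ = P (n + 1) τ - P n τ := by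
    intro n τ hτ
    obtain ⟨h1, h2⟩ := hfloor (n + 1) τ hτ
    set j := ⌊2 ^ (n + 1) * ((τ - a) / h)⌋₊ with hj
    have hm : Monotone fun j : Fin (2 ^ (n + 1) + 1) => pt (n + 1) j := fun i j hij =>
      hptmono _ hij
    have e1 : A n τ = (lam n : ℂ)⁻¹ • ψ n ⟨j, h1⟩ := by
      simp only [hA]
      exact stepFun_eq hm _ (k := ⟨j, h1⟩) (by simpa using h2)
    -- the interval of the coarser mesh which contains the `j`-th interval of the finer one
    have e2 : ⌊2 ^ n * ((τ - a) / h)⌋₊ = j / 2 := by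
      rw [hj, ← Nat.floor_div_ofNat]
      congr 1
      rw [pow_succ]; ring
    have e3 : (lam n : ℂ) ≠ 0 := by exact_mod_cast (hlam0 n).ne'
    rw [e1, smul_smul, mul_inv_cancel₀ e3, one_smul]
    simp only [hP, hψ, e2]
    rfl
  have hlams : Summable lam := by
    simp only [hlam]
    refine Summable.mul_left _ ?_
    refine (summable_nat_add_iff 1).2 (summable_geometric_of_lt_one (by positivity) ?_)
    exact Real.rpow_lt_one_of_one_lt_of_neg one_lt_two (by linarith)
  have hsum : ∀ τ ∈ Ico a b, HasSum (fun n => (lam n : ℂ) • A n τ) (F τ) := by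
    intro τ hτ
    have hs : Summable fun n => (lam n : ℂ) • A n τ := by
      refine Summable.of_norm_bounded hlams fun n => ?_
      rw [norm_smul, Complex.norm_real, Real.norm_of_nonneg (hlam0 n).le]
      exact mul_le_of_le_one_right (hlam0 n).le ((hAt n).norm_le_one hτ)
    have h1 := hs.hasSum.tendsto_sum_nat
    have h2 : ∀ N, ∑ n ∈ Finset.range N, (lam n : ℂ) • A n τ = P N τ := fun N => by
      rw [Finset.sum_congr rfl fun n _ => hdiff n τ hτ, Finset.sum_range_sub fun n => P n τ]
      -- the coarsest interpolation is the constant `F a = 0`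
      have h3 := (hfloor 0 τ hτ).1
      have h4 : ⌊2 ^ 0 * ((τ - a) / h)⌋₊ = 0 := by simpa using h3
      have h5 : P 0 τ = 0 := by
        simp only [hP, h4, hpt]
        simpa using hF0
      rw [h5, sub_zero]
    simp_rw [h2] at h1
    have h3 : Tendsto (fun N => P N τ) atTop (𝓝 (F τ)) := by
      rw [tendsto_iff_norm_sub_tendsto_zero]
      have h4 : Tendsto (fun N : ℕ => C * (h / 2 ^ N) ^ γ) atTop (𝓝 0) := by
        have h5 : Tendsto (fun N : ℕ => h / 2 ^ N) atTop (𝓝 0) :=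
          tendsto_const_nhds.div_atTop (tendsto_pow_atTop_atTop_of_one_lt one_lt_two)
        have h6 := (h5.rpow_const (p := γ) (Or.inr (by linarith))).const_mul C
        rwa [Real.zero_rpow (by linarith), mul_zero] at h6
      refine squeeze_zero (fun _ => norm_nonneg _) (fun N => ?_) h4
      obtain ⟨h5, h6⟩ := hfloor N τ hτ
      rw [norm_sub_rev]
      refine (hF _ _ (hpta _ _) h6.1 hτ.2).trans ?_
      refine mul_le_mul_of_nonneg_left
        (Real.rpow_le_rpow (by linarith [h6.1]) ?_ (by linarith)) hC.le
      have h7 := h6.2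
      simp only [hpt] at h7 ⊢
      push_cast at h7
      linarith
    rw [tendsto_nhds_unique h3 h1]
    exact hs.hasSum
  refine (uNorm_le_of_decomp hab (fun n => (lam n : ℂ)) A hAt hsum).trans (le_of_eq ?_)
  unfold holderConst
  rw [← ENNReal.tsum_mul_left]
  refine tsum_congr fun n => ?_
  rw [← ofReal_norm, Complex.norm_real, Real.norm_of_nonneg (hlam0 n).le]
  simp only [hlam]
  rw [ENNReal.ofReal_mul (by positivity), ENNReal.ofReal_pow (by positivity)]

end U


/-! ### Decreasing rearrangements -/

theorem le_nthLargest {n : ℕ} {x : Fin n → ℝ} {i : ℕ} (hi : i < n) {U : Finset (Fin n)}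
    (hU : i + 1 ≤ U.card) {r : ℝ} (hr : ∀ j ∈ U, r ≤ x j) : r ≤ nthLargest x i := by
  unfold nthLargest
  rw [dif_pos hi]
  set σ := Tuple.sort x with hσ
  set e := Fin.rev ⟨i, hi⟩ with he
  -- only `i` positions lie above `e`, so one of the `i + 1` indices in `U` is sorted to `e` or below
  have hex : ∃ j, j ≤ e ∧ σ j ∈ U := by
    by_contra! hcon
    have h1 : U ⊆ (Finset.Ioi e).image σ := by
      intro j hj
      rw [Finset.mem_image]
      refine ⟨σ.symm j, ?_, by simp⟩
      rw [Finset.mem_Ioi]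
      by_contra h2
      exact hcon _ (not_lt.1 h2) (by simpa using hj)
    have h2 := (Finset.card_le_card h1).trans Finset.card_image_le
    rw [Fin.card_Ioi, he, Fin.val_rev] at h2
    simp only at h2
    omega
  obtain ⟨j, hj, hjU⟩ := hex
  exact (hr _ hjU).trans (Tuple.monotone_sort x hj)

theorem sum_le_sum_nthLargest {n : ℕ} (x : Fin n → ℝ) (V : Finset (Fin n)) :
    ∑ j ∈ V, x j ≤ ∑ i ∈ Finset.range V.card, nthLargest x i := by
  induction hv : V.card generalizing V with
  | zero => simp [Finset.card_eq_zero.1 hv]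
  | succ v ih =>
    have hne : V.Nonempty := Finset.card_pos.1 (by omega)
    obtain ⟨j, hj, hmin⟩ := V.exists_min_image x hne
    have hlt : v < n := by
      have := V.card_le_univ
      rw [Fintype.card_fin] at this
      omega
    rw [← Finset.sum_erase_add _ _ hj, Finset.sum_range_succ]
    refine add_le_add (ih _ ?_) (le_nthLargest hlt hv.ge hmin)
    rw [Finset.card_erase_of_mem hj, hv]
    rfl

theorem sum_range_eq_betaStar {m : ℕ} (β : Fin (m + 1) → ℝ) (w : ℕ) :
    ∑ i ∈ Finset.range (w + 2), nthLargest (fun i : Fin m => β i.succ) i =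
      betaStar β 1 + betaStar β 2 + ∑ l ∈ Finset.Icc 2 (w + 1), betaStar β (l + 1) := by
  induction w with
  | zero => simp [Finset.sum_range_succ, betaStar]
  | succ w ih =>
    rw [Finset.sum_range_succ, ih, Finset.sum_Icc_succ_top (b := w + 1) (by omega)]
    simp only [betaStar]
    rw [show w + 1 + 1 + 1 - 1 = w + 2 by omega]
    ring

/-! ### The numerology of the exponents -/

/-- The exponents of the frequencies in the multilinear estimate: `β_0 + s` for the output and
`β_j - s` for the inputs. -/
def expo {m : ℕ} (β : Fin (m + 1) → ℝ) (s : ℝ) : Fin (m + 1) → ℝ :=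
  Fin.cons (β 0 + s) fun j => β j.succ - s

section expo
variable {d m : ℕ} {α₁ α₂ s ρ : ℝ} {β : Fin (m + 1) → ℝ}

theorem expo_pair_le (hα₁ : 0 < α₁) (hs : EnoughIrregularity d α₁ α₂ β s ρ)
    {p q : Fin (m + 1)} (hpq : p ≠ q) : expo β s p + expo β s q ≤ ρ * α₁ := by
  have h1 : ∀ j : Fin m, β 0 + β j.succ ≤ ρ * α₁ := fun j => by
    have h := hs.high_low
    rw [div_le_iff₀ hα₁] at h
    have : β j.succ ≤ betaStar β 1 := by
      unfold betaStar
      exact le_nthLargest (x := fun i : Fin m => β i.succ) (U := {j}) (i := 1 - 1)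
        (by have := j.2; omega) (by simp) (by simp)
    linarith
  induction p using Fin.cases with
  | zero =>
    induction q using Fin.cases with
    | zero => exact absurd rfl hpq
    | succ j => simp only [expo, Fin.cons_zero, Fin.cons_succ]; linarith [h1 j]
  | succ i =>
    induction q using Fin.cases with
    | zero => simp only [expo, Fin.cons_zero, Fin.cons_succ]; linarith [h1 i]
    | succ j =>
      simp only [expo, Fin.cons_succ]
      have h := hs.high_high
      rw [div_le_iff₀ hα₁] at h
      have hij : i ≠ j := fun h => hpq (by rw [h])
      have h2 := sum_le_sum_nthLargest (fun i : Fin m => β i.succ) {i, j}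
      rw [Finset.sum_pair hij, Finset.card_pair hij] at h2
      have h3 := sum_range_eq_betaStar β 0
      simp only [zero_add] at h3
      rw [h3] at h2
      simp at h2
      linarith

theorem expo_sum_lt (hα : 0 < α₁ + α₂) (hs : EnoughIrregularity d α₁ α₂ β s ρ)
    {U : Finset (Fin (m + 1))} (hU : 3 ≤ U.card) :
    ∑ j ∈ U, expo β s j + (U.card - 2) * (d / 2 : ℝ) < ρ * (α₁ + α₂) := by
  classical
  set V : Finset (Fin m) := Finset.univ.filter fun j => j.succ ∈ U with hV
  have hsum : ∀ f : Fin (m + 1) → ℝ,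
      ∑ j ∈ U, f j = (if 0 ∈ U then f 0 else 0) + ∑ j ∈ V, f j.succ := fun f => by
    have h := Finset.sum_ite_mem Finset.univ U f
    rw [Finset.univ_inter] at h
    rw [← h, Fin.sum_univ_succ, hV, Finset.sum_filter]
  have h1 := hsum (expo β s)
  have h2 := hsum fun _ => 1
  simp only [expo, Fin.cons_zero, Fin.cons_succ, Finset.sum_sub_distrib, Finset.sum_const,
    nsmul_eq_mul, mul_one] at h1 h2
  change ∑ j ∈ U, expo β s j = _ at h1
  have h3 := sum_le_sum_nthLargest (fun i : Fin m => β i.succ) V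
  have hVm : V.card ≤ m := by simpa using V.card_le_univ
  have hVU : U.card ≤ V.card + 1 ∧ (0 ∉ U → U.card = V.card) := by
    split_ifs at h2 with h0
    · have : U.card = 1 + V.card := by exact_mod_cast h2
      exact ⟨by omega, fun h => absurd h0 h⟩
    · have : U.card = V.card := by rw [zero_add] at h2; exact_mod_cast h2
      exact ⟨by omega, fun _ => this⟩
  obtain ⟨w, hw⟩ : ∃ w, V.card = w + 2 := ⟨V.card - 2, by omega⟩
  rw [hw, sum_range_eq_betaStar] at h3
  -- if the output belongs to `U`, this is a condition of the form `sum_after`, otherwise `sum_before`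
  split_ifs at h1 h2 with h0
  · have h := hs.sum_after (w + 2) (by omega) (by omega)
    rw [div_lt_iff₀ hα, show w + 2 - 1 = w + 1 by omega] at h
    simp only [Finset.sum_sub_distrib, Finset.sum_add_distrib, Finset.sum_const, Nat.card_Icc,
      nsmul_eq_mul, show w + 1 + 1 - 2 = w by omega] at h
    rw [h1, h2, hw]
    push_cast at h ⊢
    linarith
  · have hU' := hVU.2 h0
    obtain ⟨v, rfl⟩ : ∃ v, w = v + 1 := ⟨w - 1, by omega⟩
    have h := hs.sum_before (v + 2) (by omega) (by omega)
    rw [div_lt_iff₀ hα] at h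
    simp only [Finset.sum_sub_distrib, Finset.sum_add_distrib, Finset.sum_const, Nat.card_Icc,
      nsmul_eq_mul, show v + 2 + 1 - 2 = v + 1 by omega] at h
    rw [h1, h2, hw]
    rw [show v + 1 + 1 = v + 2 by omega] at h3
    push_cast at h ⊢
    linarith

theorem exists_gap (hα : 0 < α₁ + α₂) (hs : EnoughIrregularity d α₁ α₂ β s ρ) :
    ∃ η : ℝ, 0 < η ∧ ∀ U : Finset (Fin (m + 1)), 3 ≤ U.card →
      ∑ j ∈ U, expo β s j + (U.card - 2) * (d / 2 + η : ℝ) ≤ ρ * (α₁ + α₂) := by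
  have h : ∀ᶠ η : ℝ in 𝓝[>] 0, ∀ U : Finset (Fin (m + 1)), 3 ≤ U.card →
      ∑ j ∈ U, expo β s j + (U.card - 2) * (d / 2 + η : ℝ) ≤ ρ * (α₁ + α₂) := by
    rw [eventually_all]
    intro U
    rw [eventually_imp_distrib_left]
    intro hU
    have h1 : Tendsto (fun η : ℝ => ∑ j ∈ U, expo β s j + (U.card - 2) * (d / 2 + η : ℝ))
        (𝓝[>] 0) (𝓝 (∑ j ∈ U, expo β s j + (U.card - 2) * (d / 2 + 0 : ℝ))) := by
      refine tendsto_nhdsWithin_of_tendsto_nhds (Continuous.tendsto ?_ 0)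
      fun_prop
    rw [add_zero] at h1
    exact (h1.eventually_lt_const (expo_sum_lt hα hs hU)).mono fun _ h => h.le
  obtain ⟨η, h1, h2⟩ := (h.and self_mem_nhdsWithin).exists
  exact ⟨η, h2, h1⟩

/-- The exponent inequality behind the multilinear estimate. Here `p` and `q` carry the two
largest frequencies, which are comparable, and `r` carries the third largest one. -/
theorem exponent_le (hα₁ : 0 < α₁) (hs : EnoughIrregularity d α₁ α₂ β s ρ)
    {η : ℝ} (hη : ∀ U : Finset (Fin (m + 1)), 3 ≤ U.card →
      ∑ j ∈ U, expo β s j + (U.card - 2) * (d / 2 + η : ℝ) ≤ ρ * (α₁ + α₂))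
    {c : ℕ} {ν : Fin (m + 1) → ℕ} {p q r : Fin (m + 1)} (hpq : p ≠ q) (hrp : r ≠ p) (hrq : r ≠ q)
    (hqp : ν q ≤ ν p) (hpc : ν p ≤ ν q + c) (hrq' : ν r ≤ ν q)
    (hr : ∀ j, j ≠ p → j ≠ q → ν j ≤ ν r) :
    ∑ j, expo β s j * ν j + (d / 2 : ℝ) * ∑ j ∈ (Finset.univ.erase p).erase q, (ν j : ℝ)
      - ρ * α₁ * ν p - ρ * α₂ * ν r ≤
    c * ∑ j, |expo β s j| - η * ∑ j ∈ (Finset.univ.erase p).erase q, (ν j : ℝ) := by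
  set h := expo β s with hh
  set R := (Finset.univ.erase p).erase q with hR
  have hq : q ∈ Finset.univ.erase p := by simp [hpq.symm]
  have hrR : r ∈ R := by simp [hR, hrp, hrq]
  -- the entries below `r` whose total exponent is positive: their levels are raised to `ν r`, while those
  -- of the others are dropped
  set S := (R.erase r).filter fun j => 0 < h j + d / 2 + η with hS
  set U := insert p (insert q (insert r S)) with hU
  have hrS : r ∉ S := by simp [hS]
  have hqS : q ∉ insert r S := by simp [hS, hR, hrq.symm]
  have hpS : p ∉ insert q (insert r S) := by simp [hS, hR, hrp.symm, hpq]
  have hUc : U.card = S.card + 3 := by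
    rw [hU, Finset.card_insert_of_notMem hpS, Finset.card_insert_of_notMem hqS,
      Finset.card_insert_of_notMem hrS]
  have h1 := hη U (by omega)
  rw [hUc, hU, Finset.sum_insert hpS, Finset.sum_insert hqS, Finset.sum_insert hrS] at h1
  have h2 : ∑ j ∈ R.erase r, (h j + d / 2 + η) * ν j ≤ ∑ j ∈ S, (h j + d / 2 + η) * ν r := by
    rw [hS, Finset.sum_filter]
    refine Finset.sum_le_sum fun j hj => ?_
    have hj' : j ≠ r ∧ j ≠ q ∧ j ≠ p := by simpa [hR] using hj
    have h3 : (ν j : ℝ) ≤ ν r := by exact_mod_cast hr j hj'.2.2 hj'.2.1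
    split_ifs with h4
    · exact mul_le_mul_of_nonneg_left h3 h4.le
    · exact mul_nonpos_of_nonpos_of_nonneg (not_lt.1 h4) (Nat.cast_nonneg _)
  have h3 : ∑ j, h j * ν j = ∑ j ∈ R, h j * ν j + h q * ν q + h p * ν p := by
    rw [← Finset.sum_erase_add _ _ (Finset.mem_univ p), ← Finset.sum_erase_add _ _ hq]
  have h4 : ∑ j ∈ R, h j * ν j + (d / 2 : ℝ) * ∑ j ∈ R, (ν j : ℝ) + η * ∑ j ∈ R, (ν j : ℝ) =
      ∑ j ∈ R.erase r, (h j + d / 2 + η) * ν j + (h r + d / 2 + η) * ν r := by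
    rw [Finset.sum_erase_add _ _ hrR, Finset.mul_sum, Finset.mul_sum, ← Finset.sum_add_distrib,
      ← Finset.sum_add_distrib]
    exact Finset.sum_congr rfl fun j _ => by ring
  have h5 : ∑ j ∈ S, (h j + d / 2 + η) * ν r =
      (∑ j ∈ S, h j + S.card * (d / 2 + η)) * ν r := by
    rw [← Finset.sum_mul]
    congr 1
    rw [Finset.sum_add_distrib, Finset.sum_add_distrib, Finset.sum_const, Finset.sum_const]
    simp only [nsmul_eq_mul]; ring
  have h6 := expo_pair_le hα₁ hs hpq
  have h7 : |h q| ≤ ∑ j, |h j| :=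
    Finset.single_le_sum (f := fun j => |h j|) (fun _ _ => abs_nonneg _) (Finset.mem_univ q)
  have hrp' : (ν r : ℝ) ≤ ν p := by exact_mod_cast hrq'.trans hqp
  have hqp' : (ν q : ℝ) ≤ ν p := by exact_mod_cast hqp
  have hpc' : (ν p : ℝ) ≤ ν q + c := by exact_mod_cast hpc
  -- the exponent of `p` and `q` together is nonpositive, so the level `ν p` may be lowered to `ν r`
  have h8 : (h p + h q - ρ * α₁) * ν p ≤ (h p + h q - ρ * α₁) * ν r :=
    mul_le_mul_of_nonpos_left hrp' (by linarith)
  have h9 : h q * ν q ≤ h q * ν p + c * ∑ j, |h j| := by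
    have e1 : -(h q) * (ν p - ν q) ≤ |h q| * c :=
      mul_le_mul ((neg_le_abs _)) (by linarith) (by linarith) (abs_nonneg _)
    have e2 : |h q| * c ≤ c * ∑ j, |h j| := by
      rw [mul_comm]; exact mul_le_mul_of_nonneg_left h7 (Nat.cast_nonneg _)
    linarith
  have h10 := mul_le_mul_of_nonneg_right h1 (Nat.cast_nonneg (α := ℝ) (ν r))
  push_cast at h10
  rw [h3]
  nlinarith

end expo


/-! ### The convolution constraint -/

section Gamma
variable {d m : ℕ} {ε : Fin (m + 1) → ℤˣ}

theorem freqNorm_eq_norm (k : Fin d → ℤ) :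
    freqNorm k = ‖WithLp.toLp 2 (fun i => (k i : ℝ))‖ := by
  rw [EuclideanSpace.norm_eq]
  simp [freqNorm]

/-- On the convolution set, each frequency is at most the sum of the others. -/
theorem freqNorm_le_sum {κ : Fin (m + 1) → Fin d → ℤ} (hκ : κ ∈ Gam d ε) (p : Fin (m + 1)) :
    freqNorm (κ p) ≤ ∑ j ∈ Finset.univ.erase p, freqNorm (κ j) := by
  set E : (Fin d → ℤ) → EuclideanSpace ℝ (Fin d) := fun k => WithLp.toLp 2 fun i => (k i : ℝ)
    with hE
  have h0 : ∑ j, ((ε j : ℤ) : ℝ) • E (κ j) = 0 := by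
    ext i
    have h := congrFun (show ∑ j, (ε j : ℤ) • κ j = 0 from hκ) i
    simp only [Finset.sum_apply, Pi.smul_apply, smul_eq_mul, Pi.zero_apply] at h
    have h' : ((∑ j, (ε j : ℤ) * κ j i : ℤ) : ℝ) = 0 := by rw [h]; simp
    push_cast at h'
    simpa [hE] using h'
  have hn : ∀ j, ‖((ε j : ℤ) : ℝ) • E (κ j)‖ = freqNorm (κ j) := fun j => by
    rw [norm_smul, freqNorm_eq_norm]
    rcases Int.units_eq_one_or (ε j) with h | h <;> simp [h, hE]
  rw [← Finset.add_sum_erase _ _ (Finset.mem_univ p)] at h0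
  have h1 := eq_neg_of_add_eq_zero_left h0
  rw [← hn p, h1, norm_neg]
  refine (norm_sum_le _ _).trans (le_of_eq ?_)
  exact Finset.sum_congr rfl fun j _ => hn j

theorem lvl_le_of_mem_Gam {κ : Fin (m + 1) → Fin d → ℤ} (hκ : κ ∈ Gam d ε) {p q : Fin (m + 1)}
    (hq : ∀ j, j ≠ p → lvl (κ j) ≤ lvl (κ q)) : lvl (κ p) ≤ lvl (κ q) + m := by
  rw [lvl_le_iff]
  refine (freqNorm_le_sum hκ p).trans ?_
  calc ∑ j ∈ Finset.univ.erase p, freqNorm (κ j)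
      ≤ ∑ j ∈ Finset.univ.erase p, (2 : ℝ) ^ lvl (κ q) := by
        refine Finset.sum_le_sum fun j hj => (freqNorm_le_lvl _).trans ?_
        exact pow_le_pow_right₀ one_le_two (hq j (Finset.ne_of_mem_erase hj))
    _ = m * 2 ^ lvl (κ q) := by
        rw [Finset.sum_const, Finset.card_erase_of_mem (Finset.mem_univ p)]
        simp
    _ ≤ 2 ^ m * 2 ^ lvl (κ q) := by
        gcongr
        exact_mod_cast (Nat.lt_two_pow_self (n := m)).le
    _ = 2 ^ (lvl (κ q) + m) := by rw [pow_add, mul_comm]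

theorem eq_of_mem_Gam {κ κ' : Fin (m + 1) → Fin d → ℤ} (hκ : κ ∈ Gam d ε) (hκ' : κ' ∈ Gam d ε)
    (p : Fin (m + 1)) (h : ∀ j, j ≠ p → κ j = κ' j) : κ = κ' := by
  have h0 : ∑ j, (ε j : ℤ) • κ j = ∑ j, (ε j : ℤ) • κ' j :=
    (show _ = (0 : Fin d → ℤ) from hκ).trans (show _ = (0 : Fin d → ℤ) from hκ').symm
  rw [← Finset.add_sum_erase _ _ (Finset.mem_univ p),
    ← Finset.add_sum_erase (f := fun j => (ε j : ℤ) • κ' j) _ (Finset.mem_univ p)] at h0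
  have h1 : ∑ j ∈ Finset.univ.erase p, (ε j : ℤ) • κ j =
      ∑ j ∈ Finset.univ.erase p, (ε j : ℤ) • κ' j :=
    Finset.sum_congr rfl fun j hj => by rw [h j (Finset.ne_of_mem_erase hj)]
  rw [h1] at h0
  have h2 := add_right_cancel h0
  funext j
  by_cases hj : j = p
  · subst hj
    rcases Int.units_eq_one_or (ε j) with h3 | h3 <;> simpa [h3] using h2
  · exact h j hj

end Gamma

/-! ### Multilinear forms localized to dyadic blocks -/

section forms
variable {d m : ℕ}

/-- The multilinear form with multiplier `Q` restricted to the inputs of levels `n`; it is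
`nonlin` applied to the dyadic projections, as a finite sum. -/
def dform (ε : Fin (m + 1) → ℤˣ) (Q : (Fin (m + 1) → Fin d → ℤ) → ℂ) (n : Fin m → ℕ)
    (x : Fin m → Coeffs d) : Coeffs d := fun k₀ =>
  ∑ k ∈ Fintype.piFinset fun j => shell d (n j), (Gam d ε).indicator
    (fun κ => Q κ * ∏ j : Fin m, signConj (ε j.succ) (x j (κ j.succ)))
    (Fin.cons k₀ k : Fin (m + 1) → Fin d → ℤ)

theorem enorm_signConj (e : ℤˣ) (z : ℂ) : ‖signConj e z‖ₑ = ‖z‖ₑ := by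
  unfold signConj
  split_ifs
  · rfl
  · rw [← ofReal_norm, ← ofReal_norm, RCLike.norm_conj]

theorem enorm_prod_eq {ι : Type*} (S : Finset ι) (z : ι → ℂ) :
    ‖∏ i ∈ S, z i‖ₑ = ∏ i ∈ S, ‖z i‖ₑ := by
  simp_rw [← ofReal_norm]
  rw [norm_prod, ENNReal.ofReal_prod_of_nonneg fun _ _ => norm_nonneg _]

theorem signConj_zero (e : ℤˣ) : signConj e 0 = 0 := by
  unfold signConj; split_ifs <;> simp

theorem signConj_mul (e : ℤˣ) (z w : ℂ) : signConj e (z * w) = signConj e z * signConj e w := by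
  unfold signConj; split_ifs <;> simp

theorem signConj_sub (e : ℤˣ) (z w : ℂ) : signConj e (z - w) = signConj e z - signConj e w := by
  unfold signConj; split_ifs <;> simp

theorem signConj_sum {ι : Type*} (s : Finset ι) (e : ℤˣ) (z : ι → ℂ) :
    signConj e (∑ i ∈ s, z i) = ∑ i ∈ s, signConj e (z i) := by
  unfold signConj; split_ifs <;> simp

theorem continuous_signConj (e : ℤˣ) : Continuous (signConj e) := by
  unfold signConj
  split_ifs
  · exact continuous_id
  · exact Complex.continuous_conj

theorem tsum_if_lvl_le (n : ℕ) (f : (Fin d → ℤ) → ℝ≥0∞) :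
    ∑' k, (if lvl k = n then f k else 0) ≤
      ENNReal.ofReal (3 ^ d * (2 ^ n) ^ d) ^ (1 / 2 : ℝ) *
        l2 fun k => if lvl k = n then f k else 0 := by
  have h := tsum_mul_le_l2 (fun k : Fin d → ℤ => if lvl k = n then (1 : ℝ≥0∞) else 0)
    fun k => if lvl k = n then f k else 0
  have e1 : ∀ k : Fin d → ℤ, (if lvl k = n then (1 : ℝ≥0∞) else 0) *
      (if lvl k = n then f k else 0) = if lvl k = n then f k else 0 := fun k => by
    split_ifs <;> simp
  simp_rw [e1] at h
  refine h.trans ?_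
  gcongr
  unfold l2
  gcongr
  rw [tsum_eq_sum (s := shell d n) (fun k hk => by
    rw [mem_shell] at hk; simp [hk])]
  rw [Finset.sum_congr rfl (g := fun _ => (1 : ℝ≥0∞)) fun k hk => by simp [mem_shell.1 hk]]
  rw [Finset.sum_const, nsmul_eq_mul, mul_one]
  rw [← ENNReal.ofReal_natCast]
  exact ENNReal.ofReal_le_ofReal (card_shell_le d n)

/-- `L²` bound of a block of the multilinear form. The two distinguished entries `p`, `q` (output
or inputs) are estimated in `ℓ²`, the others in `ℓ¹` by Bernstein's inequality. -/
theorem enorm_block_dform_le {ε : Fin (m + 1) → ℤˣ} {Q : (Fin (m + 1) → Fin d → ℤ) → ℂ}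
    {ν : Fin (m + 1) → ℕ} {B : ℝ≥0∞} {p q : Fin (m + 1)} (hpq : p ≠ q)
    (hQ : ∀ κ ∈ Gam d ε, (∀ j, lvl (κ j) = ν j) → ‖Q κ‖ₑ ≤ B) (x : Fin m → Coeffs d) :
    ‖block (ν 0) (dform ε Q (fun j => ν j.succ) x)‖ₑ ≤
      B * (∏ j ∈ (Finset.univ.erase p).erase q,
        ENNReal.ofReal (3 ^ d * (2 ^ ν j) ^ d) ^ (1 / 2 : ℝ)) *
        ∏ j, ‖block (ν j.succ) (x j)‖ₑ := by
  set R := (Finset.univ.erase p).erase q with hR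
  set D : ℝ≥0∞ := ∏ j ∈ R, ENNReal.ofReal (3 ^ d * (2 ^ ν j) ^ d) ^ (1 / 2 : ℝ) with hD
  rw [enorm_block_eq]
  refine l2_le_of_dual _ _ fun a => ?_
  set f : Fin (m + 1) → (Fin d → ℤ) → ℝ≥0∞ := Fin.cons a fun j k => ‖x j k‖ₑ with hf
  set y : Fin (m + 1) → (Fin d → ℤ) → ℝ≥0∞ := fun j k => if lvl k = ν j then f j k else 0 with hy
  have h1 : ∀ k₀, a k₀ * (if lvl k₀ = ν 0 then ‖dform ε Q (fun j => ν j.succ) x k₀‖ₑ else 0) ≤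
      ∑' k : Fin m → Fin d → ℤ, B * (Gam d ε).indicator (fun κ => ∏ j, y j (κ j))
        (Fin.cons k₀ k : Fin (m + 1) → Fin d → ℤ) := by
    intro k₀
    split_ifs with hk0
    swap
    · simp
    refine le_trans ?_ (ENNReal.sum_le_tsum (Fintype.piFinset fun j => shell d (ν j.succ)))
    calc a k₀ * ‖dform ε Q (fun j => ν j.succ) x k₀‖ₑ
        ≤ a k₀ * ∑ k ∈ Fintype.piFinset fun j => shell d (ν j.succ), ‖(Gam d ε).indicator
          (fun κ => Q κ * ∏ j : Fin m, signConj (ε j.succ) (x j (κ j.succ)))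
          (Fin.cons k₀ k : Fin (m + 1) → Fin d → ℤ)‖ₑ := by
          gcongr
          exact enorm_sum_le _ _
      _ ≤ _ := by
          rw [Finset.mul_sum]
          refine Finset.sum_le_sum fun k hk => ?_
          rw [Fintype.mem_piFinset] at hk
          by_cases hG : (Fin.cons k₀ k : Fin (m + 1) → Fin d → ℤ) ∈ Gam d ε
          · rw [Set.indicator_of_mem hG, Set.indicator_of_mem hG]
            have h2 : ‖Q (Fin.cons k₀ k)‖ₑ ≤ B := by
              refine hQ _ hG fun j => ?_
              induction j using Fin.cases with
              | zero => simpa using hk0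
              | succ j => simpa using hk j
            rw [Fin.prod_univ_succ]
            simp only [hy, hf, Fin.cons_zero, Fin.cons_succ, if_pos hk0]
            rw [enorm_mul, enorm_prod_eq]
            have h3 : ∀ j, (if lvl (k j) = ν j.succ then ‖x j (k j)‖ₑ else 0) = ‖x j (k j)‖ₑ :=
              fun j => if_pos (by simpa using hk j)
            simp_rw [h3, enorm_signConj]
            calc a k₀ * (‖Q (Fin.cons k₀ k)‖ₑ * ∏ j, ‖x j (k j)‖ₑ)
                ≤ a k₀ * (B * ∏ j, ‖x j (k j)‖ₑ) := by gcongr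
              _ = _ := by ring
          · rw [Set.indicator_of_notMem hG]
            simp
  have hy0 : l2 (y 0) ≤ l2 a := l2_mono fun k => by
    simp only [hy, hf, Fin.cons_zero]
    split_ifs
    · exact le_rfl
    · exact zero_le
  have hys : ∀ j : Fin m, l2 (y j.succ) = ‖block (ν j.succ) (x j)‖ₑ := fun j => by
    rw [enorm_block_eq]
    simp only [hy, hf, Fin.cons_succ]
  calc _ ≤ ∑' k₀, ∑' k : Fin m → Fin d → ℤ, B * (Gam d ε).indicator (fun κ => ∏ j, y j (κ j))
        (Fin.cons k₀ k : Fin (m + 1) → Fin d → ℤ) := ENNReal.tsum_le_tsum h1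
    _ = B * ∑' κ : Fin (m + 1) → Fin d → ℤ,
          (Gam d ε).indicator (fun κ => ∏ j, y j (κ j)) κ := by
        simp_rw [ENNReal.tsum_mul_left]
        congr 1
        rw [← ENNReal.tsum_prod (f := fun k₀ (k : Fin m → Fin d → ℤ) =>
          (Gam d ε).indicator (fun κ => ∏ j, y j (κ j))
          (Fin.cons k₀ k : Fin (m + 1) → Fin d → ℤ))]
        exact (Fin.consEquiv fun _ => Fin d → ℤ).tsum_eq
          ((Gam d ε).indicator (fun κ => ∏ j, y j (κ j)))
    _ ≤ B * (l2 (y p) * l2 (y q) * ∏ j ∈ R, ∑' x, y j x) := by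
        gcongr
        exact tsum_indicator_prod_le _ p q hpq (fun κ h κ' h' => eq_of_mem_Gam h h' p)
          (fun κ h κ' h' => eq_of_mem_Gam h h' q) y
    _ ≤ B * (l2 (y p) * l2 (y q) * ∏ j ∈ R,
          (ENNReal.ofReal (3 ^ d * (2 ^ ν j) ^ d) ^ (1 / 2 : ℝ) * l2 (y j))) := by
        gcongr with j
        exact tsum_if_lvl_le _ _
    _ = B * D * ∏ j, l2 (y j) := by
        have hq : q ∈ Finset.univ.erase p := by simp [hpq.symm]
        rw [← Finset.prod_erase_mul _ _ (Finset.mem_univ p), ← Finset.prod_erase_mul _ _ hq,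
          ← hR, Finset.prod_mul_distrib]
        ring
    _ ≤ _ := by
        rw [Fin.prod_univ_succ]
        simp_rw [hys]
        calc B * D * (l2 (y 0) * ∏ j, ‖block (ν j.succ) (x j)‖ₑ)
            ≤ B * D * (l2 a * ∏ j, ‖block (ν j.succ) (x j)‖ₑ) := by gcongr
          _ = _ := by ring

/-- The kernel in the summation over dyadic blocks: two of the levels are comparable, the blocks
at the other levels come with a geometrically decaying weight, and the output level does not
exceed all the input levels. -/
def ker (η : ℝ) (c : ℕ) (ν : Fin (m + 1) → ℕ) : ℝ≥0∞ :=
  open Classical in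
  if ∃ j : Fin m, ν 0 ≤ ν j.succ + c then
    ∑ p, ∑ q, if p ≠ q ∧ ν p ≤ ν q + c ∧ ν q ≤ ν p + c then
      ∏ j ∈ (Finset.univ.erase p).erase q, dyW (-η) (ν j) else 0
  else 0

theorem le_ker {η : ℝ} {c : ℕ} {ν : Fin (m + 1) → ℕ} (h0 : ∃ j : Fin m, ν 0 ≤ ν j.succ + c)
    {p q : Fin (m + 1)} (hpq : p ≠ q) (h1 : ν p ≤ ν q + c) (h2 : ν q ≤ ν p + c) :
    ∏ j ∈ (Finset.univ.erase p).erase q, dyW (-η) (ν j) ≤ ker η c ν := by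
  classical
  unfold ker
  rw [if_pos h0]
  have h3 : ∏ j ∈ (Finset.univ.erase p).erase q, dyW (-η) (ν j) =
      if p ≠ q ∧ ν p ≤ ν q + c ∧ ν q ≤ ν p + c then
      ∏ j ∈ (Finset.univ.erase p).erase q, dyW (-η) (ν j) else 0 := by
    rw [if_pos ⟨hpq, h1, h2⟩]
  rw [h3]
  refine le_trans ?_ (Finset.single_le_sum (f := fun p => ∑ q,
    if p ≠ q ∧ ν p ≤ ν q + c ∧ ν q ≤ ν p + c then
      ∏ j ∈ (Finset.univ.erase p).erase q, dyW (-η) (ν j) else 0)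
    (fun _ _ => zero_le) (Finset.mem_univ p))
  refine le_trans (le_of_eq ?_) (Finset.single_le_sum (f := fun q =>
    if p ≠ q ∧ ν p ≤ ν q + c ∧ ν q ≤ ν p + c then
      ∏ j ∈ (Finset.univ.erase p).erase q, dyW (-η) (ν j) else 0)
    (fun _ _ => zero_le) (Finset.mem_univ q))
  congr

/-- The indices of the three largest entries of a tuple. -/
theorem exists_top_three (hm : 2 ≤ m) (ν : Fin (m + 1) → ℕ) :
    ∃ p q r : Fin (m + 1), p ≠ q ∧ r ≠ p ∧ r ≠ q ∧ (∀ j, j ≠ p → ν j ≤ ν q) ∧ ν q ≤ ν p ∧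
      ν r ≤ ν q ∧ ∀ j, j ≠ p → j ≠ q → ν j ≤ ν r := by
  have hc : (Finset.univ : Finset (Fin (m + 1))).card = m + 1 := by simp
  obtain ⟨p, -, hp⟩ := Finset.univ.exists_max_image ν ⟨0, Finset.mem_univ _⟩
  have h1 : (Finset.univ.erase p).Nonempty := by
    rw [← Finset.card_pos, Finset.card_erase_of_mem (Finset.mem_univ _), hc]; omega
  obtain ⟨q, hq, hq'⟩ := (Finset.univ.erase p).exists_max_image ν h1
  have h2 : ((Finset.univ.erase p).erase q).Nonempty := by
    rw [← Finset.card_pos, Finset.card_erase_of_mem hq,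
      Finset.card_erase_of_mem (Finset.mem_univ _), hc]; omega
  obtain ⟨r, hr, hr'⟩ := ((Finset.univ.erase p).erase q).exists_max_image ν h2
  simp only [Finset.mem_erase, Finset.mem_univ, and_true] at hq hr hq' hr'
  exact ⟨p, q, r, hq.symm, hr.2, hr.1, fun j hj => hq' j hj, hp q (Finset.mem_univ _),
    hq' r hr.2, fun j hp hq => hr' j ⟨hq, hp⟩⟩

end forms

/-! ### The multiplier bound -/

section multiplier
variable {d m : ℕ} {φ : (Fin d → ℝ) → ℝ} {ε : Fin (m + 1) → ℤˣ}
  {Nhat : (Fin (m + 1) → Fin d → ℤ) → ℂ} {β : Fin (m + 1) → ℝ} {α₁ α₂ s ρ : ℝ}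

/-- Pointwise bound of the multiplier, divided by the oscillation gain `⟨Ω⟩^ρ`, in terms of the
dyadic levels. -/
theorem multiplier_le (hρ : 0 < ρ) (hm : 2 ≤ m) (hβ : SymbolBound ε Nhat β)
    (hα : StronglyNonResonant φ ε Nhat α₁ α₂) :
    ∃ C : ℝ, 0 < C ∧ ∀ κ ∈ Gam d ε, ∀ p q r : Fin (m + 1), p ≠ q → r ≠ p → r ≠ q →
      lvl (κ r) ≤ lvl (κ q) → lvl (κ q) ≤ lvl (κ p) →
      ‖Nhat κ‖ * bracket (resonance φ ε κ) ^ (-ρ) ≤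
        C * 2 ^ (∑ j, β j * lvl (κ j) - ρ * α₁ * lvl (κ p) - ρ * α₂ * lvl (κ r)) := by
  obtain ⟨hβ0, C, hC, hN⟩ := hβ
  obtain ⟨hα₁, hα₂, c, hc, hres⟩ := hα
  refine ⟨C * (∏ j, 2 ^ |β j|) * (c ^ (-ρ) * 2 ^ (ρ * α₁) * 2 ^ (ρ * α₂)), by positivity, ?_⟩
  intro κ hκ p q r hpq hrp hrq h1 h2
  by_cases hN0 : Nhat κ = 0
  · rw [hN0, norm_zero, zero_mul]; positivity
  have hpow : ∀ n : ℕ, ∀ x : ℝ, ((2 : ℝ) ^ n) ^ x = 2 ^ (x * n) := fun n x => by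
    rw [← Real.rpow_natCast, ← Real.rpow_mul (by norm_num), mul_comm]
  have e1 : ‖Nhat κ‖ ≤ C * ((∏ j, 2 ^ |β j|) * 2 ^ (∑ j, β j * lvl (κ j))) := by
    refine (hN κ hκ).trans ?_
    gcongr
    rw [Real.rpow_sum_of_pos (by norm_num), ← Finset.prod_mul_distrib]
    exact Finset.prod_le_prod (fun j _ => Real.rpow_nonneg (bracket_pos _).le _)
      fun j _ => bracket_rpow_le _ _
  have hb : ∀ j, (2 : ℝ) ^ lvl (κ j) / 2 ≤ bracket (freqNorm (κ j)) := fun j => by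
    linarith [two_pow_lvl_le (κ j)]
  have hb0 : (2 : ℝ) ^ lvl (κ p) / 2 ≤ bracket (nthLargest (fun j => freqNorm (κ j)) 0) := by
    refine (hb p).trans (bracket_mono (freqNorm_nonneg _) ?_)
    exact le_nthLargest (U := {p}) (by omega) (by simp) (by simp)
  have hb2 : (2 : ℝ) ^ lvl (κ r) / 2 ≤ bracket (nthLargest (fun j => freqNorm (κ j)) 2) := by
    obtain ⟨i, hi, hmin⟩ := ({p, q, r} : Finset (Fin (m + 1))).exists_min_image
      (fun j => freqNorm (κ j)) ⟨p, by simp⟩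
    have h3 : freqNorm (κ i) ≤ nthLargest (fun j => freqNorm (κ j)) 2 := by
      refine le_nthLargest (U := {p, q, r}) (by omega) ?_ hmin
      rw [Finset.card_eq_three.2 ⟨p, q, r, hpq, hrp.symm, hrq.symm, rfl⟩]
    have h4 : lvl (κ r) ≤ lvl (κ i) := by
      simp only [Finset.mem_insert, Finset.mem_singleton] at hi
      rcases hi with rfl | rfl | rfl
      · exact h1.trans h2
      · exact h1
      · exact le_rfl
    refine le_trans ?_ ((hb i).trans (bracket_mono (freqNorm_nonneg _) h3))
    gcongr
    exact one_le_two
  have e2 : bracket (resonance φ ε κ) ^ (-ρ) ≤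
      (c * (2 ^ lvl (κ p) / 2) ^ α₁ * (2 ^ lvl (κ r) / 2) ^ α₂) ^ (-ρ) := by
    refine Real.rpow_le_rpow_of_nonpos (by positivity) ?_ (by linarith)
    refine le_trans ?_ ((hres κ hκ hN0).trans (abs_le_bracket _))
    gcongr
    exact mul_nonneg hc.le (Real.rpow_nonneg (bracket_pos _).le _)
  have e3 : (c * ((2 : ℝ) ^ lvl (κ p) / 2) ^ α₁ * (2 ^ lvl (κ r) / 2) ^ α₂) ^ (-ρ) =
      (c ^ (-ρ) * 2 ^ (ρ * α₁) * 2 ^ (ρ * α₂)) *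
        (2 ^ (-(ρ * α₁ * lvl (κ p))) * 2 ^ (-(ρ * α₂ * lvl (κ r)))) := by
    rw [Real.mul_rpow (by positivity) (by positivity), Real.mul_rpow hc.le (by positivity),
      ← Real.rpow_mul (by positivity), ← Real.rpow_mul (by positivity),
      Real.div_rpow (by positivity) (by norm_num), Real.div_rpow (by positivity) (by norm_num),
      hpow, hpow]
    have e4 : ∀ α : ℝ, (2 : ℝ) ^ (α * -ρ) = (2 ^ (ρ * α))⁻¹ := fun α => by
      rw [← Real.rpow_neg (by norm_num)]; congr 1; ring
    rw [e4 α₁, e4 α₂]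
    have e5 : ∀ α x : ℝ, (2 : ℝ) ^ (α * -ρ * x) = 2 ^ (-(ρ * α * x)) := fun α x => by
      congr 1; ring
    rw [e5, e5]
    field_simp
  calc _ ≤ C * ((∏ j, 2 ^ |β j|) * 2 ^ (∑ j, β j * lvl (κ j))) *
        ((c ^ (-ρ) * 2 ^ (ρ * α₁) * 2 ^ (ρ * α₂)) *
        (2 ^ (-(ρ * α₁ * lvl (κ p))) * 2 ^ (-(ρ * α₂ * lvl (κ r))))) := by
        rw [← e3]
        exact mul_le_mul e1 e2 (Real.rpow_nonneg (bracket_pos _).le _) (by positivity)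
    _ = _ := by
        rw [sub_sub, sub_eq_add_neg, Real.rpow_add (by norm_num), neg_add,
          Real.rpow_add (by norm_num)]
        ring

theorem dyW_mul (s t : ℝ) (n : ℕ) : dyW s n * dyW t n = dyW (s + t) n := by
  unfold dyW
  rw [← ENNReal.ofReal_mul (by positivity), ← Real.rpow_add (by norm_num), add_mul]

theorem ofReal_two_rpow_sum {ι : Type*} (S : Finset ι) (f : ι → ℝ) :
    ENNReal.ofReal (2 ^ ∑ i ∈ S, f i) = ∏ i ∈ S, ENNReal.ofReal (2 ^ f i) := by
  rw [Real.rpow_sum_of_pos (by norm_num), ENNReal.ofReal_prod_of_nonneg]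
  intro i _; positivity

/-- The multilinear estimate for dyadic blocks at a fixed time, with the oscillation gain. -/
theorem exists_block_multiplier_bound (hρ : 0 < ρ) (hm : 2 ≤ m) (hβ : SymbolBound ε Nhat β)
    (hα : StronglyNonResonant φ ε Nhat α₁ α₂) (hs : EnoughIrregularity d α₁ α₂ β s ρ) :
    ∃ (η : ℝ) (c : ℕ) (C : ℝ≥0∞), 0 < η ∧ C ≠ ⊤ ∧
      ∀ (Q : (Fin (m + 1) → Fin d → ℤ) → ℂ) (A : ℝ≥0∞) (ν : Fin (m + 1) → ℕ)
        (x : Fin m → Coeffs d),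
      (∀ κ ∈ Gam d ε, ‖Q κ‖ₑ ≤ A * ENNReal.ofReal (‖Nhat κ‖ * bracket (resonance φ ε κ) ^ (-ρ))) →
      dyW s (ν 0) * ‖block (ν 0) (dform ε Q (fun j => ν j.succ) x)‖ₑ ≤
        C * A * ker η c ν * ∏ j, (dyW s (ν j.succ) * ‖block (ν j.succ) (x j)‖ₑ) := by
  obtain ⟨C₁, hC₁, hmult⟩ := multiplier_le hρ hm hβ hα
  obtain ⟨η, hη, hgap⟩ := exists_gap (add_pos_of_pos_of_nonneg hα.1 hα.2.1) hs
  set C' : ℝ := C₁ * 2 ^ ((m : ℝ) * ∑ j, |expo β s j|) * (3 ^ (d / 2 : ℝ)) ^ (m - 1) with hC'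
  refine ⟨η, m, ENNReal.ofReal C', hη, ENNReal.ofReal_ne_top, fun Q A ν x hQ => ?_⟩
  obtain ⟨p, q, r, hpq, hrp, hrq, hjq, hqp, hrq', hr⟩ := exists_top_three hm ν
  set R := (Finset.univ.erase p).erase q with hR
  have hRc : R.card = m - 1 := by
    rw [hR, Finset.card_erase_of_mem (by simp [hpq.symm]),
      Finset.card_erase_of_mem (Finset.mem_univ _)]
    simp
  -- if the convolution constraint has no solution at the levels `ν`, the form vanishes
  by_cases hex : ∃ κ ∈ Gam d ε, ∀ j, lvl (κ j) = ν j
  swap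
  · have h := enorm_block_dform_le (B := 0) (Q := Q) (ν := ν) hpq
      (fun κ h1 h2 => absurd ⟨κ, h1, h2⟩ hex) x
    simp only [zero_mul, nonpos_iff_eq_zero] at h
    rw [h, mul_zero]
    exact zero_le
  obtain ⟨κ₀, hκ₀, hlv⟩ := hex
  -- the constraint makes the two largest levels comparable
  have hpc : ν p ≤ ν q + m := by
    have := lvl_le_of_mem_Gam hκ₀ (p := p) (q := q) fun j hj => by
      rw [hlv, hlv]; exact hjq j hj
    rwa [hlv, hlv] at this
  have hadm : ∃ j : Fin m, ν 0 ≤ ν j.succ + m := by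
    obtain ⟨i, -, hi⟩ := (Finset.univ : Finset (Fin m)).exists_max_image (fun j => ν j.succ)
      ⟨⟨0, by omega⟩, Finset.mem_univ _⟩
    refine ⟨i, ?_⟩
    have := lvl_le_of_mem_Gam hκ₀ (p := 0) (q := i.succ) fun j hj => by
      obtain ⟨l, rfl⟩ := Fin.exists_succ_eq.2 hj
      rw [hlv, hlv]; exact hi l (Finset.mem_univ _)
    rwa [hlv, hlv] at this
  set X : ℝ := ∑ j, β j * ν j - ρ * α₁ * ν p - ρ * α₂ * ν r with hX
  have hB : ∀ κ ∈ Gam d ε, (∀ j, lvl (κ j) = ν j) → ‖Q κ‖ₑ ≤ A * ENNReal.ofReal (C₁ * 2 ^ X) := by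
    intro κ h1 h2
    refine (hQ κ h1).trans (mul_le_mul' le_rfl (ENNReal.ofReal_le_ofReal ?_))
    have := hmult κ h1 p q r hpq hrp hrq (by rw [h2, h2]; exact hrq') (by rw [h2, h2]; exact hqp)
    simpa only [h2] using this
  have hmain := enorm_block_dform_le hpq hB x
  have hcard : ∏ j ∈ R, ENNReal.ofReal (3 ^ d * (2 ^ ν j) ^ d) ^ (1 / 2 : ℝ) =
      ENNReal.ofReal ((3 ^ (d / 2 : ℝ)) ^ (m - 1) * 2 ^ ((d / 2 : ℝ) * ∑ j ∈ R, (ν j : ℝ))) := by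
    have e : ∀ j, ENNReal.ofReal (3 ^ d * (2 ^ ν j) ^ d) ^ (1 / 2 : ℝ) =
        ENNReal.ofReal (3 ^ (d / 2 : ℝ)) * ENNReal.ofReal (2 ^ ((d / 2 : ℝ) * ν j)) := fun j => by
      rw [ENNReal.ofReal_rpow_of_nonneg (by positivity) (by norm_num),
        ← ENNReal.ofReal_mul (by positivity), Real.mul_rpow (by positivity) (by positivity)]
      congr 2
      · rw [← Real.rpow_natCast, ← Real.rpow_mul (by norm_num)]; congr 1; ring
      · rw [← pow_mul, ← Real.rpow_natCast, ← Real.rpow_mul (by norm_num)]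
        congr 1; push_cast; ring
    simp_rw [e]
    rw [Finset.prod_mul_distrib, Finset.prod_const, hRc, ENNReal.ofReal_mul (by positivity),
      ENNReal.ofReal_pow (by positivity), Finset.mul_sum, ofReal_two_rpow_sum]
  have hker : ENNReal.ofReal (2 ^ (-η * ∑ j ∈ R, (ν j : ℝ))) ≤ ker η m ν := by
    rw [Finset.mul_sum, ofReal_two_rpow_sum]
    exact le_ker hadm hpq hpc (by omega)
  -- in terms of levels, what is left is the inequality between the exponents
  have hexp := exponent_le hα.1 hs hgap hpq hrp hrq hqp hpc hrq' hr
  have hexpo : ∑ j, expo β s j * ν j = ∑ j, β j * ν j + s * ν 0 - s * ∑ j : Fin m, (ν j.succ : ℝ) := by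
    rw [Fin.sum_univ_succ, Fin.sum_univ_succ]
    simp only [expo, Fin.cons_zero, Fin.cons_succ, sub_mul, Finset.sum_sub_distrib,
      Finset.mul_sum]
    ring
  have hreal : dyW s (ν 0) * (ENNReal.ofReal (C₁ * 2 ^ X) *
      ∏ j ∈ R, ENNReal.ofReal (3 ^ d * (2 ^ ν j) ^ d) ^ (1 / 2 : ℝ)) ≤
      ENNReal.ofReal C' * ker η m ν * ∏ j : Fin m, dyW s (ν j.succ) := by
    refine le_trans ?_ (mul_le_mul_left (mul_le_mul_right hker _) _)
    have e1 : ∏ j : Fin m, dyW s (ν j.succ) =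
        ENNReal.ofReal (2 ^ (s * ∑ j : Fin m, (ν j.succ : ℝ))) := by
      rw [Finset.mul_sum, ofReal_two_rpow_sum]; rfl
    rw [hcard, e1, dyW, ← ENNReal.ofReal_mul (by positivity), ← ENNReal.ofReal_mul (by positivity),
      ← ENNReal.ofReal_mul (by positivity), ← ENNReal.ofReal_mul (by positivity)]
    refine ENNReal.ofReal_le_ofReal ?_
    have e2 : (2 : ℝ) ^ (s * ν 0) * (C₁ * 2 ^ X * ((3 ^ (d / 2 : ℝ)) ^ (m - 1) *
        2 ^ ((d / 2 : ℝ) * ∑ j ∈ R, (ν j : ℝ)))) = C₁ * (3 ^ (d / 2 : ℝ)) ^ (m - 1) *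
        2 ^ (s * ν 0 + X + (d / 2 : ℝ) * ∑ j ∈ R, (ν j : ℝ)) := by
      rw [Real.rpow_add (by norm_num), Real.rpow_add (by norm_num)]; ring
    have e3 : C' * 2 ^ (-η * ∑ j ∈ R, (ν j : ℝ)) * 2 ^ (s * ∑ j : Fin m, (ν j.succ : ℝ)) =
        C₁ * (3 ^ (d / 2 : ℝ)) ^ (m - 1) * 2 ^ ((m : ℝ) * ∑ j, |expo β s j| +
          -η * ∑ j ∈ R, (ν j : ℝ) + s * ∑ j : Fin m, (ν j.succ : ℝ)) := by
      rw [hC', Real.rpow_add (by norm_num), Real.rpow_add (by norm_num)]; ring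
    rw [e2, e3]
    refine mul_le_mul_of_nonneg_left (Real.rpow_le_rpow_of_exponent_le one_le_two ?_)
      (by positivity)
    rw [hexpo] at hexp
    rw [hX]
    linarith
  calc _ ≤ dyW s (ν 0) * (A * ENNReal.ofReal (C₁ * 2 ^ X) * (∏ j ∈ R,
        ENNReal.ofReal (3 ^ d * (2 ^ ν j) ^ d) ^ (1 / 2 : ℝ)) *
        ∏ j, ‖block (ν j.succ) (x j)‖ₑ) := by gcongr
    _ = dyW s (ν 0) * (ENNReal.ofReal (C₁ * 2 ^ X) *
      ∏ j ∈ R, ENNReal.ofReal (3 ^ d * (2 ^ ν j) ^ d) ^ (1 / 2 : ℝ)) *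
        (A * ∏ j, ‖block (ν j.succ) (x j)‖ₑ) := by ring
    _ ≤ ENNReal.ofReal C' * ker η m ν * (∏ j : Fin m, dyW s (ν j.succ)) *
        (A * ∏ j, ‖block (ν j.succ) (x j)‖ₑ) := by gcongr
    _ = _ := by rw [Finset.prod_mul_distrib]; ring

end multiplier


/-! ### Summation over the dyadic levels -/

section kernel
variable {m : ℕ}

theorem l2_dyW_ne_top {η : ℝ} (hη : 0 < η) : l2 (dyW (-η)) ≠ ⊤ := by
  unfold l2
  refine ENNReal.rpow_ne_top_of_nonneg (by norm_num) ?_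
  have e : ∀ n, dyW (-η) n ^ 2 = ENNReal.ofReal (2 ^ (-η * 2)) ^ n := fun n => by
    unfold dyW
    rw [← ENNReal.ofReal_pow (by positivity), ← ENNReal.ofReal_pow (by positivity)]
    congr 1
    rw [← Real.rpow_natCast, ← Real.rpow_mul (by norm_num), ← Real.rpow_natCast,
      ← Real.rpow_mul (by norm_num)]
    congr 1
    push_cast; ring
  simp_rw [e]
  rw [ENNReal.tsum_geometric]
  refine ENNReal.inv_ne_top.2 (tsub_pos_of_lt ?_).ne'
  rw [ENNReal.ofReal_lt_one]
  exact Real.rpow_lt_one_of_one_lt_of_neg one_lt_two (by linarith)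

/-- The constant in the summation over the dyadic levels. -/
def kerConst (m : ℕ) (η : ℝ) (c : ℕ) : ℝ≥0∞ :=
  ((m + 1 : ℕ) * ((m + 1 : ℕ) * (2 * c + 1 : ℕ))) * l2 (dyW (-η)) ^ (m - 1)

theorem kerConst_ne_top {η : ℝ} (hη : 0 < η) (c : ℕ) : kerConst m η c ≠ ⊤ := by
  unfold kerConst
  refine ENNReal.mul_ne_top (by finiteness) (ENNReal.pow_ne_top (l2_dyW_ne_top hη))

theorem tsum_ker_le (η : ℝ) (c : ℕ) (f : Fin (m + 1) → ℕ → ℝ≥0∞) :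
    ∑' ν, ker η c ν * ∏ j, f j (ν j) ≤ kerConst m η c * ∏ j, l2 (f j) := by
  set y : Fin (m + 1) → Fin (m + 1) → Fin (m + 1) → ℕ → ℝ≥0∞ := fun p q j n =>
    if j ∈ (Finset.univ.erase p).erase q then dyW (-η) n * f j n else f j n with hy
  -- comparable levels `ν p` and `ν q` differ by one of `2 c + 1` values; for each of these values either
  -- level determines the other
  set G : Fin (m + 1) → Fin (m + 1) → ℕ → Set (Fin (m + 1) → ℕ) := fun p q δ =>
    {ν | ν p + δ = ν q + c} with hG
  have hyprod : ∀ p q (ν : Fin (m + 1) → ℕ), ∏ j, y p q j (ν j) =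
      (∏ j ∈ (Finset.univ.erase p).erase q, dyW (-η) (ν j)) * ∏ j, f j (ν j) := by
    intro p q ν
    have h1 : ∏ j ∈ (Finset.univ.erase p).erase q, dyW (-η) (ν j) =
        ∏ j, if j ∈ (Finset.univ.erase p).erase q then dyW (-η) (ν j) else 1 := by
      rw [Finset.prod_ite_mem, Finset.univ_inter]
    rw [h1, ← Finset.prod_mul_distrib]
    refine Finset.prod_congr rfl fun j _ => ?_
    simp only [hy]
    split_ifs <;> simp
  have h1 : ∀ ν, ker η c ν * ∏ j, f j (ν j) ≤ ∑ p, ∑ q, ∑ δ ∈ Finset.range (2 * c + 1),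
      if p ≠ q then (G p q δ).indicator (fun ν => ∏ j, y p q j (ν j)) ν else 0 := by
    intro ν
    unfold ker
    split_ifs with h0
    swap
    · simp
    rw [Finset.sum_mul]
    refine Finset.sum_le_sum fun p _ => ?_
    rw [Finset.sum_mul]
    refine Finset.sum_le_sum fun q _ => ?_
    by_cases h2 : p ≠ q ∧ ν p ≤ ν q + c ∧ ν q ≤ ν p + c
    swap
    · rw [if_neg h2, zero_mul]
      exact zero_le
    rw [if_pos h2]
    obtain ⟨hpq, h3, h4⟩ := h2
    have hmem : ν q + c - ν p ∈ Finset.range (2 * c + 1) := by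
      rw [Finset.mem_range]; omega
    refine le_trans (le_of_eq ?_) (Finset.single_le_sum (f := fun δ =>
      if p ≠ q then (G p q δ).indicator (fun ν => ∏ j, y p q j (ν j)) ν else 0)
      (fun _ _ => zero_le) hmem)
    have h5 : ν ∈ G p q (ν q + c - ν p) := by
      simp only [hG, Set.mem_ofPred_eq]; omega
    simp only [if_pos hpq]
    rw [Set.indicator_of_mem h5, hyprod]
  have h2 : ∀ p q δ, p ≠ q → ∑' ν, (G p q δ).indicator (fun ν => ∏ j, y p q j (ν j)) ν ≤
      l2 (dyW (-η)) ^ (m - 1) * ∏ j, l2 (f j) := by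
    intro p q δ hpq
    refine (tsum_indicator_prod_le (G p q δ) p q hpq ?_ ?_ (y p q)).trans ?_
    · intro ν hν ν' hν' h
      funext j
      by_cases hj : j = p
      · subst hj
        have := h q hpq.symm
        simp only [hG, Set.mem_ofPred_eq] at hν hν'
        omega
      · exact h j hj
    · intro ν hν ν' hν' h
      funext j
      by_cases hj : j = q
      · subst hj
        have := h p hpq
        simp only [hG, Set.mem_ofPred_eq] at hν hν'
        omega
      · exact h j hj
    · have hq : q ∈ Finset.univ.erase p := by simp [hpq.symm]
      have hyp : y p q p = f p := by funext n; simp [hy]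
      have hyq : y p q q = f q := by funext n; simp [hy]
      have hR : ((Finset.univ.erase p).erase q).card = m - 1 := by
        rw [Finset.card_erase_of_mem hq, Finset.card_erase_of_mem (Finset.mem_univ _)]
        simp
      rw [hyp, hyq]
      calc l2 (f p) * l2 (f q) * ∏ j ∈ (Finset.univ.erase p).erase q, ∑' n, y p q j n
          ≤ l2 (f p) * l2 (f q) *
            ∏ j ∈ (Finset.univ.erase p).erase q, (l2 (dyW (-η)) * l2 (f j)) := by
            gcongr with j hj
            simp only [hy, if_pos hj]
            exact tsum_mul_le_l2 _ _
        _ = _ := by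
            rw [Finset.prod_mul_distrib, Finset.prod_const, hR,
              ← Finset.prod_erase_mul _ _ (Finset.mem_univ p), ← Finset.prod_erase_mul _ _ hq]
            ring
  calc _ ≤ ∑' ν, ∑ p, ∑ q, ∑ δ ∈ Finset.range (2 * c + 1),
      (if p ≠ q then (G p q δ).indicator (fun ν => ∏ j, y p q j (ν j)) ν else 0) :=
        ENNReal.tsum_le_tsum h1
    _ = ∑ p, ∑ q, ∑ δ ∈ Finset.range (2 * c + 1), ∑' ν,
      (if p ≠ q then (G p q δ).indicator (fun ν => ∏ j, y p q j (ν j)) ν else 0) := by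
        rw [Summable.tsum_finsetSum fun _ _ => ENNReal.summable]
        refine Finset.sum_congr rfl fun p _ => ?_
        rw [Summable.tsum_finsetSum fun _ _ => ENNReal.summable]
        refine Finset.sum_congr rfl fun q _ => ?_
        rw [Summable.tsum_finsetSum fun _ _ => ENNReal.summable]
    _ ≤ ∑ p : Fin (m + 1), ∑ q : Fin (m + 1), ∑ δ ∈ Finset.range (2 * c + 1),
          l2 (dyW (-η)) ^ (m - 1) * ∏ j, l2 (f j) := by
        refine Finset.sum_le_sum fun p _ => Finset.sum_le_sum fun q _ =>
          Finset.sum_le_sum fun δ _ => ?_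
        by_cases hpq : p ≠ q
        · simp only [if_pos hpq]
          exact h2 p q δ hpq
        · simp only [if_neg hpq, tsum_zero]
          exact zero_le
    _ = _ := by
        simp only [Finset.sum_const, Finset.card_univ, Fintype.card_fin, Finset.card_range,
          nsmul_eq_mul]
        unfold kerConst
        ring

theorem l2_ker_le (η : ℝ) (c : ℕ) (f : Fin m → ℕ → ℝ≥0∞) :
    l2 (fun n₀ => ∑' n : Fin m → ℕ, ker η c (Fin.cons n₀ n : Fin (m + 1) → ℕ) *
      ∏ j, f j (n j)) ≤ kerConst m η c * ∏ j, l2 (f j) := by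
  refine l2_le_of_dual _ _ fun a => ?_
  have h := tsum_ker_le η c (Fin.cons a f : Fin (m + 1) → ℕ → ℝ≥0∞)
  rw [Fin.prod_univ_succ] at h
  simp only [Fin.cons_zero, Fin.cons_succ] at h
  refine le_trans (le_of_eq ?_) (h.trans (le_of_eq (by ring)))
  rw [← (Fin.consEquiv fun _ => ℕ).tsum_eq, ENNReal.tsum_prod']
  refine tsum_congr fun n₀ => ?_
  rw [← ENNReal.tsum_mul_left]
  refine tsum_congr fun n => ?_
  have e : (Fin.consEquiv fun _ : Fin (m + 1) => ℕ) (n₀, n) = Fin.cons n₀ n := rfl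
  rw [Fin.prod_univ_succ, e]
  simp only [Fin.cons_zero, Fin.cons_succ]
  ring

/-- Tame form of the summation over the dyadic levels: a weight on the output is carried by one of
the inputs. -/
theorem l2_ker_tame_le (η : ℝ) (c : ℕ) {g : ℕ → ℝ≥0∞} {D : ℝ≥0∞}
    (hg : ∀ n n', n ≤ n' + c → g n ≤ D * g n') (f : Fin m → ℕ → ℝ≥0∞) :
    l2 (fun n₀ => g n₀ * ∑' n : Fin m → ℕ, ker η c (Fin.cons n₀ n : Fin (m + 1) → ℕ) *
      ∏ j, f j (n j)) ≤
    D * kerConst m η c * ∑ i, ∏ j, l2 (fun n => (if j = i then g n else 1) * f j n) := by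
  have h1 : ∀ n₀, g n₀ * ∑' n : Fin m → ℕ, ker η c (Fin.cons n₀ n : Fin (m + 1) → ℕ) *
      ∏ j, f j (n j) ≤ ∑ i, D * ∑' n : Fin m → ℕ, ker η c (Fin.cons n₀ n : Fin (m + 1) → ℕ) *
      ∏ j, ((if j = i then g (n j) else 1) * f j (n j)) := by
    intro n₀
    simp_rw [← ENNReal.tsum_mul_left]
    rw [← Summable.tsum_finsetSum fun _ _ => ENNReal.summable]
    refine ENNReal.tsum_le_tsum fun n => ?_
    by_cases hex : ∃ j : Fin m, n₀ ≤ n j + c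
    · obtain ⟨i, hi⟩ := hex
      refine le_trans ?_ (Finset.single_le_sum (f := fun i =>
        D * (ker η c (Fin.cons n₀ n : Fin (m + 1) → ℕ) *
          ∏ j, ((if j = i then g (n j) else 1) * f j (n j)))) (fun _ _ => zero_le)
        (Finset.mem_univ i))
      rw [Finset.prod_mul_distrib, Finset.prod_ite_eq' Finset.univ i, if_pos (Finset.mem_univ _)]
      calc g n₀ * (ker η c (Fin.cons n₀ n : Fin (m + 1) → ℕ) * ∏ j, f j (n j))
          ≤ D * g (n i) * (ker η c (Fin.cons n₀ n : Fin (m + 1) → ℕ) * ∏ j, f j (n j)) := by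
            gcongr
            exact hg _ _ hi
        _ = _ := by ring
    · have : ker η c (Fin.cons n₀ n : Fin (m + 1) → ℕ) = 0 := by
        unfold ker
        rw [if_neg (by simpa using hex)]
      simp [this]
  refine (l2_mono h1).trans ((l2_sum_le _).trans ?_)
  rw [Finset.mul_sum]
  refine Finset.sum_le_sum fun i _ => ?_
  rw [l2_const_mul, mul_assoc]
  gcongr
  exact l2_ker_le η c fun j n => (if j = i then g n else 1) * f j n

end kernel


/-! ### Products of step functions -/

section partitions
variable {m : ℕ}

/-- The common part of one interval from each of `m` partitions. -/
def cell {K : Fin m → ℕ} (t : ∀ j, Fin (K j + 1) → ℝ) (κ : ∀ j, Fin (K j)) : Set ℝ :=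
  ⋂ j, Ico (t j (κ j).castSucc) (t j (κ j).succ)

theorem cell_disjoint {K : Fin m → ℕ} {t : ∀ j, Fin (K j + 1) → ℝ} (ht : ∀ j, Monotone (t j)) :
    Pairwise (Function.onFun Disjoint (cell t)) := by
  intro κ κ' hne
  refine Set.disjoint_left.2 fun τ h h' => hne (funext fun j => ?_)
  exact step_unique (ht j) (Set.mem_iInter.1 h j) (Set.mem_iInter.1 h' j)

theorem cell_eq_Ico [NeZero m] {K : Fin m → ℕ} (t : ∀ j, Fin (K j + 1) → ℝ)
    (κ : ∀ j, Fin (K j)) :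
    cell t κ = Ico (Finset.univ.sup' Finset.univ_nonempty fun j => t j (κ j).castSucc)
      (Finset.univ.inf' Finset.univ_nonempty fun j => t j (κ j).succ) := by
  ext τ
  simp only [cell, Set.mem_iInter, Set.mem_Ico, Finset.sup'_le_iff, Finset.lt_inf'_iff,
    Finset.mem_univ, forall_const]
  exact forall_and

open Classical in
/-- Sums over the nonempty cells of the common refinement of `m` partitions: every such cell ends at
the end of an interval of one of the partitions, and it is the only cell ending there. Hence a
product of `m` step functions is square-summable over the cells, as each of them is over the
intervals of its own partition. -/
theorem sum_cell_prod_le {K : Fin m → ℕ} {t : ∀ j, Fin (K j + 1) → ℝ}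
    (ht : ∀ j, Monotone (t j)) [NeZero m] (w : ∀ j, Fin (K j) → ℝ≥0∞) (D : Fin m → ℝ≥0∞)
    (hw : ∀ j, ∑ l, w j l ≤ D j) :
    ∑ κ : ∀ j, Fin (K j), (if (cell t κ).Nonempty then ∏ j, w j (κ j) else 0) ≤
      m * ∏ j, D j := by
  set E : Fin m → Finset (∀ j, Fin (K j)) := fun j => Finset.univ.filter fun κ =>
    (cell t κ).Nonempty ∧ ∀ i, t j (κ j).succ ≤ t i (κ i).succ with hE
  have h1 : ∀ κ : ∀ j, Fin (K j), (if (cell t κ).Nonempty then ∏ j, w j (κ j) else 0) ≤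
      ∑ j, if κ ∈ E j then ∏ j, w j (κ j) else 0 := by
    intro κ
    split_ifs with hne
    swap
    · exact zero_le
    obtain ⟨j, -, hj⟩ := (Finset.univ : Finset (Fin m)).exists_min_image
      (fun i => t i (κ i).succ) Finset.univ_nonempty
    refine le_trans (le_of_eq ?_) (Finset.single_le_sum
      (f := fun j => if κ ∈ E j then ∏ j, w j (κ j) else 0) (fun _ _ => zero_le)
      (Finset.mem_univ j))
    simp only [hE]
    rw [if_pos (by simpa using ⟨hne, fun i => hj i (Finset.mem_univ _)⟩)]
  have hinj : ∀ j, Set.InjOn (fun κ : ∀ j, Fin (K j) => κ j) (E j) := by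
    intro j κ hκ κ' hκ' heq
    simp only [hE, Finset.coe_filter, Finset.mem_univ, true_and] at hκ hκ'
    obtain ⟨⟨u, hu⟩, hmin⟩ := hκ
    obtain ⟨⟨u', hu'⟩, hmin'⟩ := hκ'
    simp only at heq
    have hu1 := Set.mem_iInter.1 hu
    have hu1' := Set.mem_iInter.1 hu'
    funext i
    -- both cells end at `t j (κ j).succ`, so they share the times just before it
    have e1 : max u u' < t j (κ j).succ :=
      max_lt (hu1 j).2 (by rw [heq]; exact (hu1' j).2)
    have e2 : max u u' ∈ Ico (t i (κ i).castSucc) (t i (κ i).succ) :=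
      ⟨(hu1 i).1.trans (le_max_left _ _), e1.trans_le (hmin i)⟩
    have e3 : max u u' ∈ Ico (t i (κ' i).castSucc) (t i (κ' i).succ) :=
      ⟨(hu1' i).1.trans (le_max_right _ _), (heq ▸ e1).trans_le (hmin' i)⟩
    exact step_unique (ht i) e2 e3
  have hwD : ∀ i l, w i l ≤ D i := fun i l =>
    (Finset.single_le_sum (f := w i) (fun _ _ => zero_le) (Finset.mem_univ l)).trans (hw i)
  have h2 : ∀ j, ∑ κ : ∀ j, Fin (K j), (if κ ∈ E j then ∏ j, w j (κ j) else 0) ≤ ∏ i, D i := by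
    intro j
    rw [Finset.sum_ite_mem, Finset.univ_inter]
    calc ∑ κ ∈ E j, ∏ i, w i (κ i)
        ≤ ∑ κ ∈ E j, (∏ i ∈ Finset.univ.erase j, D i) * w j (κ j) := by
          refine Finset.sum_le_sum fun κ _ => ?_
          rw [← Finset.prod_erase_mul _ _ (Finset.mem_univ j)]
          gcongr
          exact hwD _ _
      _ = (∏ i ∈ Finset.univ.erase j, D i) * ∑ l ∈ (E j).image fun κ => κ j, w j l := by
          rw [← Finset.mul_sum, Finset.sum_image (hinj j)]
      _ ≤ (∏ i ∈ Finset.univ.erase j, D i) * D j := by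
          gcongr
          exact (Finset.sum_le_sum_of_subset (Finset.subset_univ _)).trans (hw j)
      _ = ∏ i, D i := Finset.prod_erase_mul _ _ (Finset.mem_univ j)
  calc _ ≤ ∑ κ : ∀ j, Fin (K j), ∑ j, if κ ∈ E j then ∏ j, w j (κ j) else 0 :=
        Finset.sum_le_sum fun κ _ => h1 κ
    _ = ∑ j, ∑ κ : ∀ j, Fin (K j), if κ ∈ E j then ∏ j, w j (κ j) else 0 := Finset.sum_comm
    _ ≤ ∑ _j : Fin m, ∏ i, D i := Finset.sum_le_sum fun j _ => h2 j
    _ = _ := by simp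

open Classical in
/-- Cauchy-Schwarz over the cells: since `γ > 1/2`, the powers `|I|^γ` of the lengths of the cells
are square-summable, with `∑ |I|^{2γ} ≤ |J|^{2γ}`. -/
theorem sum_cell_volume_rpow_le {K : Fin m → ℕ} {t : ∀ j, Fin (K j + 1) → ℝ}
    (ht : ∀ j, Monotone (t j)) [NeZero m] {a b : ℝ} {γ : ℝ} (hγ : 1 / 2 < γ)
    (hsub : ∀ κ, cell t κ ⊆ Ico a b) (w : ∀ j, Fin (K j) → ℝ≥0∞) (D : Fin m → ℝ≥0∞)
    (hw : ∀ j, ∑ l, w j l ^ 2 ≤ D j ^ 2) :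
    ∑ κ : ∀ j, Fin (K j), volume (cell t κ) ^ γ *
      (if (cell t κ).Nonempty then ∏ j, w j (κ j) else 0) ≤
      ENNReal.ofReal (b - a) ^ γ * ((m : ℝ≥0∞) ^ (1 / 2 : ℝ) * ∏ j, D j) := by
  have h1 := tsum_mul_le_l2 (fun κ : ∀ j, Fin (K j) => volume (cell t κ) ^ γ)
    (fun κ => if (cell t κ).Nonempty then ∏ j, w j (κ j) else 0)
  rw [tsum_fintype] at h1
  refine h1.trans (mul_le_mul' ?_ ?_)
  · rw [← sqrt_sq_ennreal (ENNReal.ofReal (b - a) ^ γ)]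
    unfold l2
    gcongr
    rw [tsum_fintype]
    have hv : ∀ κ, volume (cell t κ) ≤ ENNReal.ofReal (b - a) := fun κ => by
      rw [← Real.volume_Ico]; exact measure_mono (hsub κ)
    have e : ∀ x : ℝ≥0∞, (x ^ γ) ^ 2 = x ^ (2 * γ - 1) * x := fun x => by
      rw [← ENNReal.rpow_natCast, ← ENNReal.rpow_mul]
      conv_rhs => rw [← ENNReal.rpow_one x, ← ENNReal.rpow_mul, one_mul]
      rw [← ENNReal.rpow_add_of_nonneg _ _ (by linarith) (by norm_num)]
      congr 1; push_cast; ring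
    calc ∑ κ, (volume (cell t κ) ^ γ) ^ 2
        ≤ ∑ κ, ENNReal.ofReal (b - a) ^ (2 * γ - 1) * volume (cell t κ) := by
          refine Finset.sum_le_sum fun κ _ => ?_
          rw [e]
          gcongr
          · linarith
          · exact hv κ
      _ = ENNReal.ofReal (b - a) ^ (2 * γ - 1) * volume (⋃ κ, cell t κ) := by
          rw [← Finset.mul_sum, measure_iUnion (cell_disjoint ht)
            (fun κ => MeasurableSet.iInter fun _ => measurableSet_Ico), tsum_fintype]
      _ ≤ ENNReal.ofReal (b - a) ^ (2 * γ - 1) * ENNReal.ofReal (b - a) := by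
          gcongr
          rw [← Real.volume_Ico]
          exact measure_mono (Set.iUnion_subset hsub)
      _ = _ := (e _).symm
  · rw [← sqrt_sq_ennreal ((m : ℝ≥0∞) ^ (1 / 2 : ℝ) * ∏ j, D j)]
    unfold l2
    gcongr
    rw [tsum_fintype, mul_pow, sq_sqrt_ennreal, ← Finset.prod_pow]
    refine le_trans (Finset.sum_le_sum fun κ _ => le_of_eq ?_)
      (sum_cell_prod_le ht (fun j l => w j l ^ 2) (fun j => D j ^ 2) hw)
    by_cases hc : (cell t κ).Nonempty
    · simp only [if_pos hc]
      rw [Finset.prod_pow]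
    · simp [if_neg hc]

end partitions

/-! ### The oscillatory integral over a time interval -/

section time
variable {d m : ℕ} {ε : Fin (m + 1) → ℤˣ}

theorem dform_sum {ι : Fin m → Type*} (S : ∀ j, Finset (ι j))
    (Q : (Fin (m + 1) → Fin d → ℤ) → ℂ) (n : Fin m → ℕ) (y : ∀ j, ι j → Coeffs d)
    (k₀ : Fin d → ℤ) :
    dform ε Q n (fun j => ∑ i ∈ S j, y j i) k₀ =
      ∑ κ ∈ Fintype.piFinset S, dform ε Q n (fun j => y j (κ j)) k₀ := by
  classical
  unfold dform
  rw [Finset.sum_comm]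
  refine Finset.sum_congr rfl fun k _ => ?_
  by_cases hG : (Fin.cons k₀ k : Fin (m + 1) → Fin d → ℤ) ∈ Gam d ε
  · simp only [Set.indicator_of_mem hG, Fin.cons_succ]
    rw [← Finset.mul_sum]
    congr 1
    simp only [Finset.sum_apply, signConj_sum]
    rw [Finset.prod_univ_sum]
  · simp only [Set.indicator_of_notMem hG, Finset.sum_const_zero]

theorem dform_eq_zero (Q : (Fin (m + 1) → Fin d → ℤ) → ℂ) (n : Fin m → ℕ) {x : Fin m → Coeffs d}
    {j : Fin m} (hj : x j = 0) (k₀ : Fin d → ℤ) : dform ε Q n x k₀ = 0 := by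
  unfold dform
  refine Finset.sum_eq_zero fun k _ => ?_
  refine Set.indicator_apply_eq_zero.2 fun _ => ?_
  rw [Finset.prod_eq_zero (Finset.mem_univ j), mul_zero]
  rw [hj]; exact signConj_zero _

theorem dform_congr (Q : (Fin (m + 1) → Fin d → ℤ) → ℂ) (n : Fin m → ℕ) {x y : Fin m → Coeffs d}
    (h : ∀ j, ∀ k, lvl k = n j → x j k = y j k) (k₀ : Fin d → ℤ) :
    dform ε Q n x k₀ = dform ε Q n y k₀ := by
  unfold dform
  refine Finset.sum_congr rfl fun k hk => ?_
  rw [Fintype.mem_piFinset] at hk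
  have e : ∏ j : Fin m, signConj (ε j.succ) (x j (k j)) =
      ∏ j : Fin m, signConj (ε j.succ) (y j (k j)) :=
    Finset.prod_congr rfl fun j _ => by rw [h j _ (by simpa using hk j)]
  simp only [Set.indicator, Fin.cons_succ, e]

theorem dform_zero (n : Fin m → ℕ) (x : Fin m → Coeffs d) (k₀ : Fin d → ℤ) :
    dform ε 0 n x k₀ = 0 := by
  simp [dform]

theorem norm_dform_le (Q : (Fin (m + 1) → Fin d → ℤ) → ℂ) (n : Fin m → ℕ) (x : Fin m → Coeffs d)
    (k₀ : Fin d → ℤ) {q : (Fin (m + 1) → Fin d → ℤ) → ℝ} (hQ : ∀ κ, ‖Q κ‖ ≤ q κ)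
    {B : Fin m → ℝ} (hx : ∀ j k, ‖x j k‖ ≤ B j) :
    ‖dform ε Q n x k₀‖ ≤ ∑ k ∈ Fintype.piFinset fun j => shell d (n j),
      q (Fin.cons k₀ k) * ∏ j, B j := by
  have hsc : ∀ (e : ℤˣ) (z : ℂ), ‖signConj e z‖ = ‖z‖ := fun e z => by
    have := enorm_signConj e z
    rw [← ofReal_norm, ← ofReal_norm] at this
    exact (ENNReal.ofReal_eq_ofReal_iff (norm_nonneg _) (norm_nonneg _)).1 this
  refine norm_sum_le_of_le _ fun k _ => (norm_indicator_le_norm_self _ _).trans ?_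
  rw [norm_mul, norm_prod]
  simp only [Fin.cons_succ, hsc]
  have hq : 0 ≤ q (Fin.cons k₀ k) := (norm_nonneg _).trans (hQ _)
  gcongr with j
  · exact hQ _
  · exact hx _ _

variable {μ : Measure ℝ}

theorem aestronglyMeasurable_dform {M : ℝ → (Fin (m + 1) → Fin d → ℤ) → ℂ}
    (hM : ∀ κ, Continuous fun τ => M τ κ) {y : Fin m → ℝ → Coeffs d}
    (hy : ∀ j k, AEStronglyMeasurable (fun τ => y j τ k) μ) (n : Fin m → ℕ) (k₀ : Fin d → ℤ) :
    AEStronglyMeasurable (fun τ => dform ε (M τ) n (fun j => y j τ) k₀) μ := by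
  unfold dform
  refine Finset.aestronglyMeasurable_fun_sum _ fun k _ => ?_
  by_cases hG : (Fin.cons k₀ k : Fin (m + 1) → Fin d → ℤ) ∈ Gam d ε
  · simp only [Set.indicator_of_mem hG, Fin.cons_succ]
    refine (hM _).aestronglyMeasurable.mul ?_
    refine Finset.aestronglyMeasurable_fun_prod _ fun j _ => ?_
    exact (continuous_signConj _).comp_aestronglyMeasurable (hy j _)
  · simp only [Set.indicator_of_notMem hG]
    exact aestronglyMeasurable_const

theorem integrableOn_dform {M : ℝ → (Fin (m + 1) → Fin d → ℤ) → ℂ}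
    (hM : ∀ κ, Continuous fun τ => M τ κ) {q : (Fin (m + 1) → Fin d → ℤ) → ℝ}
    (hq : ∀ τ κ, ‖M τ κ‖ ≤ q κ) {a b : ℝ} {y : Fin m → ℝ → Coeffs d}
    (hy : ∀ j k, AEStronglyMeasurable (fun τ => y j τ k) (volume.restrict (Ico a b)))
    {B : Fin m → ℝ} (hB : ∀ j, ∀ τ ∈ Ico a b, ∀ k, ‖y j τ k‖ ≤ B j) (n : Fin m → ℕ)
    (k₀ : Fin d → ℤ) :
    IntegrableOn (fun τ => dform ε (M τ) n (fun j => y j τ) k₀) (Ico a b) := by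
  refine Integrable.of_bound (aestronglyMeasurable_dform hM hy n k₀)
    (∑ k ∈ Fintype.piFinset fun j => shell d (n j), q (Fin.cons k₀ k) * ∏ j, B j) ?_
  rw [ae_restrict_iff' measurableSet_Ico]
  exact Eventually.of_forall fun τ hτ => norm_dform_le _ _ _ _ (hq τ) fun j k => hB j τ hτ k

theorem stepFun_apply {K : ℕ} (t : Fin (K + 1) → ℝ) (ψ : Fin K → L2 d) (τ : ℝ) :
    ((stepFun t ψ τ : L2 d) : Coeffs d) =
      ∑ l, (fun k => ((Ico (t l.castSucc) (t l.succ)).indicator (fun _ => ψ l) τ) k : Coeffs d) := by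
  unfold stepFun
  exact lp.coeFn_sum _ _

theorem stepFun_coeff {K : ℕ} (t : Fin (K + 1) → ℝ) (ψ : Fin K → L2 d) (τ : ℝ)
    (k : Fin d → ℤ) :
    (stepFun t ψ τ) k =
      ∑ l, (Ico (t l.castSucc) (t l.succ)).indicator (fun _ => (ψ l) k) τ := by
  refine (congrFun (stepFun_apply t ψ τ) k).trans ?_
  rw [Finset.sum_apply]
  refine Finset.sum_congr rfl fun l _ => ?_
  by_cases h : τ ∈ Ico (t l.castSucc) (t l.succ)
  · rw [Set.indicator_of_mem h, Set.indicator_of_mem h]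
  · rw [Set.indicator_of_notMem h, Set.indicator_of_notMem h]
    rfl

theorem measurable_stepFun {K : ℕ} (t : Fin (K + 1) → ℝ) (ψ : Fin K → L2 d) (k : Fin d → ℤ) :
    Measurable fun τ => (stepFun t ψ τ) k := by
  have e : (fun τ => (stepFun t ψ τ) k) = fun τ =>
      ∑ l, (Ico (t l.castSucc) (t l.succ)).indicator (fun _ => (ψ l) k) τ :=
    funext fun τ => stepFun_coeff t ψ τ k
  rw [e]
  exact Finset.measurable_fun_sum _ fun l _ => measurable_const.indicator measurableSet_Ico

end time


section time
variable {d m : ℕ} {ε : Fin (m + 1) → ℤˣ}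

theorem integral_dform_const {M : ℝ → (Fin (m + 1) → Fin d → ℤ) → ℂ}
    (hM : ∀ κ, Continuous fun τ => M τ κ) (a b : ℝ) (n : Fin m → ℕ) (x : Fin m → Coeffs d)
    (k₀ : Fin d → ℤ) :
    ∫ τ in Ico a b, dform ε (M τ) n x k₀ = dform ε (fun κ => ∫ τ in Ico a b, M τ κ) n x k₀ := by
  unfold dform
  have hint : ∀ κ, IntegrableOn (fun τ => M τ κ) (Ico a b) := fun κ =>
    ((hM κ).integrableOn_Icc (a := a) (b := b)).mono_set Ico_subset_Icc_self
  rw [integral_finsetSum]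
  · refine Finset.sum_congr rfl fun k _ => ?_
    by_cases hG : (Fin.cons k₀ k : Fin (m + 1) → Fin d → ℤ) ∈ Gam d ε
    · simp only [Set.indicator_of_mem hG]
      rw [integral_mul_const]
    · simp only [Set.indicator_of_notMem hG, integral_zero]
  · intro k _
    by_cases hG : (Fin.cons k₀ k : Fin (m + 1) → Fin d → ℤ) ∈ Gam d ε
    · simp only [Set.indicator_of_mem hG]
      exact (hint _).mul_const _
    · simp only [Set.indicator_of_notMem hG]
      exact integrable_zero _ _ _

/-- The time integral of the multilinear form along step functions: on each cell of the common
refinement the inputs are constant, so that the integrated multiplier is available there. -/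
theorem enorm_block_integral_step_le [NeZero m] {M : ℝ → (Fin (m + 1) → Fin d → ℤ) → ℂ}
    (hM : ∀ κ, Continuous fun τ => M τ κ) {γ : ℝ} (hγ : 1 / 2 < γ) {a b : ℝ}
    {n₀ : ℕ} {n : Fin m → ℕ} {Λ : ℝ≥0∞}
    (hΛ : ∀ σ τ, a ≤ σ → σ ≤ τ → τ ≤ b → ∀ x : Fin m → L2 d,
      ‖block n₀ (dform ε (fun κ => ∫ u in Ico σ τ, M u κ) n fun j => x j)‖ₑ ≤
        Λ * ENNReal.ofReal (τ - σ) ^ γ * ∏ j, ‖x j‖ₑ)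
    {K : Fin m → ℕ} {t : ∀ j, Fin (K j + 1) → ℝ} (ht : ∀ j, Monotone (t j))
    (ht0 : ∀ j, t j 0 = a) (ht1 : ∀ j, t j (Fin.last _) = b)
    (ψ : ∀ j, Fin (K j) → L2 d) (D : Fin m → ℝ≥0∞) (hD : ∀ j, ∑ l, ‖ψ j l‖ₑ ^ 2 ≤ D j ^ 2) :
    ‖block n₀ (fun k₀ => ∫ τ in Ico a b, dform ε (M τ) n (fun j => (stepFun (t j) (ψ j) τ : L2 d)) k₀)‖ₑ ≤
      Λ * (ENNReal.ofReal (b - a) ^ γ * ((m : ℝ≥0∞) ^ (1 / 2 : ℝ) * ∏ j, D j)) := by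
  classical
  set lo : (∀ j, Fin (K j)) → ℝ := fun κ =>
    Finset.univ.sup' Finset.univ_nonempty fun j => t j (κ j).castSucc with hlo
  set hi : (∀ j, Fin (K j)) → ℝ := fun κ =>
    Finset.univ.inf' Finset.univ_nonempty fun j => t j (κ j).succ with hhi
  have hcell : ∀ κ, cell t κ = Ico (lo κ) (hi κ) := fun κ => cell_eq_Ico t κ
  have hta : ∀ j i, a ≤ t j i := fun j i => ht0 j ▸ ht j (Fin.zero_le _)
  have htb : ∀ j i, t j i ≤ b := fun j i => ht1 j ▸ ht j (Fin.le_last _)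
  have hlo_a : ∀ κ, a ≤ lo κ := fun κ =>
    (hta 0 _).trans (Finset.le_sup' (fun j => t j (κ j).castSucc) (Finset.mem_univ 0))
  have hhi_b : ∀ κ, hi κ ≤ b := fun κ =>
    (Finset.inf'_le (fun j => t j (κ j).succ) (Finset.mem_univ 0)).trans (htb 0 _)
  have hsub : ∀ κ, cell t κ ⊆ Ico a b := fun κ τ hτ => by
    rw [hcell] at hτ
    exact ⟨(hlo_a κ).trans hτ.1, hτ.2.trans_le (hhi_b κ)⟩
  have hform : ∀ k₀, ∫ τ in Ico a b, dform ε (M τ) n (fun j => (stepFun (t j) (ψ j) τ : L2 d)) k₀ =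
      ∑ κ : ∀ j, Fin (K j), dform ε (fun κ' => ∫ u in Ico (lo κ) (hi κ), M u κ') n
        (fun j => ψ j (κ j)) k₀ := by
    intro k₀
    have e1 : ∀ τ, dform ε (M τ) n (fun j => (stepFun (t j) (ψ j) τ : L2 d)) k₀ =
        ∑ κ : ∀ j, Fin (K j), (cell t κ).indicator
          (fun τ => dform ε (M τ) n (fun j => ψ j (κ j)) k₀) τ := by
      intro τ
      simp_rw [stepFun_apply]
      rw [dform_sum (fun j => Finset.univ), Fintype.piFinset_univ]
      refine Finset.sum_congr rfl fun κ _ => ?_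
      by_cases hc : τ ∈ cell t κ
      · rw [Set.indicator_of_mem hc]
        congr 1
        funext j
        rw [Set.indicator_of_mem (Set.mem_iInter.1 hc j)]
      · rw [Set.indicator_of_notMem hc]
        simp only [cell, Set.mem_iInter, not_forall] at hc
        obtain ⟨j, hj⟩ := hc
        refine dform_eq_zero _ _ (j := j) ?_ _
        rw [Set.indicator_of_notMem hj]
        rfl
    simp_rw [e1]
    have hmeas : ∀ κ, MeasurableSet (cell t κ) := fun κ => by
      rw [hcell]; exact measurableSet_Ico
    rw [integral_finsetSum]
    · refine Finset.sum_congr rfl fun κ _ => ?_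
      rw [setIntegral_indicator (hmeas κ), Set.inter_eq_right.2 (hsub κ), hcell,
        integral_dform_const hM]
    · intro κ _
      refine IntegrableOn.integrable ?_
      refine Integrable.indicator ?_ (hmeas κ)
      have hc : Continuous fun τ => dform ε (M τ) n (fun j => ψ j (κ j)) k₀ := by
        unfold dform
        refine continuous_finsetSum _ fun k _ => ?_
        by_cases hG : (Fin.cons k₀ k : Fin (m + 1) → Fin d → ℤ) ∈ Gam d ε
        · simp only [Set.indicator_of_mem hG]
          exact (hM _).mul continuous_const
        · simp only [Set.indicator_of_notMem hG]
          exact continuous_const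
      exact (hc.integrableOn_Icc (a := a) (b := b)).mono_set Ico_subset_Icc_self
  have hblock : block n₀ (fun k₀ => ∫ τ in Ico a b,
      dform ε (M τ) n (fun j => (stepFun (t j) (ψ j) τ : L2 d)) k₀) =
      ∑ κ : ∀ j, Fin (K j), block n₀ (dform ε (fun κ' => ∫ u in Ico (lo κ) (hi κ), M u κ') n
        (fun j => ψ j (κ j))) := by
    rw [← block_sum]
    congr 1
    funext k₀
    rw [hform, Finset.sum_apply]
  rw [hblock]
  refine (enorm_sum_le _ _).trans ?_
  refine le_trans ?_ (mul_le_mul' le_rfl (sum_cell_volume_rpow_le ht hγ hsub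
    (fun j l => ‖ψ j l‖ₑ) D hD))
  rw [Finset.mul_sum]
  refine Finset.sum_le_sum fun κ _ => ?_
  by_cases hne : (cell t κ).Nonempty
  · rw [if_pos hne, hcell, Real.volume_Ico, ← mul_assoc]
    rw [hcell, Set.nonempty_Ico] at hne
    exact hΛ _ _ (hlo_a κ) hne.le (hhi_b κ) fun j => ψ j (κ j)
  · rw [if_neg hne, mul_zero, mul_zero]
    rw [hcell, Set.not_nonempty_iff_eq_empty] at hne
    have e : dform ε (fun κ' => ∫ u in Ico (lo κ) (hi κ), M u κ') n (fun j => ψ j (κ j)) = 0 := by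
      rw [hne]
      funext k₀
      simp only [Measure.restrict_empty, integral_zero_measure]
      exact dform_zero _ _ _
    rw [e, enorm_block_eq]
    simp [l2]

/-- Every function with finite `U²` norm is a sum of global step functions. -/
theorem exists_step_decomp {H : Type*} [NormedAddCommGroup H] [NormedSpace ℂ H] {a b : ℝ}
    {f : ℝ → H} {B : ℝ≥0∞} (h : uNorm 2 a b f < B) :
    ∃ (K : ℕ → ℕ) (t : ∀ i, Fin (K i + 1) → ℝ) (ψ : ∀ i, Fin (K i) → H) (D : ℕ → ℝ≥0∞),
      (∀ i, Monotone (t i)) ∧ (∀ i, t i 0 = a) ∧ (∀ i, t i (Fin.last _) = b) ∧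
      (∀ i, ∑ l, ‖ψ i l‖ₑ ^ 2 ≤ D i ^ 2) ∧ ∑' i, D i < B ∧
      (∀ i, ∀ τ, ‖stepFun (t i) (ψ i) τ‖ₑ ≤ D i) ∧
      ∀ τ ∈ Ico a b, HasSum (fun i => stepFun (t i) (ψ i) τ) (f τ) := by
  obtain ⟨c, A, hA, hf, hc⟩ := exists_decomp h
  choose K t ψ ht ht0 ht1 hψ hAe using hA
  refine ⟨K, t, fun i l => c i • ψ i l, fun i => ‖c i‖ₑ, ht, ht0, ht1, ?_, hc, ?_, ?_⟩
  · intro i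
    simp_rw [enorm_smul, mul_pow]
    rw [← Finset.mul_sum]
    refine mul_le_of_le_one_right zero_le ?_
    have h1 := hψ i
    simp_rw [Real.rpow_two] at h1
    have h2 : ∑ l, ‖ψ i l‖ₑ ^ 2 = ENNReal.ofReal (∑ l, ‖ψ i l‖ ^ 2) := by
      rw [ENNReal.ofReal_sum_of_nonneg fun _ _ => by positivity]
      refine Finset.sum_congr rfl fun l _ => ?_
      rw [ENNReal.ofReal_pow (norm_nonneg _), ofReal_norm]
    rw [h2]
    exact ENNReal.ofReal_le_one.2 h1
  all_goals
    have e : ∀ i τ, stepFun (t i) (fun l => c i • ψ i l) τ = c i • stepFun (t i) (ψ i) τ :=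
      fun i τ => by
        unfold stepFun
        rw [Finset.smul_sum]
        refine Finset.sum_congr rfl fun l _ => ?_
        by_cases hl : τ ∈ Ico (t i l.castSucc) (t i l.succ)
        · simp [Set.indicator_of_mem hl]
        · simp [Set.indicator_of_notMem hl]
  · intro i τ
    rw [e, enorm_smul]
    refine mul_le_of_le_one_right zero_le ?_
    rw [← ofReal_norm]
    exact ENNReal.ofReal_le_one.2 (norm_stepFun_le_one (ht i) (hψ i) τ)
  · intro τ hτ
    convert hf τ hτ using 2 with i
    rw [e, hAe i τ hτ]
    rfl

theorem aestronglyMeasurable_coeff {a b : ℝ} {f : ℝ → L2 d} (h : uNorm 2 a b f ≠ ⊤)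
    (k : Fin d → ℤ) :
    AEStronglyMeasurable (fun τ => f τ k) (volume.restrict (Ico a b)) := by
  obtain ⟨K, t, ψ, D, -, -, -, -, -, -, hf⟩ := exists_step_decomp h.lt_top
  set g : ℕ → ℝ → ℂ := fun i τ => (stepFun (t i) (ψ i) τ : L2 d) k with hg
  have hgm : ∀ i, Measurable (g i) := fun i => measurable_stepFun _ _ _
  refine aestronglyMeasurable_of_tendsto_ae atTop
    (f := fun N τ => ∑ i ∈ Finset.range N, g i τ) ?_ ?_
  · intro N
    exact (Finset.measurable_fun_sum _ fun i _ => hgm i).aestronglyMeasurable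
  · rw [ae_restrict_iff' measurableSet_Ico]
    refine Eventually.of_forall fun τ hτ => ?_
    have h2 := (hf τ hτ).mapL (lp.evalCLM ℂ (fun _ : Fin d → ℤ => ℂ) 2 k)
    exact h2.tendsto_sum_nat

theorem tendsto_prod_add_inv (U : Fin m → ℝ≥0∞) (hU : ∀ j, U j ≠ ⊤) {D : ℝ≥0∞} (hD : D ≠ ⊤) :
    Tendsto (fun N : ℕ => D * ∏ j, (U j + ((N : ℝ≥0∞) + 1)⁻¹)) atTop (𝓝 (D * ∏ j, U j)) := by
  have h1 : Tendsto (fun N : ℕ => ((N : ℝ≥0∞) + 1)⁻¹) atTop (𝓝 0) := by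
    have := (tendsto_add_atTop_iff_nat 1).2 ENNReal.tendsto_inv_nat_nhds_zero
    simpa using this
  refine ENNReal.Tendsto.const_mul ?_ (Or.inr hD)
  refine ENNReal.tendsto_finsetProd_of_ne_top _ (fun j _ => ?_) fun j _ => hU j
  simpa using tendsto_const_nhds.add h1

/-- The time integral of the multilinear form along functions in `U²`, by expanding each of them
into step functions. -/
theorem enorm_block_integral_le [NeZero m] {M : ℝ → (Fin (m + 1) → Fin d → ℤ) → ℂ}
    (hM : ∀ κ, Continuous fun τ => M τ κ) {q : (Fin (m + 1) → Fin d → ℤ) → ℝ}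
    (hq : ∀ τ κ, ‖M τ κ‖ ≤ q κ) {γ : ℝ} (hγ : 1 / 2 < γ) {a b : ℝ}
    {n₀ : ℕ} {n : Fin m → ℕ} {Λ : ℝ≥0∞} (hΛt : Λ ≠ ⊤)
    (hΛ : ∀ σ τ, a ≤ σ → σ ≤ τ → τ ≤ b → ∀ x : Fin m → L2 d,
      ‖block n₀ (dform ε (fun κ => ∫ u in Ico σ τ, M u κ) n fun j => x j)‖ₑ ≤
        Λ * ENNReal.ofReal (τ - σ) ^ γ * ∏ j, ‖x j‖ₑ)
    (f : Fin m → ℝ → L2 d) (hf : ∀ j, uNorm 2 a b (f j) ≠ ⊤) :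
    ‖block n₀ (fun k₀ => ∫ τ in Ico a b, dform ε (M τ) n (fun j => f j τ) k₀)‖ₑ ≤
      Λ * (m : ℝ≥0∞) ^ (1 / 2 : ℝ) * ENNReal.ofReal (b - a) ^ γ * ∏ j, uNorm 2 a b (f j) := by
  set P : ℝ≥0∞ := Λ * (m : ℝ≥0∞) ^ (1 / 2 : ℝ) * ENNReal.ofReal (b - a) ^ γ with hP
  have hPt : P ≠ ⊤ := by
    refine ENNReal.mul_ne_top (ENNReal.mul_ne_top hΛt ?_) ?_
    · exact ENNReal.rpow_ne_top_of_nonneg (by norm_num) (ENNReal.natCast_ne_top m)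
    · exact ENNReal.rpow_ne_top_of_nonneg (by linarith) ENNReal.ofReal_ne_top
  -- almost optimal decompositions of the inputs, with total cost `U j + 1 / (N + 1)`
  refine ge_of_tendsto (tendsto_prod_add_inv _ hf hPt) (Eventually.of_forall fun N => ?_)
  set B : Fin m → ℝ≥0∞ := fun j => uNorm 2 a b (f j) + ((N : ℝ≥0∞) + 1)⁻¹ with hB
  have hlt : ∀ j, uNorm 2 a b (f j) < B j := fun j =>
    ENNReal.lt_add_right (hf j) (by simp)
  choose K t ψ D ht ht0 ht1 hψ hDB hDn hsum using fun j => exists_step_decomp (hlt j)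
  have hBt : ∀ j, B j ≠ ⊤ := fun j => by
    simp only [hB]
    refine ENNReal.add_ne_top.2 ⟨hf j, ?_⟩
    simp
  set g : ∀ j : Fin m, ℕ → ℝ → Coeffs d := fun j i τ => (stepFun (t j i) (ψ j i) τ : L2 d) with hg
  have hgm : ∀ j i k, Measurable fun τ => g j i τ k := fun j i k => measurable_stepFun _ _ _
  have hgn : ∀ j i τ k, ‖g j i τ k‖ₑ ≤ D j i := fun j i τ k =>
    (enorm_apply_le _ _).trans (hDn j i τ)
  have hgb : ∀ j (S : Finset ℕ) τ k, ‖∑ i ∈ S, g j i τ k‖ ≤ (B j).toReal := fun j S τ k => by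
    have h1 : ‖∑ i ∈ S, g j i τ k‖ₑ ≤ B j :=
      (enorm_sum_le _ _).trans ((Finset.sum_le_sum fun i _ => hgn j i τ k).trans
        ((ENNReal.sum_le_tsum S).trans (hDB j).le))
    rw [← toReal_enorm]
    exact ENNReal.toReal_mono (hBt j) h1
  -- the partial sums of the decompositions
  set y : ℕ → Fin m → ℝ → Coeffs d := fun M' j τ => ∑ i ∈ Finset.range M', g j i τ with hy
  have hyk : ∀ M' j τ k, y M' j τ k = ∑ i ∈ Finset.range M', g j i τ k := fun M' j τ k => by
    simp only [hy, Finset.sum_apply]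
  have hlim : ∀ k₀, Tendsto (fun M' => ∫ τ in Ico a b, dform ε (M τ) n (fun j => y M' j τ) k₀)
      atTop (𝓝 (∫ τ in Ico a b, dform ε (M τ) n (fun j => f j τ) k₀)) := by
    intro k₀
    refine tendsto_integral_of_dominated_convergence (fun _ =>
      ∑ k ∈ Fintype.piFinset fun j => shell d (n j), q (Fin.cons k₀ k) * ∏ j, (B j).toReal)
      ?_ ?_ ?_ ?_
    · intro M'
      refine aestronglyMeasurable_dform hM (fun j k => ?_) n k₀
      simp_rw [hyk]
      exact (Finset.measurable_fun_sum _ fun i _ => hgm j i k).aestronglyMeasurable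
    · exact integrable_const _
    · intro M'
      refine Eventually.of_forall fun τ => norm_dform_le _ _ _ _ (hq τ) fun j k => ?_
      rw [hyk]
      exact hgb j _ τ k
    · rw [ae_restrict_iff' measurableSet_Ico]
      refine Eventually.of_forall fun τ hτ => ?_
      unfold dform
      refine tendsto_finsetSum _ fun k _ => ?_
      by_cases hG : (Fin.cons k₀ k : Fin (m + 1) → Fin d → ℤ) ∈ Gam d ε
      · simp only [Set.indicator_of_mem hG]
        refine tendsto_const_nhds.mul (tendsto_finsetProd _ fun j _ => ?_)
        refine ((continuous_signConj _).tendsto _).comp ?_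
        simp_rw [hyk]
        exact ((hsum j τ hτ).mapL
          (lp.evalCLM ℂ (fun _ : Fin d → ℤ => ℂ) 2 _)).tendsto_sum_nat
      · simp only [Set.indicator_of_notMem hG]
        exact tendsto_const_nhds
  refine enorm_block_le_of_tendsto hlim fun M' => ?_
  have hexp : block n₀ (fun k₀ => ∫ τ in Ico a b, dform ε (M τ) n (fun j => y M' j τ) k₀) =
      ∑ ι ∈ Fintype.piFinset fun _ : Fin m => Finset.range M',
        block n₀ (fun k₀ => ∫ τ in Ico a b, dform ε (M τ) n (fun j => g j (ι j) τ) k₀) := by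
    rw [← block_sum]
    congr 1
    funext k₀
    rw [Finset.sum_apply]
    simp only [hy]
    simp_rw [dform_sum (fun _ => Finset.range M')]
    rw [integral_finsetSum]
    intro ι _
    refine integrableOn_dform hM hq (fun j k => (hgm j _ k).aestronglyMeasurable)
      (B := fun j => (B j).toReal) (fun j τ _ k => ?_) n k₀
    simpa using hgb j {ι j} τ k
  rw [hexp]
  refine (enorm_sum_le _ _).trans ?_
  calc ∑ ι ∈ Fintype.piFinset fun _ : Fin m => Finset.range M',
        ‖block n₀ (fun k₀ => ∫ τ in Ico a b, dform ε (M τ) n (fun j => g j (ι j) τ) k₀)‖ₑ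
      ≤ ∑ ι ∈ Fintype.piFinset fun _ : Fin m => Finset.range M', P * ∏ j, D j (ι j) := by
        refine Finset.sum_le_sum fun ι _ => ?_
        refine (enorm_block_integral_step_le hM hγ hΛ (fun j => ht j (ι j))
          (fun j => ht0 j (ι j)) (fun j => ht1 j (ι j)) (fun j => ψ j (ι j))
          (fun j => D j (ι j)) fun j => hψ j (ι j)).trans (le_of_eq ?_)
        rw [hP]; ring
    _ = P * ∏ j, ∑ i ∈ Finset.range M', D j i := by
        rw [← Finset.mul_sum, Finset.prod_univ_sum]
    _ ≤ P * ∏ j, B j := by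
        gcongr with j
        exact (ENNReal.sum_le_tsum _).trans (hDB j).le

end time


/-! ### The Duhamel operator in the interaction picture -/

section duhamel
variable {d m : ℕ}

/-- The multiplier of the nonlinearity after conjugation with the linear flow. -/
def modMult (φ : (Fin d → ℝ) → ℝ) (W : ℝ → ℝ) (ε : Fin (m + 1) → ℤˣ)
    (Nhat : (Fin (m + 1) → Fin d → ℤ) → ℂ) (τ : ℝ) (κ : Fin (m + 1) → Fin d → ℤ) : ℂ :=
  Nhat κ * Complex.exp (-(Complex.I * ((W τ * resonance φ ε κ : ℝ) : ℂ)))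

/-- The time integral, starting at time `a`, of the conjugated nonlinearity with inputs localized
to the levels `n`. -/
def duh (φ : (Fin d → ℝ) → ℝ) (W : ℝ → ℝ) (ε : Fin (m + 1) → ℤˣ)
    (Nhat : (Fin (m + 1) → Fin d → ℤ) → ℂ) (a : ℝ) (n : Fin m → ℕ) (z : Fin m → ℝ → Coeffs d)
    (t : ℝ) : Coeffs d := fun k₀ =>
  ∫ τ in a..t, dform ε (modMult φ W ε Nhat τ) n (fun j => z j τ) k₀

/-- The sum of `duh` over all levels. -/
def duhamel (φ : (Fin d → ℝ) → ℝ) (W : ℝ → ℝ) (ε : Fin (m + 1) → ℤˣ)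
    (Nhat : (Fin (m + 1) → Fin d → ℤ) → ℂ) (a : ℝ) (z : Fin m → ℝ → Coeffs d)
    (t : ℝ) : Coeffs d := fun k₀ => ∑' n : Fin m → ℕ, duh φ W ε Nhat a n z t k₀

/-- The `U²`-based norm on `[a, b)`, in the interaction picture, with dyadic weight `w`. -/
def xw (w : ℕ → ℝ≥0∞) (a b : ℝ) (v : ℝ → Coeffs d) : ℝ≥0∞ :=
  l2 fun n => w n * uNorm 2 a b (fun t => block n (v t))

variable {φ : (Fin d → ℝ) → ℝ} {W : ℝ → ℝ} {ε : Fin (m + 1) → ℤˣ}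
  {Nhat : (Fin (m + 1) → Fin d → ℤ) → ℂ}

theorem continuous_modMult (hW : Continuous W) (κ : Fin (m + 1) → Fin d → ℤ) :
    Continuous fun τ => modMult φ W ε Nhat τ κ := by
  unfold modMult
  fun_prop

theorem norm_exp_neg_I_mul (x : ℝ) : ‖Complex.exp (-(Complex.I * (x : ℂ)))‖ = 1 := by
  have : -(Complex.I * (x : ℂ)) = ((-x : ℝ) : ℂ) * Complex.I := by push_cast; ring
  rw [this, Complex.norm_exp_ofReal_mul_I]

theorem norm_modMult (τ : ℝ) (κ : Fin (m + 1) → Fin d → ℤ) :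
    ‖modMult φ W ε Nhat τ κ‖ = ‖Nhat κ‖ := by
  unfold modMult
  rw [norm_mul, norm_exp_neg_I_mul, mul_one]

/-- The gain from the oscillation of the path. -/
theorem IsIrregular.exists_norm_integral_le {ρ γ : ℝ} (hW : IsIrregular ρ γ W) :
    ∃ C : ℝ, 0 ≤ C ∧ ∀ σ τ, 0 ≤ σ → σ ≤ τ → τ ≤ 1 → ∀ Ω : ℝ,
      ‖∫ u in Ico σ τ, Complex.exp (-(Complex.I * ((W u * Ω : ℝ) : ℂ)))‖ ≤
        C * (τ - σ) ^ γ * bracket Ω ^ (-ρ) := by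
  obtain ⟨C, hC⟩ := hW.holder 1 one_pos
  refine ⟨|C|, abs_nonneg C, fun σ τ hσ hστ hτ Ω => ?_⟩
  have h := hC σ τ (by linarith) hστ hτ (-Ω)
  have e1 : charFun (occupationMeasure W (Icc σ τ)) (-Ω) =
      ∫ u in Ico σ τ, Complex.exp (-(Complex.I * ((W u * Ω : ℝ) : ℂ))) := by
    unfold occupationMeasure
    rw [charFun_apply_real, integral_map hW.continuous.measurable.aemeasurable
      (by fun_prop), integral_Icc_eq_integral_Ico]
    refine integral_congr_ae (Eventually.of_forall fun u => ?_)
    simp only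
    congr 1
    push_cast; ring
  have e2 : bracket (-Ω) = bracket Ω := by simp [bracket]
  rw [e1, e2] at h
  have hb : 0 < bracket Ω ^ ρ := Real.rpow_pos_of_pos (bracket_pos _) _
  rw [Real.rpow_neg (bracket_pos _).le, ← div_eq_mul_inv, le_div_iff₀ hb, mul_comm]
  refine h.trans ?_
  have : 0 ≤ (τ - σ) ^ γ := Real.rpow_nonneg (by linarith) _
  gcongr
  exact le_abs_self C

theorem ker_ne_top (η : ℝ) (c : ℕ) (ν : Fin (m + 1) → ℕ) : ker η c ν ≠ ⊤ := by
  unfold ker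
  split_ifs
  · refine (ENNReal.sum_lt_top.2 fun p _ => ENNReal.sum_lt_top.2 fun q _ => ?_).ne
    split_ifs
    · exact ENNReal.prod_lt_top fun j _ => (dyW_ne_top _ _).lt_top
    · exact ENNReal.zero_lt_top
  · exact ENNReal.zero_ne_top

/-- The estimate of the dyadic pieces of the Duhamel operator, from which everything else
follows. -/
def DuhBound (φ : (Fin d → ℝ) → ℝ) (W : ℝ → ℝ) (ε : Fin (m + 1) → ℤˣ)
    (Nhat : (Fin (m + 1) → Fin d → ℤ) → ℂ) (s γ η : ℝ) (c : ℕ) (C : ℝ≥0∞) : Prop :=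
  ∀ a b : ℝ, 0 ≤ a → a ≤ b → b ≤ 1 → ∀ (ν : Fin (m + 1) → ℕ) (z : Fin m → ℝ → Coeffs d),
    (∀ j, uNorm 2 a b (fun t => block (ν j.succ) (z j t)) ≠ ⊤) →
    dyW s (ν 0) * uNorm 2 a b (fun t => block (ν 0) (duh φ W ε Nhat a (fun j => ν j.succ) z t)) ≤
      C * ENNReal.ofReal (b - a) ^ γ * ker η c ν *
        ∏ j, (dyW s (ν j.succ) * uNorm 2 a b (fun t => block (ν j.succ) (z j t)))

theorem dform_block (Q : (Fin (m + 1) → Fin d → ℤ) → ℂ) (n : Fin m → ℕ) (x : Fin m → Coeffs d)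
    (k₀ : Fin d → ℤ) :
    dform ε Q n x k₀ = dform ε Q n (fun j => (block (n j) (x j) : Coeffs d)) k₀ :=
  dform_congr Q n (fun j k hk => by rw [block_apply, if_pos hk]) k₀

theorem integrableOn_integrand (hW : Continuous W) {a b : ℝ} {n : Fin m → ℕ}
    {z : Fin m → ℝ → Coeffs d} (hz : ∀ j, uNorm 2 a b (fun t => block (n j) (z j t)) ≠ ⊤)
    (k₀ : Fin d → ℤ) :
    IntegrableOn (fun τ => dform ε (modMult φ W ε Nhat τ) n (fun j => z j τ) k₀) (Ico a b) := by
  have e : (fun τ => dform ε (modMult φ W ε Nhat τ) n (fun j => z j τ) k₀) = fun τ =>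
      dform ε (modMult φ W ε Nhat τ) n (fun j => (block (n j) (z j τ) : Coeffs d)) k₀ :=
    funext fun τ => dform_block _ _ _ _
  rw [e]
  refine integrableOn_dform (continuous_modMult hW) (q := fun κ => ‖Nhat κ‖)
    (fun τ κ => (norm_modMult τ κ).le) (fun j k => aestronglyMeasurable_coeff (hz j) k)
    (B := fun j => (uNorm 2 a b (fun t => block (n j) (z j t))).toReal) (fun j τ hτ k => ?_) n k₀
  rw [← toReal_enorm]
  exact ENNReal.toReal_mono (hz j) ((enorm_apply_le _ _).trans
    (enorm_le_uNorm (fun t => block (n j) (z j t)) hτ))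

theorem intervalIntegrable_integrand (hW : Continuous W) {a b : ℝ} {n : Fin m → ℕ}
    {z : Fin m → ℝ → Coeffs d} (hz : ∀ j, uNorm 2 a b (fun t => block (n j) (z j t)) ≠ ⊤)
    (k₀ : Fin d → ℤ) {t t' : ℝ} (ht : t ∈ Icc a b) (ht' : t' ∈ Icc a b) :
    IntervalIntegrable (fun τ => dform ε (modMult φ W ε Nhat τ) n (fun j => z j τ) k₀)
      volume t t' := by
  have h := (integrableOn_Icc_iff_integrableOn_Ico (μ := volume)).2
    (integrableOn_integrand (φ := φ) (ε := ε) (Nhat := Nhat) hW hz k₀)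
  refine IntegrableOn.intervalIntegrable (h.mono_set ?_)
  exact Set.uIcc_subset_Icc ht ht'

theorem exists_duhBound {ρ γ s α₁ α₂ : ℝ} {β : Fin (m + 1) → ℝ} (hρ : 0 < ρ) (hγ : 1 / 2 < γ)
    (hm : 2 ≤ m) (hW : IsIrregular ρ γ W) (hβ : SymbolBound ε Nhat β)
    (hα : StronglyNonResonant φ ε Nhat α₁ α₂) (hs : EnoughIrregularity d α₁ α₂ β s ρ) :
    ∃ (η : ℝ) (c : ℕ) (C : ℝ≥0∞), 0 < η ∧ C ≠ ⊤ ∧ DuhBound φ W ε Nhat s γ η c C := by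
  have : NeZero m := ⟨by omega⟩
  obtain ⟨η, c, C₁, hη, hC₁, hmult⟩ := exists_block_multiplier_bound hρ hm hβ hα hs
  obtain ⟨C₂, hC₂, hosc⟩ := hW.exists_norm_integral_le
  refine ⟨η, c, C₁ * ENNReal.ofReal C₂ * (m : ℝ≥0∞) ^ (1 / 2 : ℝ) * holderConst γ, hη, ?_, ?_⟩
  · refine ENNReal.mul_ne_top (ENNReal.mul_ne_top (ENNReal.mul_ne_top hC₁ ENNReal.ofReal_ne_top)
      ?_) (holderConst_ne_top hγ)
    exact ENNReal.rpow_ne_top_of_nonneg (by norm_num) (ENNReal.natCast_ne_top m)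
  intro a b ha hab hb ν z hz
  set n : Fin m → ℕ := fun j => ν j.succ with hn
  set w := dyW s (ν 0) with hw
  have hw0 : w ≠ 0 := dyW_ne_zero _ _
  have hwt : w ≠ ⊤ := dyW_ne_top _ _
  set Λ : ℝ≥0∞ := w⁻¹ * (C₁ * ENNReal.ofReal C₂ * ker η c ν * ∏ j, dyW s (n j)) with hΛ
  have hΛt : Λ ≠ ⊤ := by
    refine ENNReal.mul_ne_top (ENNReal.inv_ne_top.2 hw0) (ENNReal.mul_ne_top (ENNReal.mul_ne_top
      (ENNReal.mul_ne_top hC₁ ENNReal.ofReal_ne_top) (ker_ne_top _ _ _)) ?_)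
    exact ENNReal.prod_ne_top fun j _ => dyW_ne_top _ _
  -- for inputs which do not depend on time, the multiplier is integrated by the irregularity of `W`
  have hbound : ∀ σ τ, 0 ≤ σ → σ ≤ τ → τ ≤ 1 → ∀ x : Fin m → L2 d,
      ‖block (ν 0) (dform ε (fun κ => ∫ u in Ico σ τ, modMult φ W ε Nhat u κ) n fun j => x j)‖ₑ ≤
        Λ * ENNReal.ofReal (τ - σ) ^ γ * ∏ j, ‖x j‖ₑ := by
    intro σ τ hσ hστ hτ x
    have h1 := hmult (fun κ => ∫ u in Ico σ τ, modMult φ W ε Nhat u κ)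
      (ENNReal.ofReal C₂ * ENNReal.ofReal (τ - σ) ^ γ) ν (fun j => x j) fun κ _ => by
        have h2 : ∫ u in Ico σ τ, modMult φ W ε Nhat u κ = Nhat κ *
            ∫ u in Ico σ τ, Complex.exp (-(Complex.I * ((W u * resonance φ ε κ : ℝ) : ℂ))) := by
          unfold modMult
          rw [integral_const_mul]
        rw [h2, ENNReal.ofReal_rpow_of_nonneg (by linarith) (by linarith),
          ← ENNReal.ofReal_mul hC₂, ← ENNReal.ofReal_mul
            (mul_nonneg hC₂ (Real.rpow_nonneg (by linarith) _)), ← ofReal_norm, norm_mul]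
        refine ENNReal.ofReal_le_ofReal ?_
        calc _ ≤ ‖Nhat κ‖ * (C₂ * (τ - σ) ^ γ * bracket (resonance φ ε κ) ^ (-ρ)) := by
              gcongr
              exact hosc σ τ hσ hστ hτ _
          _ = _ := by ring
    have h3 : w * ‖block (ν 0) (dform ε (fun κ => ∫ u in Ico σ τ, modMult φ W ε Nhat u κ) n
        fun j => x j)‖ₑ ≤ w * (Λ * ENNReal.ofReal (τ - σ) ^ γ * ∏ j, ‖x j‖ₑ) := by
      refine h1.trans ?_
      have h4 : ∏ j, (dyW s (ν j.succ) * ‖block (ν j.succ) (x j)‖ₑ) ≤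
          (∏ j, dyW s (n j)) * ∏ j, ‖x j‖ₑ := by
        rw [← Finset.prod_mul_distrib]
        gcongr with j
        exact enorm_block_le _ _
      calc _ ≤ C₁ * (ENNReal.ofReal C₂ * ENNReal.ofReal (τ - σ) ^ γ) * ker η c ν *
            ((∏ j, dyW s (n j)) * ∏ j, ‖x j‖ₑ) := by gcongr
        _ = (w * w⁻¹) * (C₁ * (ENNReal.ofReal C₂ * ENNReal.ofReal (τ - σ) ^ γ) * ker η c ν *
            ((∏ j, dyW s (n j)) * ∏ j, ‖x j‖ₑ)) := by
            rw [ENNReal.mul_inv_cancel hw0 hwt, one_mul]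
        _ = _ := by rw [hΛ]; ring
    exact (ENNReal.mul_le_mul_iff_right hw0 hwt).1 h3
  set U : Fin m → ℝ≥0∞ := fun j => uNorm 2 a b (fun t => block (n j) (z j t)) with hU
  set P : ℝ≥0∞ := Λ * (m : ℝ≥0∞) ^ (1 / 2 : ℝ) * ∏ j, U j with hP
  have hPt : P ≠ ⊤ := by
    refine ENNReal.mul_ne_top (ENNReal.mul_ne_top hΛt ?_) (ENNReal.prod_ne_top fun j _ => hz j)
    exact ENNReal.rpow_ne_top_of_nonneg (by norm_num) (ENNReal.natCast_ne_top m)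
  -- the increments of the Duhamel integral are integrals over `[t', t)`, so that it is `γ`-Hölder
  have hholder := uNorm_le_of_holder (F := fun t => block (ν 0) (duh φ W ε Nhat a n z t))
    (a := a) (b := b) (C := P.toReal) hγ hab ENNReal.toReal_nonneg ?_ ?_
  · rw [ENNReal.ofReal_mul ENNReal.toReal_nonneg, ENNReal.ofReal_toReal hPt,
      ← ENNReal.ofReal_rpow_of_nonneg (by linarith) (by linarith)] at hholder
    calc _ ≤ w * (P * ENNReal.ofReal (b - a) ^ γ * holderConst γ) := by gcongr
      _ = (w * w⁻¹) * (C₁ * ENNReal.ofReal C₂ * (m : ℝ≥0∞) ^ (1 / 2 : ℝ) * holderConst γ *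
          ENNReal.ofReal (b - a) ^ γ * ker η c ν * ((∏ j, dyW s (n j)) * ∏ j, U j)) := by
          rw [hP, hΛ]; ring
      _ = _ := by
          rw [ENNReal.mul_inv_cancel hw0 hwt, one_mul, ← Finset.prod_mul_distrib]
  · refine lp.ext (funext fun k => ?_)
    rw [block_apply]
    simp [duh]
  · intro t' t h1 h2 h3
    have hint : ∀ k₀, IntervalIntegrable
        (fun τ => dform ε (modMult φ W ε Nhat τ) n (fun j => z j τ) k₀) volume a t' := fun k₀ =>
      intervalIntegrable_integrand hW.continuous hz k₀ ⟨le_rfl, hab⟩ ⟨h1, by linarith⟩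
    have hint' : ∀ k₀, IntervalIntegrable
        (fun τ => dform ε (modMult φ W ε Nhat τ) n (fun j => z j τ) k₀) volume a t := fun k₀ =>
      intervalIntegrable_integrand hW.continuous hz k₀ ⟨le_rfl, hab⟩ ⟨by linarith, by linarith⟩
    have e1 : block (ν 0) (duh φ W ε Nhat a n z t) - block (ν 0) (duh φ W ε Nhat a n z t') =
        block (ν 0) (fun k₀ => ∫ τ in Ico t' t, dform ε (modMult φ W ε Nhat τ) n
          (fun j => (block (n j) (z j τ) : Coeffs d)) k₀) := by
      rw [← block_sub]
      congr 1
      funext k₀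
      simp only [duh, Pi.sub_apply]
      rw [intervalIntegral.integral_interval_sub_left (hint' k₀) (hint k₀),
        intervalIntegral.integral_of_le h2, integral_Ioc_eq_integral_Ioo,
        ← integral_Ico_eq_integral_Ioo]
      refine integral_congr_ae (Eventually.of_forall fun τ => dform_block _ _ _ _)
    rw [e1]
    have h4 := enorm_block_integral_le (ε := ε) (continuous_modMult (φ := φ) (ε := ε)
      (Nhat := Nhat) hW.continuous) (q := fun κ => ‖Nhat κ‖) (fun τ κ => (norm_modMult τ κ).le)
      hγ (a := t') (b := t) (n₀ := ν 0) (n := n) hΛt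
      (fun σ τ h5 h6 h7 x => hbound σ τ (by linarith) h6 (by linarith) x)
      (fun j τ => block (n j) (z j τ)) (fun j => ((uNorm_restrict _ h1 h2 h3.le).trans_lt
        (hz j).lt_top).ne)
    have h5 : ‖block (ν 0) (fun k₀ => ∫ τ in Ico t' t, dform ε (modMult φ W ε Nhat τ) n
          (fun j => (block (n j) (z j τ) : Coeffs d)) k₀)‖ₑ ≤ P * ENNReal.ofReal (t - t') ^ γ := by
      refine h4.trans ?_
      calc _ ≤ Λ * (m : ℝ≥0∞) ^ (1 / 2 : ℝ) * ENNReal.ofReal (t - t') ^ γ * ∏ j, U j := by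
            gcongr with j
            exact uNorm_restrict _ h1 h2 h3.le
        _ = _ := by rw [hP]; ring
    rw [ENNReal.ofReal_rpow_of_nonneg (by linarith) (by linarith)] at h5
    have h6 := ENNReal.toReal_mono (ENNReal.mul_ne_top hPt ENNReal.ofReal_ne_top) h5
    rwa [ENNReal.toReal_mul, ENNReal.toReal_ofReal (Real.rpow_nonneg (by linarith) _),
      toReal_enorm] at h6

end duhamel


section xwlemmas
variable {d m : ℕ}

theorem block_eq_sum (n : ℕ) (a : Coeffs d) :
    block n a = ∑ k ∈ shell d n, a k • (lp.single 2 k (1 : ℂ) : L2 d) := by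
  refine lp.ext (funext fun l => ?_)
  have h : (⇑(∑ k ∈ shell d n, a k • (lp.single 2 k (1 : ℂ) : L2 d)) : Coeffs d) =
      ∑ k ∈ shell d n, (fun l => (a k • (lp.single 2 k (1 : ℂ) : L2 d)) l : Coeffs d) :=
    lp.coeFn_sum _ _
  refine Eq.trans ?_ (congrFun h l).symm
  rw [block_apply, Finset.sum_apply]
  have h2 : ∀ k, (a k • (lp.single 2 k (1 : ℂ) : L2 d)) l = if k = l then a k else 0 := by
    intro k
    rw [lp.coeFn_smul, Pi.smul_apply, lp.coeFn_single]
    by_cases hkl : k = l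
    · subst hkl; simp
    · simp [hkl, Ne.symm hkl]
  simp_rw [h2, Finset.sum_ite_eq', mem_shell]

theorem hasSum_block {ι : Type*} (n : ℕ) {F : ι → Coeffs d} {v : Coeffs d}
    (h : ∀ k, HasSum (fun i => F i k) (v k)) : HasSum (fun i => block n (F i)) (block n v) := by
  simp_rw [block_eq_sum]
  exact hasSum_sum fun k _ => (h k).smul_const _

variable {w : ℕ → ℝ≥0∞} {a b : ℝ}

theorem xw_congr {u v : ℝ → Coeffs d} (h : ∀ t ∈ Ico a b, u t = v t) : xw w a b u = xw w a b v := by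
  unfold xw
  congr 1
  funext n
  rw [uNorm_congr fun t ht => by rw [h t ht]]

theorem xw_mono {w' : ℕ → ℝ≥0∞} (h : ∀ n, w n ≤ w' n) (v : ℝ → Coeffs d) :
    xw w a b v ≤ xw w' a b v := l2_mono fun n => by gcongr; exact h n

theorem xw_const_mul (c : ℝ≥0∞) (v : ℝ → Coeffs d) :
    xw (fun n => c * w n) a b v = c * xw w a b v := by
  unfold xw
  rw [← l2_const_mul]
  simp_rw [mul_assoc]

theorem xw_restrict {a' b' : ℝ} (v : ℝ → Coeffs d) (ha : a ≤ a') (hab : a' ≤ b') (hb : b' ≤ b) :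
    xw w a' b' v ≤ xw w a b v := l2_mono fun n => by gcongr; exact uNorm_restrict _ ha hab hb

theorem xw_tsum_le {ι : Type*} [Countable ι] (hab : a ≤ b) {F : ι → ℝ → Coeffs d}
    {v : ℝ → Coeffs d} (h : ∀ t ∈ Ico a b, ∀ k, HasSum (fun i => F i t k) (v t k)) :
    xw w a b v ≤ ∑' i, xw w a b (F i) := by
  refine le_trans (l2_mono fun n => ?_) (l2_tsum_le fun i n =>
    w n * uNorm 2 a b (fun t => block n (F i t)))
  rw [ENNReal.tsum_mul_left]
  gcongr
  exact uNorm_tsum_le hab fun t ht => hasSum_block n (h t ht)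

theorem xw_sum_le (hab : a ≤ b) {ι : Type*} (S : Finset ι) (F : ι → ℝ → Coeffs d) :
    xw w a b (fun t => ∑ i ∈ S, F i t) ≤ ∑ i ∈ S, xw w a b (F i) := by
  have h := xw_tsum_le (w := w) (ι := S) hab (F := fun i => F i) (v := fun t => ∑ i ∈ S, F i t)
    fun t _ k => by
      rw [Finset.sum_apply, ← Finset.sum_coe_sort]
      exact hasSum_fintype _
  rw [tsum_fintype] at h
  rwa [Finset.sum_coe_sort S (fun i => xw w a b (F i))] at h

theorem xw_add_le (hab : a ≤ b) (u v : ℝ → Coeffs d) :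
    xw w a b (fun t => u t + v t) ≤ xw w a b u + xw w a b v := by
  have h := xw_sum_le (w := w) hab (Finset.univ : Finset (Fin 2)) fun i => if i = 0 then u else v
  simpa [Fin.sum_univ_two] using h

theorem xw_neg (v : ℝ → Coeffs d) : xw w a b (fun t => -v t) = xw w a b v := by
  unfold xw
  congr 1
  funext n
  rw [← uNorm_neg]
  congr 3
  funext t
  refine lp.ext (funext fun k => ?_)
  rw [lp.coeFn_neg, Pi.neg_apply, block_apply, block_apply]
  split_ifs <;> simp

theorem xw_sub_le (hab : a ≤ b) (u v : ℝ → Coeffs d) :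
    xw w a b (fun t => u t - v t) ≤ xw w a b u + xw w a b v := by
  simpa [sub_eq_add_neg, xw_neg] using xw_add_le (w := w) hab u fun t => -v t

theorem xw_sub_comm (u v : ℝ → Coeffs d) :
    xw w a b (fun t => u t - v t) = xw w a b (fun t => v t - u t) := by
  rw [← xw_neg (fun t => u t - v t)]
  congr 1
  funext t
  exact neg_sub (u t) (v t)

theorem xw_const_le (hab : a ≤ b) (c : Coeffs d) : xw w a b (fun _ => c) ≤ hw w c :=
  l2_mono fun n => by gcongr; exact uNorm_const_le hab _

theorem hw_le_xw {t : ℝ} (ht : t ∈ Ico a b) (v : ℝ → Coeffs d) : hw w (v t) ≤ xw w a b v :=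
  l2_mono fun n => by gcongr; exact enorm_le_uNorm (fun t => block n (v t)) ht

theorem xw_glue {c : ℝ} (hab : a ≤ b) (hbc : b ≤ c) (v : ℝ → Coeffs d) :
    xw w a c v ≤ xw w a b v + xw w b c v := by
  refine le_trans (l2_mono fun n => ?_) (l2_add_le _ _)
  rw [← mul_add]
  gcongr
  exact uNorm_glue _ hab hbc

theorem uNorm_ne_top_of_xw {s : ℝ} {v : ℝ → Coeffs d} (h : xw (dyW s) a b v ≠ ⊤) (n : ℕ) :
    uNorm 2 a b (fun t => block n (v t)) ≠ ⊤ := by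
  intro hn
  have h1 : dyW s n * _ ≤ xw (dyW s) a b v :=
    le_l2 (fun n => dyW s n * uNorm 2 a b (fun t => block n (v t))) n
  rw [hn, ENNReal.mul_top (dyW_ne_zero _ _)] at h1
  exact h (top_le_iff.1 h1)

theorem eq_zero_of_xw {s : ℝ} {v : ℝ → Coeffs d} (h : xw (dyW s) a b v = 0) {t : ℝ}
    (ht : t ∈ Ico a b) : v t = 0 := by
  funext k
  have h1 : hw (dyW s) (v t) = 0 := le_antisymm ((hw_le_xw ht v).trans h.le) zero_le
  have h2 := le_l2 (fun n => dyW s n * ‖block n (v t)‖ₑ) (lvl k)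
  have h3 : dyW s (lvl k) * ‖block (lvl k) (v t)‖ₑ = 0 :=
    le_antisymm (h2.trans h1.le) zero_le
  rw [mul_eq_zero] at h3
  have h4 := h3.resolve_left (dyW_ne_zero _ _)
  have h5 := enorm_apply_le_block (v t) k
  rw [h4] at h5
  simpa using h5

end xwlemmas

/-! ### Estimates of the Duhamel operator -/

section estimates
variable {d m : ℕ} {φ : (Fin d → ℝ) → ℝ} {W : ℝ → ℝ} {ε : Fin (m + 1) → ℤˣ}
  {Nhat : (Fin (m + 1) → Fin d → ℤ) → ℂ} {s γ η : ℝ} {c : ℕ} {C : ℝ≥0∞}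

/-- A weight which does not grow too fast between comparable dyadic levels. -/
def SlowWeight (c : ℕ) (g : ℕ → ℝ≥0∞) (D : ℝ≥0∞) : Prop := ∀ n n', n ≤ n' + c → g n ≤ D * g n'

theorem slowWeight_one (c : ℕ) : SlowWeight c (fun _ => 1) 1 := fun _ _ _ => by simp

/-- The constant in the estimate of the Duhamel operator. -/
def duhConst (m : ℕ) (η : ℝ) (c : ℕ) (C D : ℝ≥0∞) : ℝ≥0∞ := C * (D * kerConst m η c)

theorem l2_duh_le (h : DuhBound φ W ε Nhat s γ η c C) {a b : ℝ} (ha : 0 ≤ a) (hab : a ≤ b)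
    (hb : b ≤ 1) {g : ℕ → ℝ≥0∞} {D : ℝ≥0∞} (hg : SlowWeight c g D) {z : Fin m → ℝ → Coeffs d}
    (hz : ∀ j, xw (dyW s) a b (z j) ≠ ⊤) :
    l2 (fun n₀ => g n₀ * dyW s n₀ *
      ∑' n : Fin m → ℕ, uNorm 2 a b (fun t => block n₀ (duh φ W ε Nhat a n z t))) ≤
      duhConst m η c C D * ENNReal.ofReal (b - a) ^ γ *
        ∑ i, ∏ j, xw (fun n => (if j = i then g n else 1) * dyW s n) a b (z j) := by
  set f : Fin m → ℕ → ℝ≥0∞ := fun j n => dyW s n * uNorm 2 a b (fun t => block n (z j t)) with hf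
  have h1 : ∀ n₀, g n₀ * dyW s n₀ *
      ∑' n : Fin m → ℕ, uNorm 2 a b (fun t => block n₀ (duh φ W ε Nhat a n z t)) ≤
      C * ENNReal.ofReal (b - a) ^ γ *
        (g n₀ * ∑' n : Fin m → ℕ, ker η c (Fin.cons n₀ n : Fin (m + 1) → ℕ) * ∏ j, f j (n j)) := by
    intro n₀
    simp_rw [← ENNReal.tsum_mul_left]
    refine ENNReal.tsum_le_tsum fun n => ?_
    have h2 := h a b ha hab hb (Fin.cons n₀ n) z fun j => uNorm_ne_top_of_xw (hz j) _
    simp only [Fin.cons_zero, Fin.cons_succ] at h2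
    calc _ = g n₀ * (dyW s n₀ * uNorm 2 a b (fun t => block n₀ (duh φ W ε Nhat a n z t))) := by
          ring
      _ ≤ g n₀ * (C * ENNReal.ofReal (b - a) ^ γ * ker η c (Fin.cons n₀ n : Fin (m + 1) → ℕ) *
          ∏ j, f j (n j)) := by gcongr
      _ = _ := by ring
  refine (l2_mono h1).trans ?_
  rw [l2_const_mul]
  calc _ ≤ C * ENNReal.ofReal (b - a) ^ γ * (D * kerConst m η c *
        ∑ i, ∏ j, l2 (fun n => (if j = i then g n else 1) * f j n)) := by
        gcongr
        exact l2_ker_tame_le η c hg f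
    _ = _ := by
        unfold duhConst xw
        simp only [hf, mul_assoc]
        ring

theorem prod_xw_one (a b : ℝ) (z : Fin m → ℝ → Coeffs d) :
    ∑ i, ∏ j, xw (fun n => (if j = i then 1 else 1) * dyW s n) a b (z j) =
      m * ∏ j, xw (dyW s) a b (z j) := by
  simp

theorem duhConst_ne_top (hη : 0 < η) (hC : C ≠ ⊤) {D : ℝ≥0∞} (hD : D ≠ ⊤) :
    duhConst m η c C D ≠ ⊤ :=
  ENNReal.mul_ne_top hC (ENNReal.mul_ne_top hD (kerConst_ne_top hη c))

theorem tsum_duh_ne_top (h : DuhBound φ W ε Nhat s γ η c C) (hη : 0 < η) (hC : C ≠ ⊤)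
    (hγ : 0 ≤ γ) {a b : ℝ} (ha : 0 ≤ a) (hab : a ≤ b) (hb : b ≤ 1) {z : Fin m → ℝ → Coeffs d}
    (hz : ∀ j, xw (dyW s) a b (z j) ≠ ⊤) (n₀ : ℕ) :
    ∑' n : Fin m → ℕ, uNorm 2 a b (fun t => block n₀ (duh φ W ε Nhat a n z t)) ≠ ⊤ := by
  intro htop
  have h1 := l2_duh_le h ha hab hb (slowWeight_one c) hz
  rw [prod_xw_one] at h1
  have h2 := (le_l2 _ n₀).trans h1
  rw [htop, one_mul, ENNReal.mul_top (dyW_ne_zero _ _), top_le_iff] at h2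
  refine ENNReal.mul_ne_top (ENNReal.mul_ne_top (duhConst_ne_top hη hC ENNReal.one_ne_top) ?_)
    (ENNReal.mul_ne_top (ENNReal.natCast_ne_top m) (ENNReal.prod_ne_top fun j _ => hz j)) h2
  exact ENNReal.rpow_ne_top_of_nonneg hγ ENNReal.ofReal_ne_top

/-- Absolute convergence of the sum over the levels. -/
theorem summable_duh (h : DuhBound φ W ε Nhat s γ η c C) (hη : 0 < η) (hC : C ≠ ⊤)
    (hγ : 0 ≤ γ) {a b : ℝ} (ha : 0 ≤ a) (hb : b ≤ 1) {z : Fin m → ℝ → Coeffs d}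
    (hz : ∀ j, xw (dyW s) a b (z j) ≠ ⊤) {t : ℝ} (ht : t ∈ Ico a b) (k₀ : Fin d → ℤ) :
    Summable fun n : Fin m → ℕ => duh φ W ε Nhat a n z t k₀ := by
  have h1 := tsum_duh_ne_top h hη hC hγ ha (ht.1.trans ht.2.le) hb hz (lvl k₀)
  have h2 : ∑' n : Fin m → ℕ, ‖duh φ W ε Nhat a n z t k₀‖ₑ ≠ ⊤ := by
    refine ((ENNReal.tsum_le_tsum fun n => ?_).trans_lt h1.lt_top).ne
    exact (enorm_apply_le_block _ _).trans
      (enorm_le_uNorm (fun t => block (lvl k₀) (duh φ W ε Nhat a n z t)) ht)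
  have h3 := ENNReal.summable_toReal h2
  simp only [toReal_enorm] at h3
  exact h3.of_norm

/-- The tame estimate of the Duhamel operator. -/
theorem xw_duhamel_le (h : DuhBound φ W ε Nhat s γ η c C) (hη : 0 < η) (hC : C ≠ ⊤)
    (hγ : 0 ≤ γ) {a b : ℝ} (ha : 0 ≤ a) (hab : a ≤ b) (hb : b ≤ 1) {g : ℕ → ℝ≥0∞} {D : ℝ≥0∞}
    (hg : SlowWeight c g D) {z : Fin m → ℝ → Coeffs d} (hz : ∀ j, xw (dyW s) a b (z j) ≠ ⊤) :
    xw (fun n => g n * dyW s n) a b (duhamel φ W ε Nhat a z) ≤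
      duhConst m η c C D * ENNReal.ofReal (b - a) ^ γ *
        ∑ i, ∏ j, xw (fun n => (if j = i then g n else 1) * dyW s n) a b (z j) := by
  refine (l2_mono fun n₀ => ?_).trans (l2_duh_le h ha hab hb hg hz)
  gcongr
  exact uNorm_tsum_le hab fun t ht => hasSum_block n₀ fun k =>
    (summable_duh h hη hC hγ ha hb hz ht k).hasSum

theorem xw_duhamel_le_prod (h : DuhBound φ W ε Nhat s γ η c C) (hη : 0 < η) (hC : C ≠ ⊤)
    (hγ : 0 ≤ γ) {a b : ℝ} (ha : 0 ≤ a) (hab : a ≤ b) (hb : b ≤ 1)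
    {z : Fin m → ℝ → Coeffs d} (hz : ∀ j, xw (dyW s) a b (z j) ≠ ⊤) :
    xw (dyW s) a b (duhamel φ W ε Nhat a z) ≤
      duhConst m η c C 1 * ENNReal.ofReal (b - a) ^ γ * (m * ∏ j, xw (dyW s) a b (z j)) := by
  have h1 := xw_duhamel_le h hη hC hγ ha hab hb (slowWeight_one c) hz
  rw [prod_xw_one] at h1
  simpa only [one_mul] using h1

theorem dform_sub_slot (Q : (Fin (m + 1) → Fin d → ℤ) → ℂ) (n : Fin m → ℕ)
    {x y e : Fin m → Coeffs d} (i : Fin m) (hi : e i = x i - y i)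
    (hx : ∀ j, j ≠ i → x j = e j) (hy : ∀ j, j ≠ i → y j = e j) (k₀ : Fin d → ℤ) :
    dform ε Q n x k₀ - dform ε Q n y k₀ = dform ε Q n e k₀ := by
  unfold dform
  rw [← Finset.sum_sub_distrib]
  refine Finset.sum_congr rfl fun k _ => ?_
  by_cases hG : (Fin.cons k₀ k : Fin (m + 1) → Fin d → ℤ) ∈ Gam d ε
  · simp only [Set.indicator_of_mem hG, Fin.cons_succ]
    rw [← mul_sub]
    congr 1
    rw [← Finset.mul_prod_erase _ _ (Finset.mem_univ i),
      ← Finset.mul_prod_erase (f := fun j => signConj (ε j.succ) (y j (k j))) _ (Finset.mem_univ i),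
      ← Finset.mul_prod_erase (f := fun j => signConj (ε j.succ) (e j (k j))) _ (Finset.mem_univ i),
      hi, Pi.sub_apply, signConj_sub, sub_mul]
    congr 1
    · congr 1
      exact Finset.prod_congr rfl fun j hj => by rw [hx j (Finset.ne_of_mem_erase hj)]
    · congr 1
      exact Finset.prod_congr rfl fun j hj => by rw [hy j (Finset.ne_of_mem_erase hj)]
  · simp only [Set.indicator_of_notMem hG, sub_zero]

theorem duhamel_sub_slot (hW : Continuous W) (h : DuhBound φ W ε Nhat s γ η c C) (hη : 0 < η)
    (hC : C ≠ ⊤) (hγ : 0 ≤ γ) {a b : ℝ} (ha : 0 ≤ a) (hb : b ≤ 1)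
    {x y e : Fin m → ℝ → Coeffs d} (i : Fin m) (hi : ∀ t, e i t = x i t - y i t)
    (hx : ∀ j, j ≠ i → x j = e j) (hy : ∀ j, j ≠ i → y j = e j)
    (hxt : ∀ j, xw (dyW s) a b (x j) ≠ ⊤) (hyt : ∀ j, xw (dyW s) a b (y j) ≠ ⊤)
    {t : ℝ} (ht : t ∈ Ico a b) :
    duhamel φ W ε Nhat a x t - duhamel φ W ε Nhat a y t = duhamel φ W ε Nhat a e t := by
  have hab : a ≤ b := ht.1.trans ht.2.le
  funext k₀
  simp only [Pi.sub_apply, duhamel]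
  rw [← (summable_duh h hη hC hγ ha hb hxt ht k₀).tsum_sub (summable_duh h hη hC hγ ha hb hyt ht k₀)]
  refine tsum_congr fun n => ?_
  unfold duh
  rw [← intervalIntegral.integral_sub
    (intervalIntegrable_integrand hW (fun j => uNorm_ne_top_of_xw (hxt j) _) k₀ ⟨le_rfl, hab⟩
      ⟨ht.1, ht.2.le⟩)
    (intervalIntegrable_integrand hW (fun j => uNorm_ne_top_of_xw (hyt j) _) k₀ ⟨le_rfl, hab⟩
      ⟨ht.1, ht.2.le⟩)]
  congr 1
  funext τ
  exact dform_sub_slot _ n i (hi τ) (fun j hj => by rw [hx j hj]) (fun j hj => by rw [hy j hj]) k₀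

/-- The Lipschitz constant of the Duhamel operator on balls of radius `B`, on intervals of
length `h`. -/
def lipConst (m : ℕ) (η γ : ℝ) (c : ℕ) (C : ℝ≥0∞) (h : ℝ) (B : ℝ≥0∞) : ℝ≥0∞ :=
  duhConst m η c C 1 * ENNReal.ofReal h ^ γ * (m * (m * B ^ (m - 1)))

theorem xw_duhamel_diag_le (hm : 2 ≤ m) (h : DuhBound φ W ε Nhat s γ η c C) (hη : 0 < η)
    (hC : C ≠ ⊤) (hγ : 0 ≤ γ) {a b : ℝ} (ha : 0 ≤ a) (hab : a ≤ b) (hb : b ≤ 1) {B : ℝ≥0∞}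
    (hB : B ≠ ⊤) {u : ℝ → Coeffs d} (hu : xw (dyW s) a b u ≤ B) :
    xw (dyW s) a b (duhamel φ W ε Nhat a fun _ => u) ≤
      lipConst m η γ c C (b - a) B * xw (dyW s) a b u := by
  have hut : xw (dyW s) a b u ≠ ⊤ := (hu.trans_lt hB.lt_top).ne
  refine (xw_duhamel_le_prod h hη hC hγ ha hab hb fun _ => hut).trans ?_
  rw [Finset.prod_const, Finset.card_univ, Fintype.card_fin]
  obtain ⟨l, rfl⟩ : ∃ l, m = l + 1 := ⟨m - 1, by omega⟩
  unfold lipConst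
  rw [add_tsub_cancel_right, mul_assoc (duhConst _ _ _ _ _ * _)]
  refine mul_le_mul' le_rfl ?_
  rw [mul_assoc, pow_succ]
  refine mul_le_mul' le_rfl ?_
  calc xw (dyW s) a b u ^ l * xw (dyW s) a b u ≤ B ^ l * xw (dyW s) a b u :=
        mul_le_mul' (pow_le_pow_left' hu l) le_rfl
    _ = 1 * (B ^ l * xw (dyW s) a b u) := by rw [one_mul]
    _ ≤ ((l + 1 : ℕ) : ℝ≥0∞) * (B ^ l * xw (dyW s) a b u) :=
        mul_le_mul' (by exact_mod_cast Nat.le_add_left 1 l) le_rfl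
    _ = _ := by ring

/-- Difference estimate for the Duhamel operator, by telescoping over the inputs. -/
theorem xw_duhamel_sub_le (hW : Continuous W) (h : DuhBound φ W ε Nhat s γ η c C) (hη : 0 < η)
    (hC : C ≠ ⊤) (hγ : 0 ≤ γ) {a b : ℝ} (ha : 0 ≤ a) (hab : a ≤ b) (hb : b ≤ 1) {B : ℝ≥0∞}
    (hB : B ≠ ⊤) {u v : ℝ → Coeffs d} (hu : xw (dyW s) a b u ≤ B) (hv : xw (dyW s) a b v ≤ B) :
    xw (dyW s) a b (fun t => duhamel φ W ε Nhat a (fun _ => u) t -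
      duhamel φ W ε Nhat a (fun _ => v) t) ≤
      lipConst m η γ c C (b - a) B * xw (dyW s) a b (fun t => u t - v t) := by
  have hut : xw (dyW s) a b u ≠ ⊤ := (hu.trans_lt hB.lt_top).ne
  have hvt : xw (dyW s) a b v ≠ ⊤ := (hv.trans_lt hB.lt_top).ne
  -- `y i` has its first `i` entries replaced by `v`; `e i` is the difference in the entry `i`
  set y : ℕ → Fin m → ℝ → Coeffs d := fun i j => if (j : ℕ) < i then v else u with hy
  set e : Fin m → Fin m → ℝ → Coeffs d := fun i j =>
    if j = i then fun t => u t - v t else y i j with he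
  have hyB : ∀ i j, xw (dyW s) a b (y i j) ≤ B := fun i j => by
    simp only [hy]; split_ifs <;> assumption
  have hyt : ∀ i j, xw (dyW s) a b (y i j) ≠ ⊤ := fun i j => ((hyB i j).trans_lt hB.lt_top).ne
  have het : ∀ i j, xw (dyW s) a b (e i j) ≠ ⊤ := fun i j => by
    simp only [he]
    split_ifs
    · exact ((xw_sub_le hab u v).trans_lt (ENNReal.add_lt_top.2 ⟨hut.lt_top, hvt.lt_top⟩)).ne
    · exact hyt i j
  have hstep : ∀ i : Fin m, ∀ t ∈ Ico a b, duhamel φ W ε Nhat a (y i) t -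
      duhamel φ W ε Nhat a (y (i + 1)) t = duhamel φ W ε Nhat a (e i) t := by
    intro i t ht
    refine duhamel_sub_slot hW h hη hC hγ ha hb i ?_ ?_ ?_ (hyt i) (hyt (i + 1)) ht
    · intro t
      simp [he, hy]
    · intro j hj
      simp [he, hj]
    · intro j hj
      have : (j : ℕ) ≠ i := fun h => hj (Fin.ext h)
      simp only [he, if_neg hj, hy]
      by_cases h1 : (j : ℕ) < i
      · rw [if_pos h1, if_pos (by omega)]
      · rw [if_neg h1, if_neg (by omega)]
  have htel : ∀ t ∈ Ico a b, duhamel φ W ε Nhat a (fun _ => u) t -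
      duhamel φ W ε Nhat a (fun _ => v) t = ∑ i : Fin m, duhamel φ W ε Nhat a (e i) t := by
    intro t ht
    rw [← Finset.sum_congr rfl fun i _ => hstep i t ht]
    rw [Fin.sum_univ_eq_sum_range (fun i => duhamel φ W ε Nhat a (y i) t -
      duhamel φ W ε Nhat a (y (i + 1)) t), Finset.sum_range_sub']
    have e0 : y 0 = fun _ => u := by funext j; simp [hy]
    have e1 : y m = fun _ => v := by funext j; simp [hy]
    rw [e0, e1]
  rw [xw_congr htel]
  refine (xw_sum_le hab _ _).trans ?_
  have hone : ∀ i, xw (dyW s) a b (duhamel φ W ε Nhat a (e i)) ≤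
      duhConst m η c C 1 * ENNReal.ofReal (b - a) ^ γ *
        (m * (B ^ (m - 1) * xw (dyW s) a b (fun t => u t - v t))) := by
    intro i
    refine (xw_duhamel_le_prod h hη hC hγ ha hab hb (het i)).trans ?_
    gcongr
    rw [← Finset.prod_erase_mul _ _ (Finset.mem_univ i)]
    have e1 : e i i = fun t => u t - v t := by simp [he]
    rw [e1]
    gcongr
    calc ∏ j ∈ Finset.univ.erase i, xw (dyW s) a b (e i j) ≤ ∏ j ∈ Finset.univ.erase i, B := by
          gcongr with j hj
          simp only [he, if_neg (Finset.ne_of_mem_erase hj)]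
          exact hyB i j
      _ = B ^ (m - 1) := by
          rw [Finset.prod_const, Finset.card_erase_of_mem (Finset.mem_univ i)]
          simp
  refine (Finset.sum_le_sum fun i _ => hone i).trans (le_of_eq ?_)
  rw [Finset.sum_const, Finset.card_univ, Fintype.card_fin, nsmul_eq_mul]
  unfold lipConst
  ring

end estimates


/-! ### Auxiliary facts for the continuity arguments -/

theorem exists_small_time {γ : ℝ} (hγ : 0 < γ) {K : ℝ≥0∞} (hK : K ≠ ⊤) :
    ∃ δ : ℝ, 0 < δ ∧ δ ≤ 1 ∧ ∀ h ≤ δ, ENNReal.ofReal h ^ γ * K ≤ 1 / 2 := by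
  have h1 : Tendsto (fun h : ℝ => ENNReal.ofReal h ^ γ * K) (𝓝 0) (𝓝 0) := by
    have h2 : Tendsto (fun h : ℝ => ENNReal.ofReal h ^ γ) (𝓝 0) (𝓝 0) := by
      have := (ENNReal.continuous_rpow_const (y := γ)).tendsto (ENNReal.ofReal 0)
      rw [ENNReal.ofReal_zero, ENNReal.zero_rpow_of_pos hγ] at this
      refine this.comp ?_
      have h3 := ENNReal.continuous_ofReal.tendsto 0
      rwa [ENNReal.ofReal_zero] at h3
    simpa using ENNReal.Tendsto.mul_const h2 (Or.inr hK)
  have h2 : ∀ᶠ h in 𝓝 (0 : ℝ), ENNReal.ofReal h ^ γ * K < 1 / 2 :=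
    h1.eventually_lt_const (by simp)
  obtain ⟨r, hr, hr'⟩ := Metric.eventually_nhds_iff.1 h2
  refine ⟨min (r / 2) 1, by positivity, min_le_right _ _, fun h hh => ?_⟩
  have h3 : ENNReal.ofReal (min (r / 2) 1) ^ γ * K < 1 / 2 := by
    refine hr' ?_
    rw [Real.dist_eq, sub_zero, abs_of_pos (by positivity)]
    exact (min_le_left _ _).trans_lt (by linarith)
  refine le_trans ?_ h3.le
  gcongr

theorem le_two_mul_of_le_half {x y : ℝ≥0∞} (hx : x ≠ ⊤) (h : x ≤ y + 1 / 2 * x) : x ≤ 2 * y := by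
  rcases eq_or_ne y ⊤ with rfl | hy
  · simp
  lift x to ℝ≥0 using hx
  lift y to ℝ≥0 using hy
  have e : (1 / 2 : ℝ≥0∞) = ((1 / 2 : ℝ≥0) : ℝ≥0∞) := by
    rw [ENNReal.coe_div (by norm_num)]; norm_num
  rw [e] at h
  norm_cast at h ⊢
  have h' : (x : ℝ) ≤ y + 1 / 2 * x := by exact_mod_cast h
  have : (x : ℝ) ≤ 2 * y := by linarith
  exact_mod_cast this

theorem step_induction {T δ : ℝ} (hT : 0 ≤ T) (hδ : 0 < δ) {P : ℝ → Prop} (h0 : P 0)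
    (hs : ∀ a, 0 ≤ a → a < T → P a → P (min (a + δ) T)) : P T := by
  have key : ∀ n : ℕ, P (min (n * δ) T) := by
    intro n
    induction n with
    | zero => simpa [min_eq_left hT] using h0
    | succ n ih =>
      rcases lt_or_ge ((n : ℝ) * δ) T with h | h
      · rw [min_eq_left h.le] at ih
        have := hs _ (by positivity) h ih
        convert this using 2
        push_cast; ring
      · rw [min_eq_right h] at ih
        rw [min_eq_right]
        · exact ih
        · push_cast; linarith
  obtain ⟨n, hn⟩ := exists_nat_ge (T / δ)
  have := key n
  rwa [min_eq_right] at this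
  rwa [div_le_iff₀ hδ] at hn

/-! ### Integral equations in the interaction picture -/

section solutions
variable {d m : ℕ} {φ : (Fin d → ℝ) → ℝ} {W : ℝ → ℝ} {ε : Fin (m + 1) → ℤˣ}
  {Nhat : (Fin (m + 1) → Fin d → ℤ) → ℂ} {s γ η : ℝ} {c : ℕ} {C : ℝ≥0∞}

/-- `v = f - ∫_a^t` on `[a, b)`, the integral equation in the interaction picture, with the time
integral read as an unconditional sum over the dyadic levels. -/
def IsIntSol (φ : (Fin d → ℝ) → ℝ) (W : ℝ → ℝ) (ε : Fin (m + 1) → ℤˣ)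
    (Nhat : (Fin (m + 1) → Fin d → ℤ) → ℂ) (a b : ℝ) (f : Coeffs d) (v : ℝ → Coeffs d) : Prop :=
  ∀ t ∈ Ico a b, ∀ k₀, HasSum (fun n : Fin m → ℕ => duh φ W ε Nhat a n (fun _ => v) t k₀)
    (f k₀ - v t k₀)

theorem IsIntSol.eq {a b : ℝ} {f : Coeffs d} {v : ℝ → Coeffs d}
    (hv : IsIntSol φ W ε Nhat a b f v) {t : ℝ} (ht : t ∈ Ico a b) :
    v t = f - duhamel φ W ε Nhat a (fun _ => v) t := by
  funext k₀
  rw [Pi.sub_apply, duhamel, (hv t ht k₀).tsum_eq, sub_sub_cancel]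

theorem isIntSol_of_eq (h : DuhBound φ W ε Nhat s γ η c C) (hη : 0 < η) (hC : C ≠ ⊤)
    (hγ : 0 ≤ γ) {a b : ℝ} (ha : 0 ≤ a) (hb : b ≤ 1) {f : Coeffs d} {v : ℝ → Coeffs d}
    (hv : xw (dyW s) a b v ≠ ⊤)
    (heq : ∀ t ∈ Ico a b, v t = f - duhamel φ W ε Nhat a (fun _ => v) t) :
    IsIntSol φ W ε Nhat a b f v := by
  intro t ht k₀
  have h1 := (summable_duh h hη hC hγ ha hb (fun _ => hv) ht k₀).hasSum
  have h2 := congrFun (heq t ht) k₀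
  rw [Pi.sub_apply, duhamel] at h2
  rw [h2, sub_sub_cancel]
  exact h1

theorem IsIntSol.mono {a b b' : ℝ} {f : Coeffs d} {v : ℝ → Coeffs d}
    (hv : IsIntSol φ W ε Nhat a b f v) (hb : b' ≤ b) : IsIntSol φ W ε Nhat a b' f v :=
  fun t ht => hv t ⟨ht.1, ht.2.trans_le hb⟩

theorem IsIntSol.initial {a b : ℝ} {f : Coeffs d} {v : ℝ → Coeffs d}
    (hv : IsIntSol φ W ε Nhat a b f v) (hab : a < b) : v a = f := by
  funext k₀
  have h := hv a ⟨le_rfl, hab⟩ k₀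
  simp only [duh, intervalIntegral.integral_same] at h
  exact (sub_eq_zero.1 (h.unique hasSum_zero)).symm

/-- The equation can be restarted at any time. -/
theorem IsIntSol.restart (hW : Continuous W) {a b a' : ℝ} {f : Coeffs d} {v : ℝ → Coeffs d}
    (hv : IsIntSol φ W ε Nhat a b f v) (hfin : xw (dyW s) a b v ≠ ⊤) (ha' : a' ∈ Ico a b) :
    IsIntSol φ W ε Nhat a' b (v a') v := by
  intro t ht k₀
  have h1 := (hv t ⟨ha'.1.trans ht.1, ht.2⟩ k₀).sub (hv a' ha' k₀)
  rw [sub_sub_sub_cancel_left] at h1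
  refine Eq.mp (congrArg (fun F => HasSum F (v a' k₀ - v t k₀)) (funext fun n => ?_)) h1
  have hI : ∀ t' ∈ Ico a b, IntervalIntegrable (fun τ => dform ε (modMult φ W ε Nhat τ) n
      (fun _ : Fin m => v τ) k₀) volume a t' := fun t' ht' =>
    intervalIntegrable_integrand (z := fun _ => v) hW (fun j => uNorm_ne_top_of_xw hfin _) k₀
      ⟨le_rfl, ht'.1.trans ht'.2.le⟩ ⟨ht'.1, ht'.2.le⟩
  unfold duh
  exact intervalIntegral.integral_interval_sub_left (hI t ⟨ha'.1.trans ht.1, ht.2⟩) (hI a' ha')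

theorem duh_congr {a t : ℝ} (hat : a ≤ t) (n : Fin m → ℕ) {z z' : Fin m → ℝ → Coeffs d}
    (h : ∀ j, ∀ τ ∈ Ico a t, z j τ = z' j τ) :
    duh φ W ε Nhat a n z t = duh φ W ε Nhat a n z' t := by
  funext k₀
  unfold duh
  rw [intervalIntegral.integral_of_le hat, intervalIntegral.integral_of_le hat,
    integral_Ioc_eq_integral_Ioo, integral_Ioc_eq_integral_Ioo]
  refine setIntegral_congr_fun measurableSet_Ioo fun τ hτ => ?_
  have : (fun j => z j τ) = fun j => z' j τ := funext fun j => h j τ ⟨hτ.1.le, hτ.2⟩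
  simp only [this]

/-- Two solutions of bounded size on a short interval differ by at most twice the difference of
their data. -/
theorem IsIntSol.xw_sub_le (hW : Continuous W) (h : DuhBound φ W ε Nhat s γ η c C) (hη : 0 < η)
    (hC : C ≠ ⊤) (hγ : 0 ≤ γ) {a b : ℝ} (ha : 0 ≤ a) (hab : a ≤ b) (hb : b ≤ 1) {B : ℝ≥0∞}
    (hB : B ≠ ⊤) (hlip : lipConst m η γ c C (b - a) B ≤ 1 / 2) {f g : Coeffs d}
    {u v : ℝ → Coeffs d} (hu : IsIntSol φ W ε Nhat a b f u) (hv : IsIntSol φ W ε Nhat a b g v)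
    (huB : xw (dyW s) a b u ≤ B) (hvB : xw (dyW s) a b v ≤ B) :
    xw (dyW s) a b (fun t => u t - v t) ≤ 2 * hw (dyW s) (f - g) := by
  have hfin : xw (dyW s) a b (fun t => u t - v t) ≠ ⊤ :=
    ((ModDisp.xw_sub_le hab u v).trans_lt (ENNReal.add_lt_top.2
      ⟨huB.trans_lt hB.lt_top, hvB.trans_lt hB.lt_top⟩)).ne
  refine le_two_mul_of_le_half hfin ?_
  have e : ∀ t ∈ Ico a b, u t - v t = (f - g) - (duhamel φ W ε Nhat a (fun _ => u) t -
      duhamel φ W ε Nhat a (fun _ => v) t) := by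
    intro t ht
    rw [hu.eq ht, hv.eq ht]
    abel
  calc xw (dyW s) a b (fun t => u t - v t) = xw (dyW s) a b (fun t => (f - g) -
        (duhamel φ W ε Nhat a (fun _ => u) t - duhamel φ W ε Nhat a (fun _ => v) t)) := xw_congr e
    _ ≤ xw (dyW s) a b (fun _ => f - g) + xw (dyW s) a b (fun t =>
        duhamel φ W ε Nhat a (fun _ => u) t - duhamel φ W ε Nhat a (fun _ => v) t) :=
        ModDisp.xw_sub_le hab _ _
    _ ≤ hw (dyW s) (f - g) + 1 / 2 * xw (dyW s) a b (fun t => u t - v t) := by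
        refine add_le_add (xw_const_le hab _) ?_
        exact (xw_duhamel_sub_le hW h hη hC hγ ha hab hb hB huB hvB).trans (by gcongr)

theorem lipConst_eq (h : ℝ) (B : ℝ≥0∞) : lipConst m η γ c C h B =
    ENNReal.ofReal h ^ γ * (duhConst m η c C 1 * (m * (m * B ^ (m - 1)))) := by
  unfold lipConst; ring

theorem exists_lipConst_le (hη : 0 < η) (hC : C ≠ ⊤) (hγ : 0 < γ) {B : ℝ≥0∞} (hB : B ≠ ⊤) :
    ∃ δ : ℝ, 0 < δ ∧ δ ≤ 1 ∧ ∀ h ≤ δ, lipConst m η γ c C h B ≤ 1 / 2 := by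
  simp_rw [lipConst_eq]
  refine exists_small_time hγ (ENNReal.mul_ne_top (duhConst_ne_top hη hC ENNReal.one_ne_top)
    (ENNReal.mul_ne_top (ENNReal.natCast_ne_top m) (ENNReal.mul_ne_top (ENNReal.natCast_ne_top m)
      (ENNReal.pow_ne_top hB))))

/-- Uniqueness, without any smallness: two solutions are compared on successive short
intervals. -/
theorem IsIntSol.unique (hW : Continuous W) (h : DuhBound φ W ε Nhat s γ η c C) (hη : 0 < η)
    (hC : C ≠ ⊤) (hγ : 0 < γ) {T : ℝ} (hT : 0 ≤ T) (hT1 : T ≤ 1) {f : Coeffs d}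
    {u v : ℝ → Coeffs d} (hu : IsIntSol φ W ε Nhat 0 T f u) (hv : IsIntSol φ W ε Nhat 0 T f v)
    (hut : xw (dyW s) 0 T u ≠ ⊤) (hvt : xw (dyW s) 0 T v ≠ ⊤) :
    ∀ t ∈ Ico 0 T, u t = v t := by
  set B := max (xw (dyW s) 0 T u) (xw (dyW s) 0 T v) with hBdef
  have hB : B ≠ ⊤ := by simp [hBdef, hut, hvt]
  obtain ⟨δ, hδ, -, hlip⟩ := exists_lipConst_le (m := m) (c := c) hη hC hγ hB
  refine step_induction (P := fun a => ∀ t ∈ Ico 0 a, u t = v t) hT hδ (by simp) ?_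
  intro a ha haT hP
  set b := min (a + δ) T with hb
  have hab : a < b := lt_min (by linarith) haT
  have hbT : b ≤ T := min_le_right _ _
  -- the integrals up to the time `a` agree, hence so do the values there
  have huv : u a = v a := by
    funext k₀
    have h1 := hu a ⟨ha, haT⟩ k₀
    have h2 := hv a ⟨ha, haT⟩ k₀
    simp_rw [fun n => duh_congr (φ := φ) (W := W) (ε := ε) (Nhat := Nhat) ha n
      (z := fun _ => u) (z' := fun _ => v) fun _ => hP] at h1
    exact sub_right_injective (h1.unique h2)
  have hsub := ((hu.restart hW hut ⟨ha, haT⟩).mono hbT).xw_sub_le hW h hη hC hγ.le ha hab.le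
    (hbT.trans hT1) hB (hlip _ (by linarith [min_le_left (a + δ) T]))
    ((hv.restart hW hvt ⟨ha, haT⟩).mono hbT)
    ((xw_restrict u ha hab.le hbT).trans (le_max_left _ _))
    ((xw_restrict v ha hab.le hbT).trans (le_max_right _ _))
  rw [huv, sub_self] at hsub
  have h0 : hw (dyW s) (0 : Coeffs d) = 0 := by
    rw [hw_eq]; simp [l2]
  rw [h0, mul_zero] at hsub
  intro t ht
  rcases lt_or_ge t a with hta | hta
  · exact hP t ⟨ht.1, hta⟩
  · exact sub_eq_zero.1 (eq_zero_of_xw (v := fun t => u t - v t) (le_antisymm hsub zero_le)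
      ⟨hta, ht.2⟩)

/-! ### Existence by iteration -/

/-- The Picard iterates of the integral equation in the interaction picture. -/
def picard (φ : (Fin d → ℝ) → ℝ) (W : ℝ → ℝ) (ε : Fin (m + 1) → ℤˣ)
    (Nhat : (Fin (m + 1) → Fin d → ℤ) → ℂ) (f : Coeffs d) : ℕ → ℝ → Coeffs d
  | 0 => fun _ => f
  | i + 1 => fun t => f - duhamel φ W ε Nhat 0 (fun _ => picard φ W ε Nhat f i) t

theorem half_mul_two_mul (r : ℝ≥0∞) : 1 / 2 * (2 * r) = r := by
  rw [← mul_assoc, one_div, ENNReal.inv_mul_cancel (by simp) (by simp), one_mul]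

theorem xw_picard_le (hm : 2 ≤ m) (h : DuhBound φ W ε Nhat s γ η c C) (hη : 0 < η)
    (hC : C ≠ ⊤) (hγ : 0 ≤ γ) {T : ℝ} (hT : 0 ≤ T) (hT1 : T ≤ 1) {r : ℝ≥0∞} (hr : r ≠ ⊤)
    (hlip : lipConst m η γ c C T (2 * r) ≤ 1 / 2) {f : Coeffs d} (hf : hw (dyW s) f ≤ r) (i : ℕ) :
    xw (dyW s) 0 T (picard φ W ε Nhat f i) ≤ 2 * r := by
  induction i with
  | zero => exact (xw_const_le hT f).trans (hf.trans (by rw [two_mul]; exact le_self_add))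
  | succ i ih =>
    have hD := xw_duhamel_diag_le hm h hη hC hγ le_rfl hT hT1 (ENNReal.mul_ne_top (by simp) hr) ih
    rw [sub_zero] at hD
    calc _ ≤ xw (dyW s) 0 T (fun _ => f) +
          xw (dyW s) 0 T (duhamel φ W ε Nhat 0 fun _ => picard φ W ε Nhat f i) :=
          xw_sub_le hT (fun _ => f) _
      _ ≤ r + 1 / 2 * (2 * r) := by
          refine add_le_add ((xw_const_le hT f).trans hf) (hD.trans ?_)
          gcongr
      _ = 2 * r := by rw [half_mul_two_mul, two_mul]

theorem xw_picard_sub_le (hm : 2 ≤ m) (hW : Continuous W) (h : DuhBound φ W ε Nhat s γ η c C)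
    (hη : 0 < η) (hC : C ≠ ⊤) (hγ : 0 ≤ γ) {T : ℝ} (hT : 0 ≤ T) (hT1 : T ≤ 1) {r : ℝ≥0∞}
    (hr : r ≠ ⊤) (hlip : lipConst m η γ c C T (2 * r) ≤ 1 / 2) {f : Coeffs d}
    (hf : hw (dyW s) f ≤ r) (i : ℕ) :
    xw (dyW s) 0 T (fun t => picard φ W ε Nhat f (i + 1) t - picard φ W ε Nhat f i t) ≤
      (1 / 2) ^ (i + 1) * r := by
  have h2r : 2 * r ≠ ⊤ := ENNReal.mul_ne_top (by simp) hr
  induction i with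
  | zero =>
    have e : (fun t => picard φ W ε Nhat f 1 t - picard φ W ε Nhat f 0 t) = fun t =>
        -duhamel φ W ε Nhat 0 (fun _ => fun _ => f) t := by
      funext t
      simp [picard]
    have h0 := xw_const_le (w := dyW s) hT f
    have hD := xw_duhamel_diag_le hm h hη hC hγ le_rfl hT hT1 h2r
      (xw_picard_le hm h hη hC hγ hT hT1 hr hlip hf 0)
    rw [sub_zero] at hD
    rw [zero_add, pow_one, e, xw_neg]
    exact hD.trans (mul_le_mul' hlip (h0.trans hf))
  | succ i ih =>
    have hD := xw_duhamel_sub_le hW h hη hC hγ le_rfl hT hT1 h2r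
      (xw_picard_le hm h hη hC hγ hT hT1 hr hlip hf i)
      (xw_picard_le hm h hη hC hγ hT hT1 hr hlip hf (i + 1))
    rw [sub_zero] at hD
    have e : (fun t => picard φ W ε Nhat f (i + 1 + 1) t - picard φ W ε Nhat f (i + 1) t) =
        fun t => duhamel φ W ε Nhat 0 (fun _ => picard φ W ε Nhat f i) t -
          duhamel φ W ε Nhat 0 (fun _ => picard φ W ε Nhat f (i + 1)) t := by
      funext t
      simp [picard]
    rw [e]
    refine hD.trans ?_
    rw [xw_sub_comm, pow_succ', mul_assoc]
    exact mul_le_mul' hlip ih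

/-- The Picard iterates converge to a solution. Their coefficientwise limit is recorded because it
transfers real-valuedness to the solution. -/
theorem exists_isIntSol (hm : 2 ≤ m) (hW : Continuous W) (h : DuhBound φ W ε Nhat s γ η c C)
    (hη : 0 < η) (hC : C ≠ ⊤) (hγ : 0 ≤ γ) {T : ℝ} (hT : 0 ≤ T) (hT1 : T ≤ 1) {r : ℝ≥0∞}
    (hr : r ≠ ⊤) (hlip : lipConst m η γ c C T (2 * r) ≤ 1 / 2) {f : Coeffs d}
    (hf : hw (dyW s) f ≤ r) :
    ∃ v : ℝ → Coeffs d, IsIntSol φ W ε Nhat 0 T f v ∧ xw (dyW s) 0 T v ≤ 2 * r ∧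
      ∀ t ∈ Ico 0 T, ∀ k, Tendsto (fun i => picard φ W ε Nhat f i t k) atTop (𝓝 (v t k)) := by
  have h2r : 2 * r ≠ ⊤ := ENNReal.mul_ne_top (by simp) hr
  set V := picard φ W ε Nhat f with hV
  set G : ℕ → ℝ → Coeffs d := fun i t => V (i + 1) t - V i t with hG
  have hGle : ∀ i, xw (dyW s) 0 T (G i) ≤ (1 / 2) ^ (i + 1) * r := fun i =>
    xw_picard_sub_le hm hW h hη hC hγ hT hT1 hr hlip hf i
  have hsum : ∑' i, xw (dyW s) 0 T (G i) ≤ r := by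
    refine (ENNReal.tsum_le_tsum hGle).trans ?_
    rw [ENNReal.tsum_mul_right]
    simp_rw [one_div]
    rw [ENNReal.tsum_geometric_add_one, ENNReal.one_sub_inv_two, inv_inv,
      ENNReal.inv_mul_cancel (by simp) (by simp), one_mul]
  have hsumt : ∑' i, xw (dyW s) 0 T (G i) ≠ ⊤ := (hsum.trans_lt hr.lt_top).ne
  have hsummable : ∀ t ∈ Ico 0 T, ∀ k, Summable fun i => G i t k := by
    intro t ht k
    have h1 : ∑' i, ‖G i t k‖ₑ ≠ ⊤ := by
      have h2 : dyW s (lvl k) * ∑' i, ‖G i t k‖ₑ ≤ ∑' i, xw (dyW s) 0 T (G i) := by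
        rw [← ENNReal.tsum_mul_left]
        refine ENNReal.tsum_le_tsum fun i => le_trans ?_ (hw_le_xw ht (G i))
        exact (mul_le_mul' le_rfl (enorm_apply_le_block (G i t) k)).trans
          (le_l2 (fun n => dyW s n * ‖block n (G i t)‖ₑ) (lvl k))
      intro htop
      rw [htop, ENNReal.mul_top (dyW_ne_zero _ _)] at h2
      exact hsumt (top_le_iff.1 h2)
    have h3 := ENNReal.summable_toReal h1
    simp only [toReal_enorm] at h3
    exact h3.of_norm
  set v : ℝ → Coeffs d := fun t k => f k + ∑' i, G i t k with hv
  have htel : ∀ n t k, ∑ i ∈ Finset.range n, G i t k = V n t k - f k := by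
    intro n t k
    exact Finset.sum_range_sub (fun i => V i t k) n
  have htend : ∀ t ∈ Ico 0 T, ∀ k, Tendsto (fun i => V i t k) atTop (𝓝 (v t k)) := by
    intro t ht k
    have h1 := ((hsummable t ht k).hasSum.tendsto_sum_nat).const_add (f k)
    simpa only [htel, add_sub_cancel] using h1
  have hvn : ∀ n, xw (dyW s) 0 T (fun t => v t - V n t) ≤ ∑' i, xw (dyW s) 0 T (G (i + n)) := by
    intro n
    refine xw_tsum_le hT fun t ht k => ?_
    have h1 := (hasSum_nat_add_iff' (f := fun i => G i t k) n).2 (hsummable t ht k).hasSum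
    rw [htel] at h1
    have h2 : (v t - V n t) k = ∑' i, G i t k - (V n t k - f k) := by
      change f k + _ - V n t k = _
      ring
    rw [h2]
    exact h1
  have hvB : xw (dyW s) 0 T v ≤ 2 * r := by
    calc xw (dyW s) 0 T v ≤ xw (dyW s) 0 T (fun _ => f) + xw (dyW s) 0 T (fun t => v t - V 0 t) := by
          refine le_trans (le_of_eq (xw_congr fun t _ => ?_)) (xw_add_le hT _ _)
          exact (add_sub_cancel f (v t)).symm
      _ ≤ r + r := add_le_add ((xw_const_le hT f).trans hf) ((hvn 0).trans hsum)
      _ = 2 * r := (two_mul r).symm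
  have hvt : xw (dyW s) 0 T v ≠ ⊤ := (hvB.trans_lt h2r.lt_top).ne
  refine ⟨v, isIntSol_of_eq h hη hC hγ le_rfl hT1 hvt fun t ht => ?_, hvB, htend⟩
  set Φ : ℝ → Coeffs d := fun t => f - duhamel φ W ε Nhat 0 (fun _ => v) t with hΦ
  -- the distance from `v` to its image is bounded by tails of a convergent series
  have hzero : xw (dyW s) 0 T (fun t => v t - Φ t) = 0 := by
    have hle : ∀ n, xw (dyW s) 0 T (fun t => v t - Φ t) ≤
        ∑' i, xw (dyW s) 0 T (G (i + (n + 1))) + 1 / 2 * ∑' i, xw (dyW s) 0 T (G (i + n)) := by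
      intro n
      have hD := xw_duhamel_sub_le hW h hη hC hγ le_rfl hT hT1 h2r hvB
        (xw_picard_le hm h hη hC hγ hT hT1 hr hlip hf n)
      rw [sub_zero] at hD
      calc xw (dyW s) 0 T (fun t => v t - Φ t) ≤ xw (dyW s) 0 T (fun t => v t - V (n + 1) t) +
            xw (dyW s) 0 T (fun t => duhamel φ W ε Nhat 0 (fun _ => v) t -
              duhamel φ W ε Nhat 0 (fun _ => V n) t) := by
            refine le_trans (le_of_eq (xw_congr fun t _ => ?_)) (xw_add_le hT _ _)
            simp only [hΦ, hV, picard]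
            abel
        _ ≤ _ := add_le_add (hvn _) (hD.trans (mul_le_mul' hlip (hvn n)))
    have ht0 := ENNReal.tendsto_sum_nat_add _ hsumt
    have ht1 : Tendsto (fun n => ∑' i, xw (dyW s) 0 T (G (i + (n + 1))) +
        1 / 2 * ∑' i, xw (dyW s) 0 T (G (i + n))) atTop (𝓝 0) := by
      have h1 := (ht0.comp (tendsto_add_atTop_nat 1)).add
        (ENNReal.Tendsto.const_mul (a := 1 / 2) ht0 (Or.inr (by simp)))
      simpa using h1
    exact le_antisymm (ge_of_tendsto' ht1 hle) zero_le
  exact sub_eq_zero.1 (eq_zero_of_xw hzero ht)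

end solutions


/-! ### Persistence of regularity -/

section persistence
variable {d m : ℕ} {φ : (Fin d → ℝ) → ℝ} {W : ℝ → ℝ} {ε : Fin (m + 1) → ℤˣ}
  {Nhat : (Fin (m + 1) → Fin d → ℤ) → ℂ} {s σ γ η : ℝ} {c : ℕ} {C : ℝ≥0∞}

theorem dyW_mono {r : ℝ} (hr : 0 ≤ r) {n n' : ℕ} (h : n ≤ n') : dyW r n ≤ dyW r n' := by
  refine ENNReal.ofReal_le_ofReal (Real.rpow_le_rpow_of_exponent_le (by norm_num) ?_)
  gcongr

theorem dyW_add (r : ℝ) (n n' : ℕ) : dyW r (n + n') = dyW r n * dyW r n' := by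
  unfold dyW
  rw [← ENNReal.ofReal_mul (by positivity), ← Real.rpow_add (by norm_num)]
  push_cast
  ring_nf

theorem slowWeight_dyW {r : ℝ} (hr : 0 ≤ r) (c : ℕ) : SlowWeight c (dyW r) (dyW r c) := by
  intro n n' h
  rw [← dyW_add]
  exact dyW_mono hr (by omega)

theorem slowWeight_dyW_min {r : ℝ} (hr : 0 ≤ r) (c M : ℕ) :
    SlowWeight c (fun n => dyW r (min n M)) (dyW r c) := by
  intro n n' h
  rw [← dyW_add]
  exact dyW_mono hr (by omega)

theorem sum_prod_tame (g : ℕ → ℝ≥0∞) (a b : ℝ) (v : ℝ → Coeffs d) :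
    ∑ i : Fin m, ∏ j : Fin m, xw (fun n => (if j = i then g n else 1) * dyW s n) a b v =
      m * (xw (dyW s) a b v ^ (m - 1) * xw (fun n => g n * dyW s n) a b v) := by
  have h : ∀ i : Fin m, ∏ j : Fin m, xw (fun n => (if j = i then g n else 1) * dyW s n) a b v =
      xw (dyW s) a b v ^ (m - 1) * xw (fun n => g n * dyW s n) a b v := by
    intro i
    rw [← Finset.prod_erase_mul _ _ (Finset.mem_univ i)]
    simp only [if_true]
    congr 1
    rw [Finset.prod_congr rfl fun j hj => by
      rw [show (fun n => (if j = i then g n else 1) * dyW s n) = dyW s from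
        funext fun n => by rw [if_neg (Finset.ne_of_mem_erase hj), one_mul]]]
    rw [Finset.prod_const, Finset.card_erase_of_mem (Finset.mem_univ i)]
    simp
  rw [Finset.sum_congr rfl fun i _ => h i, Finset.sum_const, Finset.card_univ, Fintype.card_fin,
    nsmul_eq_mul]

/-- The tame estimate on the diagonal: the higher norm enters linearly. -/
theorem xw_duhamel_tame_le (h : DuhBound φ W ε Nhat s γ η c C) (hη : 0 < η) (hC : C ≠ ⊤)
    (hγ : 0 ≤ γ) {a b : ℝ} (ha : 0 ≤ a) (hab : a ≤ b) (hb : b ≤ 1) {g : ℕ → ℝ≥0∞} {D : ℝ≥0∞}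
    (hg : SlowWeight c g D) {B : ℝ≥0∞} (hB : B ≠ ⊤) {v : ℝ → Coeffs d}
    (hv : xw (dyW s) a b v ≤ B) :
    xw (fun n => g n * dyW s n) a b (duhamel φ W ε Nhat a fun _ => v) ≤
      ENNReal.ofReal (b - a) ^ γ * (duhConst m η c C D * (m * B ^ (m - 1))) *
        xw (fun n => g n * dyW s n) a b v := by
  refine (xw_duhamel_le h hη hC hγ ha hab hb hg fun _ => (hv.trans_lt hB.lt_top).ne).trans ?_
  rw [sum_prod_tame]
  calc _ ≤ duhConst m η c C D * ENNReal.ofReal (b - a) ^ γ *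
        (m * (B ^ (m - 1) * xw (fun n => g n * dyW s n) a b v)) :=
        mul_le_mul' le_rfl (mul_le_mul' le_rfl (mul_le_mul' (pow_le_pow_left' hv _) le_rfl))
    _ = _ := by ring

/-- On a short interval the higher norm of a solution is controlled by that of its data. The
higher norm is not known to be finite beforehand, so it is approached by weights which only differ
from the lower one at finitely many levels. -/
theorem IsIntSol.xw_higher_le (h : DuhBound φ W ε Nhat s γ η c C) (hη : 0 < η) (hC : C ≠ ⊤)
    (hγ : 0 ≤ γ) (hσ : s ≤ σ) {a b : ℝ} (ha : 0 ≤ a) (hab : a ≤ b) (hb : b ≤ 1) {B : ℝ≥0∞}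
    (hB : B ≠ ⊤) {f : Coeffs d} {v : ℝ → Coeffs d} (hv : IsIntSol φ W ε Nhat a b f v)
    (hvB : xw (dyW s) a b v ≤ B) (hsmall : ENNReal.ofReal (b - a) ^ γ *
      (duhConst m η c C (dyW (σ - s) c) * (m * B ^ (m - 1))) ≤ 1 / 2) :
    xw (dyW σ) a b v ≤ 2 * hw (dyW σ) f := by
  have hr : 0 ≤ σ - s := sub_nonneg.2 hσ
  have hsplit : ∀ n, dyW σ n = dyW (σ - s) n * dyW s n := fun n => by
    rw [dyW_mul, sub_add_cancel]
  set w : ℕ → ℕ → ℝ≥0∞ := fun M n => dyW (σ - s) (min n M) * dyW s n with hw'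
  have hwle : ∀ M n, w M n ≤ dyW σ n := fun M n => by
    rw [hsplit]
    exact mul_le_mul' (dyW_mono hr (min_le_left _ _)) le_rfl
  have hM : ∀ M, xw (w M) a b v ≤ 2 * hw (dyW σ) f := by
    intro M
    have hfin : xw (w M) a b v ≠ ⊤ := by
      have h1 : xw (w M) a b v ≤ dyW (σ - s) M * xw (dyW s) a b v := by
        rw [← xw_const_mul]
        exact xw_mono (fun n => mul_le_mul' (dyW_mono hr (min_le_right _ _)) le_rfl) v
      exact (h1.trans_lt (ENNReal.mul_lt_top (dyW_ne_top _ _).lt_top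
        (hvB.trans_lt hB.lt_top))).ne
    refine (le_two_mul_of_le_half hfin (y := hw (w M) f) ?_).trans ?_
    · calc xw (w M) a b v = xw (w M) a b (fun t => f - duhamel φ W ε Nhat a (fun _ => v) t) :=
            xw_congr fun t ht => hv.eq ht
        _ ≤ xw (w M) a b (fun _ => f) + xw (w M) a b (duhamel φ W ε Nhat a fun _ => v) :=
            ModDisp.xw_sub_le hab _ _
        _ ≤ hw (w M) f + 1 / 2 * xw (w M) a b v := by
            refine add_le_add (xw_const_le hab f) ((xw_duhamel_tame_le h hη hC hγ ha hab hb
              (slowWeight_dyW_min hr c M) hB hvB).trans ?_)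
            exact mul_le_mul' hsmall le_rfl
    · exact mul_le_mul' le_rfl (hw_mono (hwle M) f)
  refine l2_iSup_le (f := fun M n => w M n * uNorm 2 a b (fun t => block n (v t)))
    (fun n => ⟨n, ?_⟩) (fun n M M' hMM => ?_) hM
  · simp only [hw', min_self, hsplit, le_refl]
  · refine mul_le_mul' (mul_le_mul' (dyW_mono hr ?_) le_rfl) le_rfl
    exact min_le_min le_rfl hMM

theorem xw_empty (w : ℕ → ℝ≥0∞) (a : ℝ) (v : ℝ → Coeffs d) : xw w a a v = 0 := by
  unfold xw
  simp_rw [fun n => uNorm_eq_of_zero (f := fun t => block n (v t)) (le_refl a) (by simp)]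
  simp [l2]

/-- Higher regularity of the data persists as long as the solution exists. -/
theorem IsIntSol.xw_higher_ne_top (hW : Continuous W) (h : DuhBound φ W ε Nhat s γ η c C)
    (hη : 0 < η) (hC : C ≠ ⊤) (hγ : 0 < γ) (hσ : s ≤ σ) {T : ℝ} (hT : 0 ≤ T) (hT1 : T ≤ 1)
    {f : Coeffs d} {v : ℝ → Coeffs d} (hv : IsIntSol φ W ε Nhat 0 T f v)
    (hvt : xw (dyW s) 0 T v ≠ ⊤) (hf : hw (dyW σ) f ≠ ⊤) : xw (dyW σ) 0 T v ≠ ⊤ := by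
  set B := xw (dyW s) 0 T v with hB
  obtain ⟨δ, hδ, -, hsmall⟩ := exists_small_time hγ
    (K := duhConst m η c C (dyW (σ - s) c) * (m * B ^ (m - 1)))
    (ENNReal.mul_ne_top (duhConst_ne_top hη hC (dyW_ne_top _ _))
      (ENNReal.mul_ne_top (ENNReal.natCast_ne_top m) (ENNReal.pow_ne_top hvt)))
  -- steps of half the admissible length, so that the next starting point is an interior one
  refine (step_induction (P := fun a => xw (dyW σ) 0 a v ≠ ⊤ ∧ (a < T → hw (dyW σ) (v a) ≠ ⊤)) hT
    (half_pos hδ) ⟨?_, fun h0 => ?_⟩ ?_).1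
  · rw [xw_empty]; simp
  · rwa [hv.initial h0]
  · intro a ha haT hP
    set b := min (a + δ) T with hb
    have hbT : b ≤ T := min_le_right _ _
    have hab : a < b := lt_min (by linarith) haT
    have hle := ((hv.restart hW hvt ⟨ha, haT⟩).mono hbT).xw_higher_le h hη hC hγ.le hσ ha hab.le
      (hbT.trans hT1) hvt (xw_restrict v ha hab.le hbT)
      (hsmall _ (by linarith [min_le_left (a + δ) T]))
    have hfin : xw (dyW σ) a b v ≠ ⊤ :=
      (hle.trans_lt (ENNReal.mul_lt_top (by simp) (hP.2 haT).lt_top)).ne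
    set a' := min (a + δ / 2) T with ha'
    have haa' : a ≤ a' := le_min (by linarith) haT.le
    have ha'b : a' ≤ b := min_le_min (by linarith) le_rfl
    refine ⟨((xw_glue ha haa' v).trans_lt (ENNReal.add_lt_top.2 ⟨hP.1.lt_top,
      (xw_restrict v le_rfl haa' ha'b).trans_lt hfin.lt_top⟩)).ne, fun hlt => ?_⟩
    have hlt' : a' < b := by
      refine lt_min ?_ hlt
      exact (min_le_left _ _).trans_lt (by linarith)
    exact ((hw_le_xw ⟨haa', hlt'⟩ v).trans_lt hfin.lt_top).ne

/-- Solutions are Hölder continuous in the interaction picture. -/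
theorem IsIntSol.exists_hw_sub_le (hW : Continuous W) (h : DuhBound φ W ε Nhat s γ η c C)
    (hη : 0 < η) (hC : C ≠ ⊤) (hγ : 0 < γ) (hσ : s ≤ σ) {T : ℝ} (hT1 : T ≤ 1)
    {f : Coeffs d} {v : ℝ → Coeffs d} (hv : IsIntSol φ W ε Nhat 0 T f v)
    (hvt : xw (dyW s) 0 T v ≠ ⊤) (hvσ : xw (dyW σ) 0 T v ≠ ⊤) :
    ∃ K : ℝ≥0∞, K ≠ ⊤ ∧ ∀ t ∈ Ico 0 T, ∀ t' ∈ Ico 0 T,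
      hw (dyW σ) (v t' - v t) ≤ ENNReal.ofReal (2 * |t' - t|) ^ γ * K := by
  set B := xw (dyW s) 0 T v with hB
  have hr : 0 ≤ σ - s := sub_nonneg.2 hσ
  have hsplit : dyW σ = fun n => dyW (σ - s) n * dyW s n := funext fun n => by
    rw [dyW_mul, sub_add_cancel]
  refine ⟨duhConst m η c C (dyW (σ - s) c) * (m * B ^ (m - 1)) * xw (dyW σ) 0 T v,
    ENNReal.mul_ne_top (ENNReal.mul_ne_top (duhConst_ne_top hη hC (dyW_ne_top _ _))
      (ENNReal.mul_ne_top (ENNReal.natCast_ne_top m) (ENNReal.pow_ne_top hvt))) hvσ, ?_⟩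
  have key : ∀ t ∈ Ico 0 T, ∀ t' ∈ Ico 0 T, t < t' →
      hw (dyW σ) (v t' - v t) ≤ ENNReal.ofReal (2 * |t' - t|) ^ γ *
        (duhConst m η c C (dyW (σ - s) c) * (m * B ^ (m - 1)) * xw (dyW σ) 0 T v) := by
    intro t ht t' ht' hlt
    set b := min (t + 2 * (t' - t)) T with hb
    have hbT : b ≤ T := min_le_right _ _
    have ht'b : t' < b := lt_min (by linarith) ht'.2
    have htb : t ≤ b := (hlt.trans ht'b).le
    have hres := (hv.restart hW hvt ht).mono hbT
    have e : v t' - v t = -duhamel φ W ε Nhat t (fun _ => v) t' := by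
      rw [hres.eq ⟨hlt.le, ht'b⟩]
      abel
    have e2 : hw (dyW σ) (v t' - v t) = hw (dyW σ) (duhamel φ W ε Nhat t (fun _ => v) t') := by
      rw [e]
      exact hw_congr fun k => by rw [Pi.neg_apply, enorm_neg]
    rw [e2]
    have hest := xw_duhamel_tame_le h hη hC hγ.le ht.1 htb (hbT.trans hT1) (slowWeight_dyW hr c)
      hvt (xw_restrict v ht.1 htb hbT)
    rw [← hsplit] at hest
    refine (hw_le_xw ⟨hlt.le, ht'b⟩ _).trans (hest.trans ?_)
    rw [mul_assoc]
    refine mul_le_mul' ?_ (mul_le_mul' le_rfl (xw_restrict v ht.1 htb hbT))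
    refine ENNReal.rpow_le_rpow (ENNReal.ofReal_le_ofReal ?_) hγ.le
    rw [abs_of_pos (by linarith)]
    linarith [min_le_left (t + 2 * (t' - t)) T]
  intro t ht t' ht'
  rcases lt_trichotomy t t' with h1 | h1 | h1
  · exact key t ht t' ht' h1
  · subst h1
    have : hw (dyW σ) (v t - v t) = 0 := by
      rw [sub_self, hw_eq]; simp [l2]
    rw [this]
    exact zero_le
  · have h2 := key t' ht' t ht h1
    rw [abs_sub_comm] at h2
    refine le_trans (le_of_eq (hw_congr fun k => ?_)) h2
    rw [Pi.sub_apply, Pi.sub_apply, ← enorm_neg, neg_sub]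

end persistence


/-! ### The linear propagator and the interaction picture -/

section interaction
variable {d m : ℕ} {φ : (Fin d → ℝ) → ℝ} {W : ℝ → ℝ} {ε : Fin (m + 1) → ℤˣ}
  {Nhat : (Fin (m + 1) → Fin d → ℤ) → ℂ} {s σ γ η : ℝ} {c : ℕ} {C : ℝ≥0∞}

theorem propagator_propagator (φ : (Fin d → ℝ) → ℝ) (x y : ℝ) (a : Coeffs d) :
    propagator φ x (propagator φ y a) = propagator φ (x + y) a := by
  funext k
  simp only [propagator]
  rw [← mul_assoc, ← Complex.exp_add]
  congr 2
  push_cast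
  ring

theorem propagator_zero (φ : (Fin d → ℝ) → ℝ) (a : Coeffs d) : propagator φ 0 a = a := by
  funext k
  simp [propagator]

theorem propagator_neg_self (φ : (Fin d → ℝ) → ℝ) (x : ℝ) (a : Coeffs d) :
    propagator φ x (propagator φ (-x) a) = a := by
  rw [propagator_propagator, add_neg_cancel, propagator_zero]

theorem propagator_neg_self' (φ : (Fin d → ℝ) → ℝ) (x : ℝ) (a : Coeffs d) :
    propagator φ (-x) (propagator φ x a) = a := by
  rw [propagator_propagator, neg_add_cancel, propagator_zero]

theorem propagator_sub (φ : (Fin d → ℝ) → ℝ) (x : ℝ) (a b : Coeffs d) :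
    propagator φ x (a - b) = propagator φ x a - propagator φ x b := by
  funext k
  simp [propagator, mul_sub]

theorem enorm_propagator (φ : (Fin d → ℝ) → ℝ) (x : ℝ) (a : Coeffs d) (k : Fin d → ℤ) :
    ‖propagator φ x a k‖ₑ = ‖a k‖ₑ := by
  rw [← ofReal_norm, ← ofReal_norm]
  unfold propagator
  rw [norm_mul, mul_comm Complex.I, Complex.norm_exp_ofReal_mul_I, one_mul]

theorem hw_propagator (φ : (Fin d → ℝ) → ℝ) (w : ℕ → ℝ≥0∞) (x : ℝ) (a : Coeffs d) :
    hw w (propagator φ x a) = hw w a := hw_congr fun k => enorm_propagator φ x a k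

theorem hw_add_le (w : ℕ → ℝ≥0∞) (a b : Coeffs d) : hw w (a + b) ≤ hw w a + hw w b := by
  simp_rw [hw_eq]
  refine le_trans (l2_mono fun k => ?_) (l2_add_le _ _)
  rw [← mul_add]
  exact mul_le_mul' le_rfl (enorm_add_le _ _)

/-- Strong continuity of the unitary group, by dominated convergence. -/
theorem tendsto_hw_propagator_sub {ι : Type*} {l : Filter ι} [l.IsCountablyGenerated]
    (φ : (Fin d → ℝ) → ℝ) {w : ℕ → ℝ≥0∞} (hw0 : ∀ n, w n ≠ ⊤) {a : Coeffs d} (ha : hw w a ≠ ⊤)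
    {x : ι → ℝ} {y : ℝ} (hx : Tendsto x l (𝓝 y)) :
    Tendsto (fun i => hw w (propagator φ (x i) a - propagator φ y a)) l (𝓝 0) := by
  have hsum : ∑' k, (w (lvl k) * ‖a k‖ₑ) ^ 2 ≠ ⊤ := by
    have h := ENNReal.pow_ne_top (n := 2) ha
    rwa [hw_eq, l2_sq] at h
  have key : Tendsto (fun i => ∑' k, (w (lvl k) *
      ‖(propagator φ (x i) a - propagator φ y a) k‖ₑ) ^ 2) l (𝓝 0) := by
    have h := tendsto_lintegral_filter_of_dominated_convergence (μ := Measure.count) (l := l)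
      (F := fun i (k : Fin d → ℤ) => (w (lvl k) *
        ‖(propagator φ (x i) a - propagator φ y a) k‖ₑ) ^ 2) (f := fun _ => 0)
      (fun k => 4 * (w (lvl k) * ‖a k‖ₑ) ^ 2)
      (Eventually.of_forall fun i => measurable_of_countable _)
      (Eventually.of_forall fun i => Eventually.of_forall fun k => ?_) ?_
      (Eventually.of_forall fun k => ?_)
    · simpa [lintegral_count] using h
    · have h1 : ‖(propagator φ (x i) a - propagator φ y a) k‖ₑ ≤ 2 * ‖a k‖ₑ := by
        rw [Pi.sub_apply]
        refine enorm_sub_le.trans ?_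
        rw [enorm_propagator, enorm_propagator, two_mul]
      calc _ ≤ (w (lvl k) * (2 * ‖a k‖ₑ)) ^ 2 :=
            pow_le_pow_left' (mul_le_mul' le_rfl h1) 2
        _ = _ := by ring
    · rw [lintegral_count, ENNReal.tsum_mul_left]
      exact ENNReal.mul_ne_top (by simp) hsum
    · have h1 : Tendsto (fun i => (propagator φ (x i) a - propagator φ y a) k) l (𝓝 0) := by
        have h2 : Continuous fun t : ℝ => propagator φ t a k := by
          unfold propagator
          fun_prop
        have h3 := (h2.tendsto y).comp hx
        simpa using h3.sub_const (propagator φ y a k)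
      have h2 : Tendsto (fun i => ‖(propagator φ (x i) a - propagator φ y a) k‖ₑ) l (𝓝 0) := by
        simpa using h1.enorm
      have h3 := ENNReal.Tendsto.const_mul h2 (Or.inr (hw0 (lvl k)))
      have h4 := ENNReal.Tendsto.pow (n := 2) h3
      simpa using h4
  have h := (ENNReal.continuous_rpow_const (y := 1 / 2)).tendsto 0 |>.comp key
  rw [ENNReal.zero_rpow_of_pos (by norm_num)] at h
  refine h.congr fun i => ?_
  rw [hw_eq]
  rfl

theorem xNorm_eq_xw (φ : (Fin d → ℝ) → ℝ) (W : ℝ → ℝ) (s T : ℝ) (u : ℝ → Coeffs d) :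
    xNorm φ W s T u = xw (dyW s) 0 T (fun t => propagator φ (W t) (u t)) := by
  unfold xNorm xw l2
  simp_rw [mul_pow, dyW_sq]

theorem nonlin_dyadicProj (n : Fin m → ℕ) (x : Fin m → Coeffs d) (k₀ : Fin d → ℤ) :
    nonlin ε Nhat (fun j => dyadicProj (n j) (x j)) k₀ = dform ε Nhat n x k₀ := by
  unfold nonlin
  rw [tsum_eq_sum (s := Fintype.piFinset fun j => shell d (n j))]
  · have h := dform_congr (ε := ε) Nhat n (x := fun j => dyadicProj (n j) (x j)) (y := x)
      (fun j k hk => by rw [dyadicProj_apply, if_pos hk]) k₀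
    rw [← h]
    rfl
  · intro k hk
    rw [Fintype.mem_piFinset] at hk
    push Not at hk
    obtain ⟨j, hj⟩ := hk
    refine Set.indicator_apply_eq_zero.2 fun _ => ?_
    rw [Finset.prod_eq_zero (Finset.mem_univ j), mul_zero]
    rw [Fin.cons_succ]
    change signConj _ (dyadicProj (n j) (x j) (k j)) = 0
    rw [dyadicProj_apply, if_neg (by simpa using hj), signConj_zero]

theorem signConj_exp (e : ℤˣ) (x : ℝ) : signConj e (Complex.exp (Complex.I * x)) =
    Complex.exp (Complex.I * (((e : ℤ) : ℝ) * x : ℝ)) := by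
  unfold signConj
  rcases Int.units_eq_one_or e with rfl | rfl
  · simp
  · rw [if_neg (by decide), ← Complex.exp_conj]
    simp

/-- Conjugation of the nonlinearity by the linear flow. The sign `ε 0 = -1` makes the phase of the
output frequency appear with a plus sign. -/
theorem dform_modMult_propagator (hε : ε 0 = -1) (τ : ℝ) (n : Fin m → ℕ) (x : Fin m → Coeffs d)
    (k₀ : Fin d → ℤ) :
    dform ε (modMult φ W ε Nhat τ) n (fun j => propagator φ (W τ) (x j)) k₀ =
      Complex.exp (Complex.I * ((W τ * atFreq φ k₀ : ℝ) : ℂ)) * dform ε Nhat n x k₀ := by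
  unfold dform
  rw [Finset.mul_sum]
  refine Finset.sum_congr rfl fun k _ => ?_
  by_cases hG : (Fin.cons k₀ k : Fin (m + 1) → Fin d → ℤ) ∈ Gam d ε
  · simp only [Set.indicator_of_mem hG, Fin.cons_succ, propagator, signConj_mul, signConj_exp,
      modMult, Finset.prod_mul_distrib]
    rw [← Complex.exp_sum]
    have hres : Complex.exp (-(Complex.I * ((W τ * resonance φ ε (Fin.cons k₀ k) : ℝ) : ℂ))) *
        Complex.exp (∑ j : Fin m,
          Complex.I * ((((ε j.succ : ℤ) : ℝ) * (W τ * atFreq φ (k j)) : ℝ) : ℂ)) =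
        Complex.exp (Complex.I * ((W τ * atFreq φ k₀ : ℝ) : ℂ)) := by
      rw [← Complex.exp_add, ← Finset.mul_sum]
      congr 1
      unfold resonance
      rw [Fin.sum_univ_succ, hε]
      simp only [Fin.cons_zero, Fin.cons_succ]
      push_cast
      rw [mul_add, mul_add, Finset.mul_sum]
      simp_rw [mul_left_comm _ (W τ : ℂ)]
      ring
    rw [← hres]
    ring
  · simp only [Set.indicator_of_notMem hG, mul_zero]

theorem propagator_nonlin (hε : ε 0 = -1) (t τ : ℝ) (n : Fin m → ℕ) (u : Coeffs d)
    (k₀ : Fin d → ℤ) :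
    propagator φ (-(W t - W τ)) (nonlin ε Nhat fun j => dyadicProj (n j) u) k₀ =
      Complex.exp (Complex.I * ((-W t * atFreq φ k₀ : ℝ) : ℂ)) *
        dform ε (modMult φ W ε Nhat τ) n (fun _ => propagator φ (W τ) u) k₀ := by
  rw [dform_modMult_propagator hε, ← mul_assoc, ← Complex.exp_add]
  unfold propagator
  rw [nonlin_dyadicProj n fun _ => u]
  congr 2
  push_cast
  ring

/-- Mild solutions correspond to solutions of the integral equation in the interaction picture. -/
theorem isMildSolution_iff (hε : ε 0 = -1) {T : ℝ} {u₀ : Coeffs d} {u : ℝ → Coeffs d} :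
    IsMildSolution φ W ε Nhat u₀ T u ↔
      IsIntSol φ W ε Nhat 0 T (propagator φ (W 0) u₀) (fun t => propagator φ (W t) (u t)) := by
  unfold IsMildSolution IsIntSol
  refine forall₂_congr fun t _ => forall_congr' fun k₀ => ?_
  have e1 : (fun n : Fin m → ℕ => ∫ τ in (0 : ℝ)..t,
      propagator φ (-(W t - W τ)) (nonlin ε Nhat fun j => dyadicProj (n j) (u τ)) k₀) =
      fun n => Complex.exp (Complex.I * ((-W t * atFreq φ k₀ : ℝ) : ℂ)) *
        duh φ W ε Nhat 0 n (fun _ t => propagator φ (W t) (u t)) t k₀ := by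
    funext n
    simp_rw [propagator_nonlin hε]
    rw [intervalIntegral.integral_const_mul]
    rfl
  have e2 : propagator φ (-(W t - W 0)) u₀ k₀ - u t k₀ =
      Complex.exp (Complex.I * ((-W t * atFreq φ k₀ : ℝ) : ℂ)) *
        (propagator φ (W 0) u₀ k₀ - propagator φ (W t) (u t) k₀) := by
    have h1 : propagator φ (-(W t - W 0)) u₀ = propagator φ (-W t) (propagator φ (W 0) u₀) := by
      rw [propagator_propagator]; congr 1; ring
    have h2 : u t = propagator φ (-W t) (propagator φ (W t) (u t)) :=
      (propagator_neg_self' _ _ _).symm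
    rw [h1, mul_sub]
    congr 1
    exact congrFun h2 k₀
  rw [e1, e2, hasSum_mul_left_iff (Complex.exp_ne_zero _)]

/-- A mild solution which lies in the lower space lies in the higher one if its data do. -/
theorem IsMildSolution.inSolutionSpace (hW : Continuous W) (h : DuhBound φ W ε Nhat s γ η c C)
    (hη : 0 < η) (hC : C ≠ ⊤) (hγ : 0 < γ) (hε : ε 0 = -1) (hσ : s ≤ σ) {T : ℝ} (hT : 0 ≤ T)
    (hT1 : T ≤ 1) {u₀ : Coeffs d} {u : ℝ → Coeffs d} (hu : IsMildSolution φ W ε Nhat u₀ T u)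
    (hx : xNorm φ W s T u < ⊤) (hu₀ : sobolevNorm σ u₀ < ⊤) : InSolutionSpace φ W σ T u := by
  rw [isMildSolution_iff hε] at hu
  rw [xNorm_eq_xw] at hx
  set v : ℝ → Coeffs d := fun t => propagator φ (W t) (u t) with hv
  have huv : ∀ t, u t = propagator φ (-W t) (v t) := fun t => (propagator_neg_self' _ _ _).symm
  have hσfin : xw (dyW σ) 0 T v ≠ ⊤ := hu.xw_higher_ne_top hW h hη hC hγ hσ hT hT1 hx.ne (by
    rw [hw_propagator]
    exact (hw_ne_top_iff σ u₀).2 hu₀)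
  have hfin : ∀ t ∈ Ico 0 T, hw (dyW σ) (v t) ≠ ⊤ := fun t ht =>
    ((hw_le_xw ht v).trans_lt hσfin.lt_top).ne
  refine ⟨fun t ht => ?_, fun t ht => ?_, ?_⟩
  · rw [← hw_ne_top_iff, huv, hw_propagator]
    exact hfin t ht
  · obtain ⟨K, hK, hhol⟩ := hu.exists_hw_sub_le hW h hη hC hγ hσ hT1 hx.ne hσfin
    have h1 : Tendsto (fun τ => ENNReal.ofReal (2 * |τ - t|) ^ γ * K) (𝓝[Ico 0 T] t) (𝓝 0) := by
      have h2 : Continuous fun τ : ℝ => ENNReal.ofReal (2 * |τ - t|) ^ γ :=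
        ENNReal.continuous_rpow_const.comp (ENNReal.continuous_ofReal.comp (by fun_prop))
      have h3 := (h2.tendsto t).mono_left (nhdsWithin_le_nhds (s := Ico 0 T))
      simp only [sub_self, abs_zero, mul_zero, ENNReal.ofReal_zero,
        ENNReal.zero_rpow_of_pos hγ] at h3
      simpa using ENNReal.Tendsto.mul_const h3 (Or.inr hK)
    have h2 : Tendsto (fun τ => hw (dyW σ) (propagator φ (-W τ) (v t) - propagator φ (-W t) (v t)))
        (𝓝[Ico 0 T] t) (𝓝 0) :=
      tendsto_hw_propagator_sub φ (fun n => dyW_ne_top σ n) (hfin t ht)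
        ((hW.neg.tendsto t).mono_left nhdsWithin_le_nhds)
    have h3 : Tendsto (fun τ => ENNReal.ofReal (2 ^ |σ|) * (ENNReal.ofReal (2 * |τ - t|) ^ γ * K +
        hw (dyW σ) (propagator φ (-W τ) (v t) - propagator φ (-W t) (v t))))
        (𝓝[Ico 0 T] t) (𝓝 0) := by
      have h4 := ENNReal.Tendsto.const_mul (a := ENNReal.ofReal (2 ^ |σ|)) (h1.add h2)
        (Or.inr ENNReal.ofReal_ne_top)
      simpa using h4
    refine tendsto_of_tendsto_of_tendsto_of_le_of_le' tendsto_const_nhds h3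
      (Eventually.of_forall fun _ => zero_le) ?_
    filter_upwards [self_mem_nhdsWithin] with τ hτ
    refine (sobolevNorm_le_hw σ _).trans (mul_le_mul' le_rfl ?_)
    have e : u τ - u t = propagator φ (-W τ) (v τ - v t) +
        (propagator φ (-W τ) (v t) - propagator φ (-W t) (v t)) := by
      rw [propagator_sub, huv τ, huv t]
      abel
    rw [e]
    refine (hw_add_le _ _ _).trans (add_le_add ?_ le_rfl)
    rw [hw_propagator]
    exact hhol t ht τ hτ
  · rw [xNorm_eq_xw]
    exact hσfin.lt_top

end interaction


/-! ### Real-valued solutions -/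

section real
variable {d m : ℕ} {φ : (Fin d → ℝ) → ℝ} {W : ℝ → ℝ} {ε : Fin (m + 1) → ℤˣ}
  {Nhat : (Fin (m + 1) → Fin d → ℤ) → ℂ} {s γ η : ℝ} {c : ℕ} {C : ℝ≥0∞}

theorem IsRealValued.propagator {a : Coeffs d} (ha : IsRealValued a)
    (hφ : ∀ k : Fin d → ℤ, atFreq φ (-k) = -atFreq φ k) (x : ℝ) :
    IsRealValued (propagator φ x a) := by
  intro k
  unfold ModDisp.propagator
  rw [ha k, hφ, map_mul, ← Complex.exp_conj]
  congr 2
  simp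

theorem IsRealValued.sub {a b : Coeffs d} (ha : IsRealValued a) (hb : IsRealValued b) :
    IsRealValued (a - b) := fun k => by
  rw [Pi.sub_apply, Pi.sub_apply, map_sub, ha, hb]

theorem IsRealValued.of_tendsto {ι : Type*} {l : Filter ι} [l.NeBot] {A : ι → Coeffs d}
    {a : Coeffs d} (h : ∀ k, Tendsto (fun i => A i k) l (𝓝 (a k))) (hA : ∀ i, IsRealValued (A i)) :
    IsRealValued a := by
  intro k
  refine tendsto_nhds_unique (h (-k)) ?_
  simp_rw [fun i => hA i k]
  exact (Complex.continuous_conj.tendsto _).comp (h k)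

theorem lvl_neg (k : Fin d → ℤ) : lvl (-k) = lvl k := by
  have h : freqNorm (-k) = freqNorm k := by simp [freqNorm]
  refine le_antisymm ?_ ?_
  · rw [lvl_le_iff, h]; exact freqNorm_le_lvl k
  · rw [lvl_le_iff, ← h]; exact freqNorm_le_lvl (-k)

/-- The sum of the localized forms over a box of levels is the nonlinearity of a low frequency
truncation. -/
theorem sum_dform_eq_nonlin (u : Coeffs d) (M : ℕ) (k₀ : Fin d → ℤ) :
    ∑ n ∈ Fintype.piFinset fun _ : Fin m => Finset.range M, dform ε Nhat n (fun _ => u) k₀ =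
      nonlin ε Nhat (fun _ => fun k => if lvl k < M then u k else 0) k₀ := by
  classical
  set low : Finset (Fin d → ℤ) := (Finset.range M).biUnion (shell d) with hlow
  have hmem : ∀ k, k ∈ low ↔ lvl k < M := fun k => by simp [hlow]
  unfold nonlin
  rw [tsum_eq_sum (s := Fintype.piFinset fun _ : Fin m => low)]
  · rw [← Finset.sum_fiberwise_of_maps_to (g := fun (k : Fin m → Fin d → ℤ) j => lvl (k j))
      (t := Fintype.piFinset fun _ : Fin m => Finset.range M)]
    · refine Finset.sum_congr rfl fun n hn => ?_
      unfold dform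
      have hset : (Fintype.piFinset fun j => shell d (n j)) =
          (Fintype.piFinset fun _ : Fin m => low).filter fun k => (fun j => lvl (k j)) = n := by
        ext k
        simp only [Fintype.mem_piFinset, mem_shell, Finset.mem_filter, hmem, funext_iff]
        refine ⟨fun h => ⟨fun j => ?_, h⟩, fun h => h.2⟩
        rw [h j]
        exact Finset.mem_range.1 (Fintype.mem_piFinset.1 hn j)
      rw [hset]
      refine Finset.sum_congr rfl fun k hk => ?_
      have hk' := Fintype.mem_piFinset.1 (Finset.mem_filter.1 hk).1
      simp only [Set.indicator, Fin.cons_succ]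
      rw [Finset.prod_congr rfl fun j _ => by rw [← if_pos (c := lvl (k j) < M) (t := u (k j))
        (e := 0) ((hmem _).1 (hk' j))]]
    · intro k hk
      rw [Fintype.mem_piFinset] at hk ⊢
      exact fun j => Finset.mem_range.2 ((hmem _).1 (hk j))
  · intro k hk
    rw [Fintype.mem_piFinset] at hk
    push Not at hk
    obtain ⟨j, hj⟩ := hk
    refine Set.indicator_apply_eq_zero.2 fun _ => ?_
    rw [Finset.prod_eq_zero (Finset.mem_univ j), mul_zero]
    simp only [Fin.cons_succ]
    rw [if_neg (by rwa [hmem] at hj), signConj_zero]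

theorem isRealValued_sum_dform (hreal : IsRealEquation φ ε Nhat) {u : Coeffs d}
    (hu : IsRealValued u) (M : ℕ) : IsRealValued fun k₀ =>
      ∑ n ∈ Fintype.piFinset fun _ : Fin m => Finset.range M,
        dform ε Nhat n (fun _ => u) k₀ := by
  have h := hreal.2 (fun k => if lvl k < M then u k else 0) ?_ ?_
  · intro k₀
    simp only [sum_dform_eq_nonlin]
    exact h k₀
  · refine (finite_freqNorm_le d (2 ^ M)).subset fun k hk => ?_
    have h1 : lvl k < M := by
      by_contra h1
      exact hk (if_neg h1)
    exact (lvl_le_iff k M).1 h1.le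
  · intro k
    simp only [lvl_neg]
    split_ifs
    · exact hu k
    · simp

/-- Real-valued inputs lead to real-valued Duhamel integrals: the sum over the levels is the limit
of the sums over boxes, which come from the nonlinearity of a trigonometric polynomial. -/
theorem isRealValued_duhamel (hW : Continuous W) (h : DuhBound φ W ε Nhat s γ η c C)
    (hη : 0 < η) (hC : C ≠ ⊤) (hγ : 0 ≤ γ) (hε : ε 0 = -1) (hreal : IsRealEquation φ ε Nhat)
    {T : ℝ} (hT1 : T ≤ 1) {v : ℝ → Coeffs d} (hvt : xw (dyW s) 0 T v ≠ ⊤)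
    (hv : ∀ t ∈ Ico 0 T, IsRealValued (v t)) {t : ℝ} (ht : t ∈ Ico 0 T) :
    IsRealValued (duhamel φ W ε Nhat 0 (fun _ => v) t) := by
  have hbox : Tendsto (fun M : ℕ => Fintype.piFinset fun _ : Fin m => Finset.range M)
      atTop atTop := by
    refine tendsto_atTop_finset_of_monotone (fun M M' hM => ?_) fun n => ?_
    · exact Fintype.piFinset_subset _ _ fun _ => Finset.range_mono hM
    · refine ⟨∑ j, n j + 1, Fintype.mem_piFinset.2 fun j => Finset.mem_range.2 ?_⟩
      exact Nat.lt_succ_of_le (Finset.single_le_sum (fun _ _ => Nat.zero_le _) (Finset.mem_univ j))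
  refine IsRealValued.of_tendsto (l := atTop) (A := fun M k₀ =>
    ∑ n ∈ Fintype.piFinset fun _ : Fin m => Finset.range M, duh φ W ε Nhat 0 n (fun _ => v) t k₀)
    (fun k => ((summable_duh h hη hC hγ le_rfl hT1 (fun _ => hvt) ht k).hasSum).comp hbox) ?_
  intro M
  have hint : ∀ n k₀, IntervalIntegrable (fun τ => dform ε (modMult φ W ε Nhat τ) n
      (fun _ : Fin m => v τ) k₀) volume 0 t := fun n k₀ =>
    intervalIntegrable_integrand (z := fun _ => v) hW (fun j => uNorm_ne_top_of_xw hvt _) k₀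
      ⟨le_rfl, ht.1.trans ht.2.le⟩ ⟨ht.1, ht.2.le⟩
  have hpt : ∀ τ ∈ Ico 0 T, IsRealValued fun k₀ =>
      ∑ n ∈ Fintype.piFinset fun _ : Fin m => Finset.range M,
        dform ε (modMult φ W ε Nhat τ) n (fun _ => v τ) k₀ := by
    intro τ hτ
    have h1 := (isRealValued_sum_dform hreal ((hv τ hτ).propagator hreal.1 (-W τ)) M).propagator
      hreal.1 (W τ)
    convert h1 using 1
    funext k₀
    simp only [ModDisp.propagator]
    rw [Finset.mul_sum]
    refine Finset.sum_congr rfl fun n _ => ?_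
    rw [← dform_modMult_propagator hε τ n (fun _ => ModDisp.propagator φ (-W τ) (v τ)) k₀,
      propagator_neg_self]
  intro k₀
  simp only [duh]
  rw [← intervalIntegral.integral_finsetSum fun n _ => hint n (-k₀),
    ← intervalIntegral.integral_finsetSum fun n _ => hint n k₀,
    intervalIntegral.integral_of_le ht.1, intervalIntegral.integral_of_le ht.1, ← integral_conj]
  exact setIntegral_congr_fun measurableSet_Ioc fun τ hτ => hpt τ ⟨hτ.1.le, hτ.2.trans_lt ht.2⟩ k₀

theorem isRealValued_picard (hm : 2 ≤ m) (hW : Continuous W)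
    (h : DuhBound φ W ε Nhat s γ η c C) (hη : 0 < η) (hC : C ≠ ⊤) (hγ : 0 ≤ γ) (hε : ε 0 = -1)
    (hreal : IsRealEquation φ ε Nhat) {T : ℝ} (hT : 0 ≤ T) (hT1 : T ≤ 1) {r : ℝ≥0∞} (hr : r ≠ ⊤)
    (hlip : lipConst m η γ c C T (2 * r) ≤ 1 / 2) {f : Coeffs d} (hf : hw (dyW s) f ≤ r)
    (hfr : IsRealValued f) (i : ℕ) :
    ∀ t ∈ Ico 0 T, IsRealValued (picard φ W ε Nhat f i t) := by
  induction i with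
  | zero => exact fun _ _ => hfr
  | succ i ih =>
    have hfin : xw (dyW s) 0 T (picard φ W ε Nhat f i) ≠ ⊤ :=
      ((xw_picard_le hm h hη hC hγ hT hT1 hr hlip hf i).trans_lt
        (ENNReal.mul_lt_top (by simp) hr.lt_top)).ne
    exact fun t ht => hfr.sub (isRealValued_duhamel hW h hη hC hγ hε hreal hT1 hfin ih ht)

end real

end ModDisp

end

theorem theorem1p4
    (d m : ℕ) (hm : 2 ≤ m)
    -- the path
    (W : ℝ → ℝ) (ρ γ : ℝ) (hρ : 0 < ρ) (hγ : γ ∈ Set.Ioo (1 / 2 : ℝ) 1)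
    (hW : ModDisp.IsIrregular ρ γ W)
    -- the dispersion
    (φ : (Fin d → ℝ) → ℝ) (hφ : Continuous φ)
    -- the algebraic nonlinearity
    (ε : Fin (m + 1) → ℤˣ) (hε : ε 0 = -1) (Nhat : (Fin (m + 1) → Fin d → ℤ) → ℂ)
    (β : Fin (m + 1) → ℝ) (hβ : ModDisp.SymbolBound ε Nhat β)
    (α₁ α₂ : ℝ) (hα : ModDisp.StronglyNonResonant φ ε Nhat α₁ α₂)
    (s : ℝ) (hs : ModDisp.EnoughIrregularity d α₁ α₂ β s ρ) :
    ∃ (T : ℝ≥0 → ℝ) (K : ℝ≥0), (∀ R, 0 < T R) ∧ ∀ R : ℝ≥0,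
      -- existence, uniqueness, persistence of regularity
      (∀ u₀ : ModDisp.Coeffs d, ModDisp.sobolevNorm s u₀ ≤ R →
        ∃ u : ℝ → ModDisp.Coeffs d,
          ModDisp.IsSolution φ W ε Nhat s u₀ (T R) u ∧
          (∀ v : ℝ → ModDisp.Coeffs d, ModDisp.IsSolution φ W ε Nhat s u₀ (T R) v →
            ∀ t ∈ Set.Ico 0 (T R), v t = u t) ∧
          u 0 = u₀ ∧
          (∀ σ : ℝ, s ≤ σ → ModDisp.sobolevNorm σ u₀ < ∞ →
            ModDisp.InSolutionSpace φ W σ (T R) u) ∧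
          (ModDisp.IsRealEquation φ ε Nhat → ModDisp.IsRealValued u₀ →
            ∀ t ∈ Set.Ico 0 (T R), ModDisp.IsRealValued (u t))) ∧
      -- Lipschitz continuity of the flow map
      (∀ (u₀ v₀ : ModDisp.Coeffs d) (u v : ℝ → ModDisp.Coeffs d),
        ModDisp.sobolevNorm s u₀ ≤ R → ModDisp.sobolevNorm s v₀ ≤ R →
        ModDisp.IsSolution φ W ε Nhat s u₀ (T R) u →
        ModDisp.IsSolution φ W ε Nhat s v₀ (T R) v →
        ModDisp.supNorm s (T R) (u - v) + ModDisp.xNorm φ W s (T R) (u - v) ≤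
          K * ModDisp.sobolevNorm s (u₀ - v₀)) := by
  obtain ⟨hγ1, -⟩ := hγ
  have hγ0 : 0 < γ := by linarith
  have hWc : Continuous W := hW.continuous
  obtain ⟨η, c, C, hη, hC, h⟩ :=
    ModDisp.exists_duhBound (φ := φ) (ε := ε) (Nhat := Nhat) hρ hγ1 hm hW hβ hα hs
  set q : ℝ≥0∞ := ENNReal.ofReal (2 ^ |s|) with hq
  have hqt : q ≠ ⊤ := ENNReal.ofReal_ne_top
  have hrt : ∀ R : ℝ≥0, q * R ≠ ⊤ := fun R => ENNReal.mul_ne_top hqt ENNReal.coe_ne_top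
  -- on a ball of radius twice the size of the data the iteration is a contraction up to time `T R`
  choose T hT0 hT1 hTlip using fun R : ℝ≥0 => ModDisp.exists_lipConst_le (m := m) (c := c) hη hC hγ0
    (B := 2 * (q * R)) (ENNReal.mul_ne_top (by simp) (hrt R))
  have hdata : ∀ (R : ℝ≥0) (u₀ : ModDisp.Coeffs d), ModDisp.sobolevNorm s u₀ ≤ R →
      ModDisp.hw (ModDisp.dyW s) (ModDisp.propagator φ (W 0) u₀) ≤ q * R := fun R u₀ hu₀ => by
    rw [ModDisp.hw_propagator]
    exact (ModDisp.hw_le_sobolevNorm s u₀).trans (mul_le_mul' le_rfl hu₀)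
  refine ⟨T, ((q + 1) * (2 * q)).toNNReal, hT0, fun R => ⟨fun u₀ hu₀ => ?_,
    fun u₀ v₀ u v hu₀ hv₀ hu hv => ?_⟩⟩
  · obtain ⟨v, hv, hvB, hlim⟩ := ModDisp.exists_isIntSol hm hWc h hη hC hγ0.le (hT0 R).le (hT1 R)
      (hrt R) (hTlip R _ le_rfl) (hdata R u₀ hu₀)
    have hvt : ModDisp.xw (ModDisp.dyW s) 0 (T R) v ≠ ⊤ :=
      (hvB.trans_lt (ENNReal.mul_lt_top (by simp) (hrt R).lt_top)).ne
    set u : ℝ → ModDisp.Coeffs d := fun t => ModDisp.propagator φ (-W t) (v t) with hu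
    have huv : (fun t => ModDisp.propagator φ (W t) (u t)) = v :=
      funext fun t => ModDisp.propagator_neg_self φ (W t) (v t)
    have hmild : ModDisp.IsMildSolution φ W ε Nhat u₀ (T R) u := by
      rw [ModDisp.isMildSolution_iff hε, huv]
      exact hv
    have hx : ModDisp.xNorm φ W s (T R) u < ⊤ := by
      rw [ModDisp.xNorm_eq_xw, huv]
      exact hvt.lt_top
    have hspace : ∀ σ : ℝ, s ≤ σ → ModDisp.sobolevNorm σ u₀ < ∞ →
        ModDisp.InSolutionSpace φ W σ (T R) u := fun σ hσ hσ₀ =>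
      hmild.inSolutionSpace hWc h hη hC hγ0 hε hσ (hT0 R).le (hT1 R) hx hσ₀
    refine ⟨u, ⟨hspace s le_rfl (hu₀.trans_lt ENNReal.coe_lt_top), hmild⟩, fun v' hv' t ht => ?_, ?_,
      hspace, fun hreal hreal₀ t ht => ?_⟩
    · have hv'x := hv'.1.mem_x.ne
      rw [ModDisp.xNorm_eq_xw] at hv'x
      have huniq := ModDisp.IsIntSol.unique hWc h hη hC hγ0 (hT0 R).le (hT1 R)
        ((ModDisp.isMildSolution_iff hε).1 hv'.2) hv hv'x hvt t ht
      change v' t = ModDisp.propagator φ (-W t) (v t)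
      rw [← huniq]
      exact (ModDisp.propagator_neg_self' φ (W t) (v' t)).symm
    · rw [hu]
      simp only [hv.initial (hT0 R)]
      exact ModDisp.propagator_neg_self' φ (W 0) u₀
    · refine ModDisp.IsRealValued.propagator ?_ hreal.1 _
      exact ModDisp.IsRealValued.of_tendsto (hlim t ht) fun i => ModDisp.isRealValued_picard hm hWc h
        hη hC hγ0.le hε hreal (hT0 R).le (hT1 R) (hrt R) (hTlip R _ le_rfl) (hdata R u₀ hu₀)
        (hreal₀.propagator hreal.1 _) i t ht
  · -- by uniqueness, both solutions obey the bound of the constructed ones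
    have hbound : ∀ (u₀ : ModDisp.Coeffs d) (u : ℝ → ModDisp.Coeffs d),
        ModDisp.sobolevNorm s u₀ ≤ R → ModDisp.IsSolution φ W ε Nhat s u₀ (T R) u →
        ModDisp.xw (ModDisp.dyW s) 0 (T R) (fun t => ModDisp.propagator φ (W t) (u t)) ≤
          2 * (q * R) := by
      intro u₀ u hu₀ hu
      obtain ⟨w, hw, hwB, -⟩ := ModDisp.exists_isIntSol hm hWc h hη hC hγ0.le (hT0 R).le (hT1 R)
        (hrt R) (hTlip R _ le_rfl) (hdata R u₀ hu₀)
      have hux := hu.1.mem_x.ne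
      rw [ModDisp.xNorm_eq_xw] at hux
      refine le_trans (le_of_eq (ModDisp.xw_congr fun t ht => ?_)) hwB
      exact ModDisp.IsIntSol.unique hWc h hη hC hγ0 (hT0 R).le (hT1 R)
        ((ModDisp.isMildSolution_iff hε).1 hu.2) hw hux
        (hwB.trans_lt (ENNReal.mul_lt_top (by simp) (hrt R).lt_top)).ne t ht
    have hdiff := ModDisp.IsIntSol.xw_sub_le hWc h hη hC hγ0.le le_rfl (hT0 R).le (hT1 R)
      (ENNReal.mul_ne_top (by simp) (hrt R)) (hTlip R _ (sub_zero _).le)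
      ((ModDisp.isMildSolution_iff hε).1 hu.2) ((ModDisp.isMildSolution_iff hε).1 hv.2)
      (hbound u₀ u hu₀ hu) (hbound v₀ v hv₀ hv)
    simp_rw [← ModDisp.propagator_sub, ModDisp.hw_propagator] at hdiff
    have hx : ModDisp.xNorm φ W s (T R) (u - v) ≤ 2 * q * ModDisp.sobolevNorm s (u₀ - v₀) := by
      rw [ModDisp.xNorm_eq_xw, mul_assoc]
      exact hdiff.trans (mul_le_mul' le_rfl (ModDisp.hw_le_sobolevNorm s _))
    have hsup : ModDisp.supNorm s (T R) (u - v) ≤ q * ModDisp.xNorm φ W s (T R) (u - v) := by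
      refine iSup₂_le fun t ht => (ModDisp.sobolevNorm_le_hw s _).trans (mul_le_mul' le_rfl ?_)
      rw [ModDisp.xNorm_eq_xw, ← ModDisp.hw_propagator φ _ (W t)]
      exact ModDisp.hw_le_xw ht fun t => ModDisp.propagator φ (W t) ((u - v) t)
    rw [ENNReal.coe_toNNReal (ENNReal.mul_ne_top (ENNReal.add_ne_top.2 ⟨hqt, by simp⟩)
      (ENNReal.mul_ne_top (by simp) hqt))]
    calc _ ≤ q * ModDisp.xNorm φ W s (T R) (u - v) + ModDisp.xNorm φ W s (T R) (u - v) :=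
          add_le_add hsup le_rfl
      _ = (q + 1) * ModDisp.xNorm φ W s (T R) (u - v) := by rw [add_mul, one_mul]
      _ ≤ (q + 1) * (2 * q * ModDisp.sobolevNorm s (u₀ - v₀)) := mul_le_mul' le_rfl hx
      _ = _ := by ring
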